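/- **Setting.** Let $(M,d)$ be a complete, connected, non-compact smooth Riemannian manifold with Riemannian distance $d$, and let $G$ be a group of isometries acting on $M$ freely, properly discontinuously (for every $x\in M$ and compact $K\subset M$, $gx\in K$ for only finitely many $g\in G$) and cocompactly. A *fundamental region* is a measurable set $F\subset M$ with $\bigcup_{g\in G}gF=M$ and $F\cap gF=\emptyset$ for $g\ne \mathrm{id}$. Let $B_0$ be a bounded fundamental region and let $m$ be the Riemannian volume measure, scaled by a constant so that $m(B_0)=1$. Let $(\Omega,\mathfrak A,\mathbb P)$ be a probability space, where $\Omega$ is a compact metric space and $\mathfrak A$ is its Borel $\sigma$-field or the $\mathbb P$-completion of it (or any $\sigma$-field in between), with a measurable action $(\theta_g)_{g\in G}$ of $G$ on $\Omega$ that preserves $\mathbb P$. A *random measure* on $X$ ($X=M$ or $M\times M$) is a measurable map $\omega\mapsto\lambda^\omega$ from $\Omega$ to the locally finite measures on $X$. It is *equivariant* if $\lambda^{\theta_g\omega}=(g\,\cdot)_*\lambda^\omega$ for all $g\in G$, $\omega\in\Omega$ (diagonal action on $M\times M$), and a random measure on $M$ has *unit intensity* if $\mathbb E[\lambda^\bullet(A)]=m(A)$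 for all measurable $A\subset M$. Its *Campbell measure* is the measure $\lambda^\bullet\mathbb P(dx,d\omega)=\lambda^\omega(dx)\,\mathbb P(d\omega)$ on $X\times\Omega$. Vague convergence of measures means convergence of the integrals of all continuous compactly supported functions. Let $p\in[1,\infty)$. Assume that for all compactly supported probability measures $\lambda\ll m$ and $\mu$ on $M$ the optimal transport problem from $\lambda$ to $\mu$ with cost $d^p$ has a unique solution, and that this solution is induced by a measurable map $T$, i.e. is $(\mathrm{id},T)_*\lambda$. An *equivariant coupling* of random measures $\lambda^\bullet,\mu^\bullet$ on $M$ is an equivariant random measure $q^\bullet$ on $M\times M$ such that for $\mathbb P$-a.e. $\omega$ the marginals of $q^\omega$ are $\lambda^\omega$ and $\mu^\omega$. Its mean transportation cost is $$\mathfrak C(q^\bullet)=\sup_{B}\frac1{m(B)}\mathbb E\Big[\int_{M\times B}d^p(x,y)\,q^\bullet(dx,dy)\Big],$$ the supremum being over all sets $B=\bigcup_{g\in I}gF$ with $F$ a fundamental region and $I\subset G$ finite and non-empty. Put $\mathbb W_p^p(\lambda^\bullet,\mu^\bullet)=\inf\mathfrak C(q^\bullet)$, the infimum being over all equivariant couplings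 $q^\bullet$ of $\lambda^\bullet$ and $\mu^\bullet$; a coupling $q^\bullet$ is *optimal* if it is equivariant and attains this infimum. Let $\mathcal P_p$ be the set of equivariant random measures $\mu^\bullet$ on $M$ of unit intensity with $\mathbb W_p(m,\mu^\bullet)<\infty$. **Proposition.** Let $\mu_n^\bullet$ ($n\in\mathbb N$) and $\mu^\bullet$ be elements of $\mathcal P_p$, let $q_n^\bullet$ be an optimal coupling of $m$ and $\mu_n^\bullet$, and let $q^\bullet$ be an optimal coupling of $m$ and $\mu^\bullet$. Consider the statements i) $\mathbb W_p(\mu_n^\bullet,\mu^\bullet)\to0$ as $n\to\infty$. ii) $\mu_n^\bullet\mathbb P\to\mu^\bullet\mathbb P$ vaguely on $M\times\Omega$ and $\mathbb W_p(\mu_n^\bullet,m)\to\mathbb W_p(\mu^\bullet,m)$ as $n\to\infty$. iii) $q_n^\bullet\mathbb P\to q^\bullet\mathbb P$ vaguely on $M\times M\times\Omega$ and $\mathbb W_p(\mu_n^\bullet,m)\to\mathbb W_p(\mu^\bullet,m)$ as $n\to\infty$. iv) $q_n^\bullet\mathbb P\to q^\bullet\mathbb P$ vaguely on $M\times M\times\Omega$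 and $$\lim_{R\to\infty}\limsup_{n\to\infty}\mathbb E\Big[\int_{\complement((B_0)_R)\times B_0}d^p(x,y)\,q_n^\bullet(dx,dy)\Big]=0,$$ where $(B_0)_R$ is the $R$-neighbourhood of $B_0$. Then i) implies ii) (whether or not optimal couplings $q_n^\bullet,q^\bullet$ exist); iii) and iv) are equivalent, and either of them implies i). -/

import Mathlib

open MeasureTheory ProbabilityTheory Filter Topology Set Manifold Bundle
open scoped ENNReal NNReal Pointwise

namespace RandomTransport

noncomputable section

/-- Vague convergence of a sequence of measures: convergence of the integrals of all continuous
compactly supported functions. -/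
def VagueTendsto {X : Type*} [TopologicalSpace X] [MeasurableSpace X]
    (ν : ℕ → Measure X) (ν' : Measure X) : Prop :=
  ∀ f : X → ℝ, Continuous f → HasCompactSupport f →
    Tendsto (fun n => ∫ x, f x ∂(ν n)) atTop (𝓝 (∫ x, f x ∂ν'))

/-- A random measure on `X` modelled on `Ω`: a kernel from `Ω` to `X` all of whose values are
locally finite. -/
def IsRandomMeasure {Ω X : Type*} [MeasurableSpace Ω] [MeasurableSpace X] [TopologicalSpace X]
    (κ : Kernel Ω X) : Prop :=
  ∀ ω, IsLocallyFiniteMeasure (κ ω)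

/-- The Campbell measure `κ^ω(dx) P(dω)` of a random measure, a measure on `X × Ω`. -/
def campbell {Ω X : Type*} [MeasurableSpace Ω] [MeasurableSpace X]
    (P : Measure Ω) (κ : Kernel Ω X) : Measure (X × Ω) :=
  (P ⊗ₘ κ).map Prod.swap

/-- Equivariance: `κ^{gω}` is the push forward of `κ^ω` by `x ↦ g • x`, that is
`κ^{gω}(gA) = κ^ω(A)`. It is used for `X = M` and, with the diagonal action, for `X = M × M`. -/
def IsEquivariant (G : Type*) {Ω X : Type*} [Group G] [MulAction G Ω] [MulAction G X]
    [MeasurableSpace Ω] [MeasurableSpace X] (κ : Kernel Ω X) : Prop :=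
  ∀ (g : G) (ω : Ω), κ (g • ω) = (κ ω).map (fun x => g • x)

/-- Unit intensity: `E[κ^•(A)] = m(A)` for all measurable `A`. -/
def HasUnitIntensity {Ω X : Type*} [MeasurableSpace Ω] [MeasurableSpace X]
    (P : Measure Ω) (m : Measure X) (κ : Kernel Ω X) : Prop :=
  ∀ A, MeasurableSet A → ∫⁻ ω, κ ω A ∂P = m A

/-- `q` is a coupling of `lam` and `mu`. -/
def IsCoupling {X Y : Type*} [MeasurableSpace X] [MeasurableSpace Y]
    (q : Measure (X × Y)) (lam : Measure X) (mu : Measure Y) : Prop :=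
  q.map Prod.fst = lam ∧ q.map Prod.snd = mu

/-- A fundamental region of the action of `G` on `M`. -/
structure IsFundamentalRegion (G : Type*) {M : Type*} [Group G] [MulAction G M]
    [MeasurableSpace M] (B : Set M) : Prop where
  measurableSet : MeasurableSet B
  iUnion_smul : ⋃ g : G, g • B = univ
  disjoint_smul : ∀ g : G, g ≠ 1 → Disjoint B (g • B)

/-- Admissible sets: unions of finitely many (at least one) translates of a fundamental region. -/
def IsAdmissible (G : Type*) {M : Type*} [Group G] [MulAction G M] [MeasurableSpace M]
    (B : Set M) : Prop :=
  ∃ (I : Finset G) (F : Set M), I.Nonempty ∧ IsFundamentalRegion G F ∧ B = ⋃ g ∈ I, g • F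

section Cost

variable {M : Type*} [MetricSpace M] [MeasurableSpace M]

/-- The cost `∫ d(x,y)^p q(dx,dy)`. -/
def cost (p : ℝ) (q : Measure (M × M)) : ℝ≥0∞ :=
  ∫⁻ z, edist z.1 z.2 ^ p ∂q

/-- `q` is a cost minimizing coupling of the (deterministic) measures `lam` and `mu`. -/
def IsCostMinimizer (p : ℝ) (q : Measure (M × M)) (lam mu : Measure M) : Prop :=
  IsCoupling q lam mu ∧ ∀ q', IsCoupling q' lam mu → cost p q ≤ cost p q'

/-- For all compactly supported probability measures `lam ≪ m` and `mu`, the optimal transport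
problem from `lam` to `mu` with cost `d^p` has exactly one solution, and this solution is induced
by a measurable map `T`. -/
def UniqueMongeSolutions (p : ℝ) (m : Measure M) : Prop :=
  ∀ lam mu : Measure M, IsProbabilityMeasure lam → IsProbabilityMeasure mu →
    (∃ K, IsCompact K ∧ lam Kᶜ = 0) → (∃ K, IsCompact K ∧ mu Kᶜ = 0) → lam ≪ m →
    ∃ T : M → M, Measurable T ∧
      ∀ q, IsCostMinimizer p q lam mu ↔ q = lam.map (fun x => (x, T x))

variable (G : Type*) [Group G] [MulAction G M]

/-- `E[∫_{A × B} d(x,y)^p q^•(dx,dy)]`. -/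
def expectedCostOn {Ω : Type*} [MeasurableSpace Ω] (P : Measure Ω) (p : ℝ)
    (q : Kernel Ω (M × M)) (A B : Set M) : ℝ≥0∞ :=
  ∫⁻ ω, cost p ((q ω).restrict (A ×ˢ B)) ∂P

/-- The mean transportation cost
`sup_B m(B)⁻¹ E[∫_{M × B} d(x,y)^p q^•(dx,dy)]`, the supremum being over all admissible sets. -/
def meanCost {Ω : Type*} [MeasurableSpace Ω] (P : Measure Ω) (m : Measure M) (p : ℝ)
    (q : Kernel Ω (M × M)) : ℝ≥0∞ :=
  ⨆ (B : Set M) (_ : IsAdmissible G B), (m B)⁻¹ * expectedCostOn P p q univ B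

variable {Ω : Type*} [MeasurableSpace Ω] [MulAction G Ω]

/-- `q` is an equivariant coupling of the random measures `lam` and `mu`: an equivariant random
measure on `M × M` such that `q^ω` is a coupling of `lam^ω` and `mu^ω` for almost every `ω`. -/
structure IsEquivariantCoupling (P : Measure Ω) (q : Kernel Ω (M × M)) (lam mu : Kernel Ω M) :
    Prop where
  isRandomMeasure : IsRandomMeasure q
  isEquivariant : IsEquivariant G q
  isCoupling : ∀ᵐ ω ∂P, IsCoupling (q ω) (lam ω) (mu ω)

/-- The infimum of the mean transportation cost over all equivariant couplings. -/
def optimalMeanCost (P : Measure Ω) (m : Measure M) (p : ℝ) (lam mu : Kernel Ω M) : ℝ≥0∞ :=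
  ⨅ (q : Kernel Ω (M × M)) (_ : IsEquivariantCoupling G P q lam mu), meanCost G P m p q

/-- `W_p(lam, mu)`, defined by
`W_p(lam, mu) ^ p = inf {meanCost q | q equivariant coupling of lam and mu}`. -/
def Wp (P : Measure Ω) (m : Measure M) (p : ℝ) (lam mu : Kernel Ω M) : ℝ≥0∞ :=
  optimalMeanCost G P m p lam mu ^ (1 / p)

/-- `q` is an optimal coupling: it is an equivariant coupling attaining the infimum. -/
structure IsOptimalCoupling (P : Measure Ω) (m : Measure M) (p : ℝ) (q : Kernel Ω (M × M))
    (lam mu : Kernel Ω M) : Prop where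
  isEquivariantCoupling : IsEquivariantCoupling G P q lam mu
  meanCost_eq : meanCost G P m p q = optimalMeanCost G P m p lam mu

/-- The class `𝒫_p` of equivariant random measures of unit intensity at finite `W_p` distance
from the deterministic measure `m`. -/
structure MemPp (P : Measure Ω) (m : Measure M) (p : ℝ) (mu : Kernel Ω M) : Prop where
  isRandomMeasure : IsRandomMeasure mu
  isEquivariant : IsEquivariant G mu
  hasUnitIntensity : HasUnitIntensity P m mu
  finite : Wp G P m p (Kernel.const Ω m) mu < ∞

end Cost

/-- On a `σ`-compact space random measures are s-finite kernels, so that the Campbell measure has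
no junk value. -/
theorem IsRandomMeasure.isSFiniteKernel {Ω X : Type*} [MeasurableSpace Ω] [MeasurableSpace X]
    [TopologicalSpace X] [T2Space X] [SigmaCompactSpace X] [OpensMeasurableSpace X]
    {κ : Kernel Ω X} (h : IsRandomMeasure κ) : IsSFiniteKernel κ := by
  classical
  have hD : ∀ i, MeasurableSet (disjointed (compactCovering X) i) := fun i =>
    MeasurableSet.disjointed (fun n => (isCompact_compactCovering X n).measurableSet) i
  have hfin : ∀ i ω, κ ω (disjointed (compactCovering X) i) < ∞ := fun i ω => by
    have := h ω
    exact (measure_mono (disjointed_subset _ i)).trans_lt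
      (isCompact_compactCovering X i).measure_lt_top
  have hU : ⋃ i, disjointed (compactCovering X) i = univ := by
    rw [iUnion_disjointed, iUnion_compactCovering]
  have hS : ∀ i (k : ℕ), MeasurableSet
      {ω | ⌊(κ ω (disjointed (compactCovering X) i)).toNNReal⌋₊ = k} := fun i k =>
    (Nat.measurable_floor.comp (κ.measurable_coe (hD i)).ennreal_toNNReal)
      (measurableSet_singleton k)
  have key : κ = Kernel.sum fun i => Kernel.sum fun k =>
      Kernel.piecewise (hS i k) (κ.restrict (hD i)) 0 := by
    ext ω s hs
    rw [Kernel.sum_apply' _ _ hs]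
    have h1 : ∀ i, (Kernel.sum fun k => Kernel.piecewise (hS i k) (κ.restrict (hD i)) 0) ω s
        = (κ ω).restrict (disjointed (compactCovering X) i) s := by
      intro i
      rw [Kernel.sum_apply' _ _ hs,
        tsum_eq_single ⌊(κ ω (disjointed (compactCovering X) i)).toNNReal⌋₊]
      · simp [Kernel.piecewise_apply, Kernel.restrict_apply]
      · intro k hk
        simp [Kernel.piecewise_apply, Ne.symm hk]
    simp_rw [h1]
    conv_lhs => rw [← Measure.restrict_univ (μ := κ ω), ← hU,
      Measure.restrict_iUnion (disjoint_disjointed _) hD, Measure.sum_apply _ hs]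
  rw [key]
  have hk : ∀ i k, IsFiniteKernel (Kernel.piecewise (hS i k) (κ.restrict (hD i)) 0) := by
    intro i k
    refine ⟨(k : ℝ≥0∞) + 1, by simp, fun ω => ?_⟩
    rw [Kernel.piecewise_apply]
    split_ifs with hω
    · rw [Kernel.restrict_apply, Measure.restrict_apply_univ,
        ← ENNReal.coe_toNNReal (hfin i ω).ne]
      have := Nat.lt_floor_add_one (κ ω (disjointed (compactCovering X) i)).toNNReal
      rw [mem_ofPred_eq] at hω
      rw [hω] at this
      exact_mod_cast this.le
    · simp
  infer_instance

theorem campbell_apply {Ω X : Type*} [MeasurableSpace Ω] [MeasurableSpace X]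
    [TopologicalSpace X] [T2Space X] [SigmaCompactSpace X] [OpensMeasurableSpace X]
    (P : Measure Ω) [IsProbabilityMeasure P] {κ : Kernel Ω X} (h : IsRandomMeasure κ)
    {s : Set (X × Ω)} (hs : MeasurableSet s) :
    campbell P κ s = ∫⁻ ω, κ ω {x | (x, ω) ∈ s} ∂P := by
  have := h.isSFiniteKernel
  rw [campbell, Measure.map_apply measurable_swap hs,
    Measure.compProd_apply (measurable_swap hs)]
  rfl

end

end RandomTransport

/-! Everything rests on the mass transport principle (`mass_transport`): for an equivariant random
measure and an invariant integrand, the expected integral against a weight, that is a function whose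
translates sum to one, does not depend on the weight. Hence the supremum defining the mean cost is
the single number E∫ w d^p dq for any weight w on M × M (`meanCost_eq`), and w may be the indicator
of B₀ in either variable or a continuous compactly supported function φ of one variable, whichever
suits. With w fixed, a mean cost is the p-th power of an L^p norm, so gluing two couplings along
their common marginal by an equivariant disintegration yields the triangle inequality
(`Wp_triangle`).

i) ⟹ ii): the distances to m converge by the triangle inequality. For vague convergence, a test
function f is uniformly continuous, so |f(x,ω) - f(y,ω)| is at most a small constant plus a multiple
of d(x,y)^p, and it vanishes unless x or y lies in a compact set; integrating against nearly optimal
couplings bounds the difference of the integrals (`enorm_integral_campbell_sub_le`).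

iii) ⟺ iv): the cost φ(x)d(x,y)^p is split by a continuous cutoff in d(x,y). The near part is a
continuous compactly supported function on M × M × Ω, because M is proper and Ω compact, so it
converges under vague convergence. Convergence of the total costs is then equivalent to the far
parts becoming small uniformly for large n (`tendsto_iff_limsup_far`), and mass transport identifies
this with the tail condition over B₀.

iv) ⟹ i): this is the deep part. Disintegrate q over its first coordinate by a kernel K and compose
the reversed q_n with K: given (x,y) from q_n, sample z from K(ω,x). This couples μ_n and μ, and its
cost should tend to that of the composition of q with itself. Three facts are needed. First, optimal
couplings are carried by graphs (`IsOptimalCoupling.ae_graph`). Otherwise the uniqueness hypothesis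
would give a cheaper local coupling on a set of ω of positive probability, and summing its
translates over G would give an equivariant coupling beating the optimum. Measurable dependence on ω
is secured by a countable family of competitors, rational block densities completed to couplings.
Consequently K is a point mass and the limiting composition lives on the diagonal
(`IsOptimalCoupling.expect_glue_ne_eq_zero`). Second, K is only measurable, so vague convergence
does not apply to it directly. But all q_n have first marginal m, so a bounded measurable function
of (x,ω) may be replaced by a continuous one with an error uniform in n
(`eventually_lintegral_le_of_vagueTendsto`). This is where the σ-field of Ω must lie between the
Borel field and its completion. Third, d(y,z)^p splits into a near part, handled by the first two
facts after partitioning the range of z into small cells (`eventually_expect_glue_near_le`), and the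
far parts of q_n and q, which are small by iv) and by integrability. -/

namespace RandomTransport

noncomputable section

set_option linter.unusedSectionVars false

/-! ### Properness of M from its length structure and the cocompact action -/

/-- Approximate geodesics: in a connected Riemannian manifold one finds points at prescribed
distances from two given points. -/
theorem exists_dist_le_dist_lt
    {E : Type*} [NormedAddCommGroup E] [NormedSpace ℝ E]
    {M : Type*} [MetricSpace M] [ChartedSpace E M] [IsManifold 𝓘(ℝ, E) ((⊤ : ℕ∞) : WithTop ℕ∞) M]
    [RiemannianBundle (fun x : M => TangentSpace 𝓘(ℝ, E) x)]
    [IsRiemannianManifold 𝓘(ℝ, E) M] {x y : M} {a b : ℝ} (ha : 0 ≤ a) (hb : 0 < b)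
    (h : dist x y < a + b) : ∃ z, dist x z ≤ a ∧ dist z y < b := by
  by_cases hxy : dist x y < a
  · exact ⟨y, hxy.le, by simpa using hb⟩
  push Not at hxy
  have h1 : riemannianEDist 𝓘(ℝ, E) x y < ENNReal.ofReal (a + b) := by
    rw [← IsRiemannianManifold.out (I := 𝓘(ℝ, E)) x y, edist_dist]
    exact (ENNReal.ofReal_lt_ofReal_iff (by linarith)).2 h
  obtain ⟨γ, h0, h1', hγ, hlen⟩ := exists_lt_of_riemannianEDist_lt h1
  have hcont : ContinuousOn (fun t => dist x (γ t)) (Icc 0 1) :=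
    (continuous_const.dist continuous_id).comp_continuousOn hγ.continuousOn
  have hmem : a ∈ Icc (dist x (γ 0)) (dist x (γ 1)) := by
    rw [h0, h1']; exact ⟨by simpa using ha, hxy⟩
  -- The point is taken on an almost shortest path at distance exactly a from x; the path up to
  -- there has length at least a, so what remains is shorter than b.
  obtain ⟨t, ht, hta⟩ := intermediate_value_Icc zero_le_one hcont hmem
  refine ⟨γ t, hta.le, ?_⟩
  have e1 : edist x (γ t) ≤ pathELength 𝓘(ℝ, E) γ 0 t := by
    rw [IsRiemannianManifold.out (I := 𝓘(ℝ, E)) x (γ t)]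
    exact riemannianEDist_le_pathELength (hγ.mono (Icc_subset_Icc_right ht.2)) h0 rfl ht.1
  have e2 : edist (γ t) y ≤ pathELength 𝓘(ℝ, E) γ t 1 := by
    rw [IsRiemannianManifold.out (I := 𝓘(ℝ, E)) (γ t) y]
    exact riemannianEDist_le_pathELength (hγ.mono (Icc_subset_Icc_left ht.1)) rfl h1' ht.2
  have e3 : edist x (γ t) + edist (γ t) y < ENNReal.ofReal (a + b) := by
    refine (add_le_add e1 e2).trans_lt ?_
    rwa [pathELength_add ht.1 ht.2]
  rw [edist_dist, edist_dist, ← ENNReal.ofReal_add dist_nonneg dist_nonneg,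
    ENNReal.ofReal_lt_ofReal_iff (by linarith)] at e3
  simp only at hta
  linarith

/-- A locally compact length space with a cocompact isometric action is proper. -/
theorem properSpace_of_cocompact {M : Type*} [MetricSpace M] [LocallyCompactSpace M]
    (hlen : ∀ (x y : M) (a b : ℝ), 0 ≤ a → 0 < b → dist x y < a + b →
      ∃ z, dist x z ≤ a ∧ dist z y < b)
    {G : Type*} [Group G] [MulAction G M] [IsIsometricSMul G M]
    (hcocompact : CompactSpace (MulAction.orbitRel.Quotient G M)) : ProperSpace M := by
  -- The doubled radius leaves room: closed r-balls around points of the open r-ball at x stay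
  -- inside this compact ball.
  have hloc : ∀ x : M, ∃ r : ℝ, 0 < r ∧ IsCompact (Metric.closedBall x (2 * r)) := fun x => by
    obtain ⟨r, hr, hr'⟩ := Metric.exists_isCompact_closedBall x
    exact ⟨r / 2, by positivity, by rwa [mul_div_cancel₀ _ two_ne_zero]⟩
  choose r hr hrc using hloc
  have hopen : IsOpenMap (Quotient.mk (MulAction.orbitRel G M)) := isOpenMap_quotient_mk'_mul
  obtain ⟨s, hs⟩ := hcocompact.isCompact_univ.elim_finite_subcover
    (fun x : M => Quotient.mk (MulAction.orbitRel G M) '' Metric.ball x (r x))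
    (fun x => hopen _ Metric.isOpen_ball) (fun z _ => by
      induction z using Quotient.inductionOn with
      | h x => exact mem_iUnion.2 ⟨x, x, Metric.mem_ball_self (hr x), rfl⟩)
  have hmin : ∃ ρ : ℝ, 0 < ρ ∧ ∀ x ∈ s, ρ ≤ r x := by
    rcases s.eq_empty_or_nonempty with h | h
    · exact ⟨1, one_pos, by simp [h]⟩
    · exact ⟨s.inf' h r, (Finset.lt_inf'_iff h).2 fun x _ => hr x, fun x hx => Finset.inf'_le r hx⟩
  obtain ⟨ρ, hρ, hρs⟩ := hmin
  have hunif : ∀ y : M, IsCompact (Metric.closedBall y ρ) := fun y => by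
    have := hs (mem_univ (Quotient.mk (MulAction.orbitRel G M) y))
    simp only [mem_iUnion, mem_image] at this
    obtain ⟨x, hx, z, hz, hzy⟩ := this
    obtain ⟨g, hg⟩ : ∃ g : G, g • y = z := by
      have := Quotient.exact hzy
      exact this
    have h1 : IsCompact (Metric.closedBall z ρ) := by
      refine (hrc x).of_isClosed_subset Metric.isClosed_closedBall fun w hw => ?_
      have := dist_triangle w z x
      have h2 := hρs x hx
      rw [Metric.mem_closedBall] at hw ⊢
      rw [Metric.mem_ball] at hz
      linarith
    have h2 : Metric.closedBall y ρ = g⁻¹ • Metric.closedBall z ρ := by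
      rw [← hg, Metric.smul_closedBall, inv_smul_smul]
    rw [h2]
    exact h1.smul g⁻¹
  -- Balls grow by ρ/2 per step. A point of the larger ball is within 3ρ/4 of the smaller one, which
  -- is covered by finitely many ρ/4-balls, so it lies in a compact ρ-ball around one of their
  -- centres.
  have hstep : ∀ (n : ℕ) (x : M), IsCompact (Metric.closedBall x (n * (ρ / 2))) := fun n x => by
    induction n with
    | zero => simp
    | succ n ih =>
      obtain ⟨t, ht, ht'⟩ := ih.finite_cover_balls (e := ρ / 4) (by positivity)
      refine (ht'.1.isCompact_biUnion (f := fun z => Metric.closedBall z ρ)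
        fun z _ => hunif z).of_isClosed_subset Metric.isClosed_closedBall fun y hy => ?_
      rw [Metric.mem_closedBall, dist_comm] at hy
      obtain ⟨z, hz1, hz2⟩ := hlen x y (n * (ρ / 2)) (3 * ρ / 4) (by positivity) (by positivity)
        (hy.trans_lt (by push_cast; linarith))
      have hz3 := ht'.2 (Metric.mem_closedBall.2 (by rwa [dist_comm]) : z ∈ _)
      simp only [mem_iUnion] at hz3 ⊢
      obtain ⟨i, hi, hi'⟩ := hz3
      refine ⟨i, hi, ?_⟩
      rw [Metric.mem_ball] at hi'
      have := dist_triangle y z i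
      rw [dist_comm y z] at this
      rw [Metric.mem_closedBall]
      linarith
  refine ⟨fun x R => ?_⟩
  obtain ⟨n, hn⟩ := exists_nat_ge (R / (ρ / 2))
  refine (hstep n x).of_isClosed_subset Metric.isClosed_closedBall
    (Metric.closedBall_subset_closedBall ?_)
  rwa [div_le_iff₀ (by positivity)] at hn

/-! ### Finiteness properties of the action on bounded sets -/

section Action

variable {M : Type*} [MetricSpace M] [ProperSpace M] {G : Type*} [Group G] [MulAction G M]
  [IsIsometricSMul G M]

omit [IsIsometricSMul G M] in
theorem countable_of_properlyDiscontinuous [Nonempty M]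
    (hdisc : ∀ (x : M) (K : Set M), IsCompact K → {g : G | g • x ∈ K}.Finite) : Countable G := by
  obtain ⟨x⟩ := ‹Nonempty M›
  have h : (univ : Set G) = ⋃ n : ℕ, {g : G | g • x ∈ Metric.closedBall x n} := by
    refine (eq_univ_of_forall fun g => ?_).symm
    obtain ⟨n, hn⟩ := exists_nat_ge (dist (g • x) x)
    exact mem_iUnion.2 ⟨n, hn⟩
  rw [← countable_univ_iff, h]
  exact countable_iUnion fun n => (hdisc x _ (isCompact_closedBall x n)).countable

/-- Only finitely many translates of a bounded set meet a given bounded set. -/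
theorem finite_smul_inter
    (hdisc : ∀ (x : M) (K : Set M), IsCompact K → {g : G | g • x ∈ K}.Finite) {B K : Set M}
    (hB : Bornology.IsBounded B) (hK : Bornology.IsBounded K) :
    {g : G | ∃ x ∈ B, g • x ∈ K}.Finite := by
  rcases B.eq_empty_or_nonempty with rfl | ⟨b, hb⟩
  · simp
  obtain ⟨C, hC⟩ := Metric.isBounded_iff.1 hB
  refine (hdisc b (Metric.cthickening C K) (Metric.isCompact_of_isClosed_isBounded
    Metric.isClosed_cthickening hK.cthickening)).subset ?_
  rintro g ⟨x, hx, hgx⟩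
  refine Metric.mem_cthickening_of_dist_le _ _ _ _ hgx ?_
  rw [dist_smul]
  exact hC hb hx

/-- Finitely many translates of B₀, each of measure one, cover K. The local finiteness of m is
derived from its normalization in this way. -/
theorem measure_lt_top_of_isBounded [MeasurableSpace M] [BorelSpace M] [Countable G]
    (hdisc : ∀ (x : M) (K : Set M), IsCompact K → {g : G | g • x ∈ K}.Finite) {B₀ : Set M}
    (hB₀ : IsFundamentalRegion G B₀) (hB₀bdd : Bornology.IsBounded B₀)
    {m : Measure M} [SMulInvariantMeasure G M m] (hmB₀ : m B₀ = 1) {K : Set M}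
    (hK : Bornology.IsBounded K) : m K < ∞ := by
  have hfin := finite_smul_inter (G := G) hdisc hB₀bdd hK
  have hsub : K ⊆ ⋃ g ∈ {g : G | ∃ x ∈ B₀, g • x ∈ K}, g • B₀ := fun y hy => by
    have := hB₀.iUnion_smul ▸ mem_univ y
    obtain ⟨g, x, hx, rfl⟩ := mem_iUnion.1 this
    exact mem_biUnion ⟨x, hx, hy⟩ ⟨x, hx, rfl⟩
  refine (measure_mono hsub).trans_lt (measure_biUnion_lt_top hfin fun g _ => ?_)
  rw [measure_smul, hmB₀]
  exact ENNReal.one_lt_top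

end Action

/-! ### Weights and the mass transport principle -/

section MassTransport

variable {G : Type*} [Group G] {Ω X Y : Type*} [MeasurableSpace Ω] [MeasurableSpace X]
  [MeasurableSpace Y] [MulAction G Ω] [MulAction G X] [MulAction G Y]

/-- The expected integral `E[∫ f dκ^•]`. -/
def expect (P : Measure Ω) (κ : Kernel Ω X) (f : X → ℝ≥0∞) : ℝ≥0∞ := ∫⁻ ω, ∫⁻ x, f x ∂κ ω ∂P

/-- A measurable function whose translates sum up to one. -/
structure IsWeight (G : Type*) {X : Type*} [Group G] [MulAction G X] [MeasurableSpace X]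
    (w : X → ℝ≥0∞) : Prop where
  measurable : Measurable w
  tsum_eq : ∀ x, ∑' g : G, w (g • x) = 1

theorem IsWeight.comp {w : Y → ℝ≥0∞} (hw : IsWeight G w) {τ : X → Y} (hτ : Measurable τ)
    (hτG : ∀ (g : G) x, τ (g • x) = g • τ x) : IsWeight G (fun x => w (τ x)) :=
  ⟨hw.measurable.comp hτ, fun x => by simp_rw [hτG]; exact hw.tsum_eq _⟩

theorem IsWeight.smul [MeasurableConstSMul G X] {w : X → ℝ≥0∞} (hw : IsWeight G w) (g : G) :
    IsWeight G (fun x => w (g • x)) :=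
  ⟨hw.measurable.comp (measurable_const_smul g), fun x => by
    rw [← hw.tsum_eq x, ← (Equiv.mulLeft g).tsum_eq (fun h => w (h • x))]
    simp [mul_smul]⟩

/-- Every orbit meets B exactly once, and with exactly one group element, so exactly one summand is
nonzero. -/
theorem IsFundamentalRegion.isWeight {B : Set X} (hB : IsFundamentalRegion G B) :
    IsWeight G (B.indicator 1 : X → ℝ≥0∞) := by
  refine ⟨measurable_one.indicator hB.measurableSet, fun x => ?_⟩
  obtain ⟨g, y, hy, rfl⟩ := mem_iUnion.1 (hB.iUnion_smul ▸ mem_univ x)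
  rw [tsum_eq_single g⁻¹]
  · simp [hy]
  · intro h hh
    refine indicator_of_notMem (fun hmem => ?_) _
    simp only [smul_smul] at hmem
    refine disjoint_left.1 (hB.disjoint_smul (h * g) fun h1 => hh ?_) hmem ⟨y, hy, rfl⟩
    exact eq_inv_of_mul_eq_one_left h1

theorem expect_congr {P : Measure Ω} {κ κ' : Kernel Ω X} (h : ∀ᵐ ω ∂P, κ ω = κ' ω)
    (f : X → ℝ≥0∞) : expect P κ f = expect P κ' f :=
  lintegral_congr_ae (h.mono fun ω hω => by simp only [hω])

theorem expect_mono {P : Measure Ω} {κ : Kernel Ω X} {f f' : X → ℝ≥0∞} (h : ∀ x, f x ≤ f' x) :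
    expect P κ f ≤ expect P κ f' :=
  lintegral_mono fun _ => lintegral_mono h

theorem expect_add {P : Measure Ω} {κ : Kernel Ω X} {f f' : X → ℝ≥0∞} (hf : Measurable f) :
    expect P κ (fun x => f x + f' x) = expect P κ f + expect P κ f' := by
  simp only [expect]
  simp_rw [lintegral_add_left hf]
  exact lintegral_add_left hf.lintegral_kernel _

theorem expect_const_mul {P : Measure Ω} {κ : Kernel Ω X} {f : X → ℝ≥0∞} (hf : Measurable f)
    (c : ℝ≥0∞) : expect P κ (fun x => c * f x) = c * expect P κ f := by
  simp only [expect]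
  simp_rw [lintegral_const_mul c hf]
  exact lintegral_const_mul c hf.lintegral_kernel

theorem expect_tsum {ι : Type*} [Countable ι] {P : Measure Ω} {κ : Kernel Ω X}
    {f : ι → X → ℝ≥0∞} (hf : ∀ i, Measurable (f i)) :
    expect P κ (fun x => ∑' i, f i x) = ∑' i, expect P κ (f i) := by
  simp only [expect]
  simp_rw [lintegral_tsum fun i => (hf i).aemeasurable]
  exact lintegral_tsum fun i => (hf i).lintegral_kernel.aemeasurable

theorem expect_map {P : Measure Ω} {κ : Kernel Ω X} {τ : X → Y} (hτ : Measurable τ)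
    {f : Y → ℝ≥0∞} (hf : Measurable f) :
    expect P (κ.map τ) f = expect P κ (fun x => f (τ x)) := by
  simp only [expect, Kernel.map_apply _ hτ]
  simp_rw [lintegral_map hf hτ]

theorem expect_eq_lintegral_campbell (P : Measure Ω) [SFinite P] (κ : Kernel Ω X)
    [IsSFiniteKernel κ] {f : X → ℝ≥0∞} (hf : Measurable f) :
    expect P κ f = ∫⁻ z, f z.1 ∂campbell P κ := by
  rw [campbell, lintegral_map (by fun_prop) measurable_swap,
    Measure.lintegral_compProd (by fun_prop)]
  rfl

variable [MeasurableConstSMul G Ω] [MeasurableConstSMul G X] {P : Measure Ω}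
  [SMulInvariantMeasure G Ω P]

/-- Equivariance moves the translation from x to ω, where the invariance of P absorbs it. -/
theorem expect_smul {κ : Kernel Ω X} (hκ : IsEquivariant G κ) {f : X → ℝ≥0∞} (hf : Measurable f)
    (g : G) : expect P κ (fun x => f (g • x)) = expect P κ f := by
  have h1 : ∀ ω, ∫⁻ x, f (g • x) ∂κ ω = ∫⁻ x, f x ∂κ (g • ω) := fun ω => by
    rw [hκ g ω, lintegral_map hf (measurable_const_smul g)]
  simp only [expect, h1]
  exact (measurePreserving_smul g P).lintegral_comp (f := fun ω => ∫⁻ x, f x ∂κ ω)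
    hf.lintegral_kernel

/-- The mass transport principle. -/
theorem mass_transport [Countable G] {κ : Kernel Ω X} (hκ : IsEquivariant G κ)
    {w w' h : X → ℝ≥0∞} (hw : IsWeight G w) (hw' : IsWeight G w') (hh : Measurable h)
    (hinv : ∀ (g : G) x, h (g • x) = h x) :
    expect P κ (fun x => w x * h x) = expect P κ (fun x => w' x * h x) := by
  have m1 : ∀ g : G, Measurable fun x => w (g⁻¹ • x) * w' x * h x := fun g =>
    ((hw.measurable.comp (measurable_const_smul _)).mul hw'.measurable).mul hh
  have m2 : ∀ g : G, Measurable fun x => w x * w' (g • x) * h x := fun g =>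
    (hw.measurable.mul (hw'.measurable.comp (measurable_const_smul _))).mul hh
  -- A factor 1 = ∑ w'(gx) is inserted, each summand is translated by g, and the sum over the
  -- translates of w then collapses to one.
  calc expect P κ (fun x => w x * h x)
      = expect P κ (fun x => ∑' g : G, w x * w' (g • x) * h x) := by
        congr 1; ext x
        rw [ENNReal.tsum_mul_right, ENNReal.tsum_mul_left, hw'.tsum_eq, mul_one]
    _ = ∑' g : G, expect P κ (fun x => w (g⁻¹ • x) * w' x * h x) := by
        rw [expect_tsum m2]
        congr 1; ext g
        rw [← expect_smul hκ (m1 g) g]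
        simp [hinv]
    _ = expect P κ (fun x => ∑' g : G, w (g⁻¹ • x) * w' x * h x) := (expect_tsum m1).symm
    _ = expect P κ (fun x => w' x * h x) := by
        congr 1; ext x
        rw [ENNReal.tsum_mul_right, ENNReal.tsum_mul_right,
          show ∑' g : G, w (g⁻¹ • x) = 1 from
            ((Equiv.inv G).tsum_eq fun g => w (g • x)).trans (hw.tsum_eq x), one_mul]

end MassTransport

/-! ### The mean cost as one weighted expectation, and its symmetry -/

section MeanCost

variable {M : Type*} [MetricSpace M] [SecondCountableTopology M] [MeasurableSpace M] [BorelSpace M]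
  {G : Type*} [Group G] [Countable G] [MulAction G M] [IsIsometricSMul G M]
  {Ω : Type*} [MeasurableSpace Ω] [MulAction G Ω] [MeasurableConstSMul G Ω] {P : Measure Ω}
  [IsProbabilityMeasure P] [SMulInvariantMeasure G Ω P] {m : Measure M} {p : ℝ}

theorem measurable_edist_rpow : Measurable fun z : M × M => edist z.1 z.2 ^ p :=
  measurable_edist.pow_const p

theorem expectedCostOn_eq {q : Kernel Ω (M × M)} {A B : Set M} (hA : MeasurableSet A)
    (hB : MeasurableSet B) : expectedCostOn P p q A B =
      expect P q (fun z => A.indicator 1 z.1 * B.indicator 1 z.2 * edist z.1 z.2 ^ p) := by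
  simp only [expectedCostOn, cost, expect]
  congr 1; ext ω
  rw [← lintegral_indicator (hA.prod hB)]
  congr 1; ext z
  by_cases h1 : z.1 ∈ A <;> by_cases h2 : z.2 ∈ B <;> simp [indicator, h1, h2]

theorem IsFundamentalRegion.disjoint_smul_smul {F : Set M} (hF : IsFundamentalRegion G F)
    {g h : G} (hgh : g ≠ h) : Disjoint (g • F) (h • F) := by
  have := hF.disjoint_smul (g⁻¹ * h) (fun h1 => hgh (inv_mul_eq_one.1 h1))
  rw [disjoint_left] at this ⊢
  rintro _ ⟨x, hx, rfl⟩ ⟨y, hy, hxy⟩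
  refine this hx ⟨y, hy, ?_⟩
  simp only at hxy ⊢
  rw [mul_smul, hxy, inv_smul_smul]

theorem IsFundamentalRegion.isFundamentalDomain {F : Set M} (hF : IsFundamentalRegion G F) :
    IsFundamentalDomain G F m where
  nullMeasurableSet := hF.measurableSet.nullMeasurableSet
  ae_covers := ae_of_all _ fun x => by
    obtain ⟨g, y, hy, rfl⟩ := mem_iUnion.1 (hF.iUnion_smul ▸ mem_univ x)
    exact ⟨g⁻¹, by simpa using hy⟩
  aedisjoint _ _ hgh := (hF.disjoint_smul_smul hgh).aedisjoint

/-- The mean transportation cost can be computed on any weight in the second variable. -/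
theorem meanCost_eq {B₀ : Set M} (hB₀ : IsFundamentalRegion G B₀) [SMulInvariantMeasure G M m]
    (hmB₀ : m B₀ = 1) {q : Kernel Ω (M × M)} (hq : IsEquivariant G q) {w : M × M → ℝ≥0∞}
    (hw : IsWeight G w) :
    meanCost G P m p q = expect P q (fun z => w z * edist z.1 z.2 ^ p) := by
  have hinv : ∀ (g : G) (z : M × M), edist (g • z).1 (g • z).2 ^ p = edist z.1 z.2 ^ p :=
    fun g z => by simp
  -- The normalized cost is the same for every admissible set: the union of the |I| translates has
  -- measure |I|, and by mass transport each translate contributes the same cost.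
  have key : ∀ B, IsAdmissible G B → (m B)⁻¹ * expectedCostOn P p q univ B =
      expect P q (fun z => w z * edist z.1 z.2 ^ p) := by
    rintro B ⟨I, F, hI, hF, rfl⟩
    have hgF : ∀ g : G, MeasurableSet (g • F) := fun g => hF.measurableSet.const_smul g
    have hind : ∀ y : M, ((⋃ g ∈ I, g • F).indicator 1 y : ℝ≥0∞) =
        ∑ g ∈ I, (F.indicator 1 (g⁻¹ • y) : ℝ≥0∞) := fun y => by
      by_cases hy : y ∈ ⋃ g ∈ I, g • F
      · rw [indicator_of_mem hy]
        simp only [mem_iUnion] at hy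
        obtain ⟨g, hg, hgy⟩ := hy
        rw [Finset.sum_eq_single_of_mem g hg]
        · rw [indicator_of_mem (mem_smul_set_iff_inv_smul_mem.1 hgy)]; rfl
        · intro h _ hhg
          refine indicator_of_notMem (fun hmem => ?_) _
          exact disjoint_left.1 (hF.disjoint_smul_smul hhg)
            (mem_smul_set_iff_inv_smul_mem.2 hmem) hgy
      · rw [indicator_of_notMem hy]
        simp only [mem_iUnion, not_exists] at hy
        refine (Finset.sum_eq_zero fun g hg => indicator_of_notMem (fun hmem => ?_) _).symm
        exact hy g hg (mem_smul_set_iff_inv_smul_mem.2 hmem)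
    have hm : m (⋃ g ∈ I, g • F) = I.card := by
      rw [measure_biUnion_finset (fun g _ h _ hgh => hF.disjoint_smul_smul hgh) fun g _ => hgF g]
      simp [measure_smul, (hF.isFundamentalDomain (m := m)).measure_eq hB₀.isFundamentalDomain, hmB₀]
    have hcost : expectedCostOn P p q univ (⋃ g ∈ I, g • F) =
        I.card * expect P q (fun z => w z * edist z.1 z.2 ^ p) := by
      rw [expectedCostOn_eq MeasurableSet.univ (Finset.measurableSet_biUnion _ fun g _ => hgF g)]
      have h1 : ∀ g : G, expect P q (fun z => F.indicator 1 (g⁻¹ • z.2) * edist z.1 z.2 ^ p) =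
          expect P q (fun z => w z * edist z.1 z.2 ^ p) := fun g =>
        mass_transport hq ((hF.isWeight.smul g⁻¹).comp measurable_snd (fun _ _ => rfl)) hw
          measurable_edist_rpow hinv
      have h2 : (fun z : M × M => (univ : Set M).indicator 1 z.1 *
          (⋃ g ∈ I, g • F).indicator 1 z.2 * edist z.1 z.2 ^ p) =
          fun z => ∑' g : I, F.indicator 1 ((g : G)⁻¹ • z.2) * edist z.1 z.2 ^ p := by
        ext z
        rw [hind, ENNReal.tsum_mul_right, Finset.tsum_subtype I
          (fun g => (F.indicator 1 (g⁻¹ • z.2) : ℝ≥0∞))]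
        simp
      rw [h2, expect_tsum]
      · simp [h1]
      · intro g
        exact (((hF.isWeight.smul (g : G)⁻¹).measurable.comp measurable_snd).mul
          measurable_edist_rpow)
    rw [hm, hcost, ← mul_assoc, ENNReal.inv_mul_cancel, one_mul]
    · simpa using hI.ne_empty
    · simp
  have hB : IsAdmissible G B₀ := ⟨{1}, B₀, by simp, hB₀, by simp⟩
  refine le_antisymm (iSup₂_le fun B hB => (key B hB).le) ?_
  rw [← key B₀ hB]
  exact le_iSup₂ (f := fun (B : Set M) (_ : IsAdmissible G B) =>
    (m B)⁻¹ * expectedCostOn P p q univ B) B₀ hB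

variable [SigmaCompactSpace M]

theorem IsEquivariant.map {X Y : Type*} [MeasurableSpace X] [MeasurableSpace Y] [MulAction G X]
    [MulAction G Y] [MeasurableConstSMul G X] [MeasurableConstSMul G Y]
    {κ : Kernel Ω X} (hκ : IsEquivariant G κ) {τ : X → Y} (hτ : Measurable τ)
    (hτG : ∀ (g : G) x, τ (g • x) = g • τ x) : IsEquivariant G (κ.map τ) := fun g ω => by
  rw [Kernel.map_apply _ hτ, Kernel.map_apply _ hτ, hκ g ω,
    Measure.map_map hτ (measurable_const_smul g), Measure.map_map (measurable_const_smul g) hτ]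
  congr 1; ext x; exact hτG g x

theorem IsEquivariantCoupling.swap {lam mu : Kernel Ω M} {q : Kernel Ω (M × M)}
    (hq : IsEquivariantCoupling G P q lam mu) :
    IsEquivariantCoupling G P (q.map Prod.swap) mu lam where
  isRandomMeasure ω := by
    rw [Kernel.map_apply _ measurable_swap]
    refine ⟨fun z => ?_⟩
    have := hq.isRandomMeasure ω
    obtain ⟨s, hs, hs'⟩ := (q ω).exists_isOpen_measure_lt_top z.swap
    refine ⟨Prod.swap ⁻¹' s, (hs'.1.preimage continuous_swap).mem_nhds hs, ?_⟩
    rw [Measure.map_apply measurable_swap ((hs'.1.preimage continuous_swap).measurableSet)]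
    simpa [preimage_preimage] using hs'.2
  isEquivariant := hq.isEquivariant.map measurable_swap fun _ _ => rfl
  isCoupling := hq.isCoupling.mono fun ω hω => by
    rw [Kernel.map_apply _ measurable_swap]
    exact ⟨by rw [Measure.map_map measurable_fst measurable_swap]; exact hω.2,
      by rw [Measure.map_map measurable_snd measurable_swap]; exact hω.1⟩

/-- Swapping exchanges localization in the first and in the second variable, and `meanCost_eq`
allows either. -/
theorem meanCost_swap {B₀ : Set M} (hB₀ : IsFundamentalRegion G B₀) [SMulInvariantMeasure G M m]
    (hmB₀ : m B₀ = 1) {q : Kernel Ω (M × M)} (hq : IsEquivariant G q) :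
    meanCost G P m p (q.map Prod.swap) = meanCost G P m p q := by
  have h1 : IsWeight G (fun z : M × M => (B₀.indicator 1 z.2 : ℝ≥0∞)) :=
    hB₀.isWeight.comp measurable_snd fun _ _ => rfl
  have h2 : IsWeight G (fun z : M × M => (B₀.indicator 1 z.1 : ℝ≥0∞)) :=
    hB₀.isWeight.comp measurable_fst fun _ _ => rfl
  rw [meanCost_eq hB₀ hmB₀ hq h2,
    meanCost_eq hB₀ hmB₀ (hq.map measurable_swap fun _ _ => rfl) h1,
    expect_map (f := fun z => B₀.indicator 1 z.2 * edist z.1 z.2 ^ p) measurable_swap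
      (h1.measurable.mul measurable_edist_rpow)]
  simp [edist_comm]

theorem optimalMeanCost_comm {B₀ : Set M} (hB₀ : IsFundamentalRegion G B₀)
    [SMulInvariantMeasure G M m] (hmB₀ : m B₀ = 1) (lam mu : Kernel Ω M) :
    optimalMeanCost G P m p lam mu = optimalMeanCost G P m p mu lam := by
  have : ∀ lam mu : Kernel Ω M,
      optimalMeanCost G P m p lam mu ≤ optimalMeanCost G P m p mu lam := fun lam mu => by
    refine le_iInf₂ fun q hq => ?_
    rw [← meanCost_swap hB₀ hmB₀ hq.isEquivariant]
    exact iInf₂_le (f := fun (q : Kernel Ω (M × M)) (_ : IsEquivariantCoupling G P q lam mu) =>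
      meanCost G P m p q) _ hq.swap
  exact (this _ _).antisymm (this _ _)

theorem Wp_comm {B₀ : Set M} (hB₀ : IsFundamentalRegion G B₀) [SMulInvariantMeasure G M m]
    (hmB₀ : m B₀ = 1) (lam mu : Kernel Ω M) : Wp G P m p lam mu = Wp G P m p mu lam := by
  rw [Wp, Wp, optimalMeanCost_comm hB₀ hmB₀]

end MeanCost

/-! ### Invariant conull sets -/

section NullSets

variable {G : Type*} [Group G] [Countable G] {Ω : Type*} [MeasurableSpace Ω] [MulAction G Ω]
  [MeasurableConstSMul G Ω] {P : Measure Ω} [SMulInvariantMeasure G Ω P]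

theorem ae_forall_smul {Q : Ω → Prop} (h : ∀ᵐ ω ∂P, Q ω) : ∀ᵐ ω ∂P, ∀ g : G, Q (g • ω) := by
  rw [ae_all_iff]
  exact fun g => (measurePreserving_smul g P).quasiMeasurePreserving.ae h

/-- Conull sets contain invariant measurable conull sets. -/
theorem exists_invariant_measurableSet {Q : Ω → Prop} (h : ∀ᵐ ω ∂P, Q ω) :
    ∃ S : Set Ω, MeasurableSet S ∧ (∀ᵐ ω ∂P, ω ∈ S) ∧ (∀ (g : G) ω, g • ω ∈ S ↔ ω ∈ S) ∧
      ∀ ω ∈ S, Q ω := by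
  obtain ⟨T, hTQ, hTm, hT⟩ := eventually_iff_exists_mem.1 h |>.imp fun T hT =>
    (show _ ∧ _ ∧ _ from ⟨hT.2, trivial, hT.1⟩)
  have hnull : P Tᶜ = 0 := hT
  -- The invariant set consists of the points whose whole orbit avoids this measurable null set;
  -- countability of G keeps it measurable and conull.
  set N := toMeasurable P Tᶜ with hN
  have hNn : P N = 0 := by rw [hN, measure_toMeasurable, hnull]
  refine ⟨{ω | ∀ g : G, g • ω ∉ N}, ?_, ?_, ?_, ?_⟩
  · simp only [ofPred_forall]
    exact MeasurableSet.iInter fun g =>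
      (measurable_const_smul g) (measurableSet_toMeasurable P Tᶜ).compl
  · exact ae_forall_smul (measure_eq_zero_iff_ae_notMem.1 hNn)
  · intro g ω
    refine ⟨fun hω k => ?_, fun hω k => ?_⟩
    · have := hω (k * g⁻¹); rwa [smul_smul, inv_mul_cancel_right] at this
    · rw [smul_smul]; exact hω _
  · intro ω hω
    have h1 := hω 1
    rw [one_smul] at h1
    exact hTQ ω (not_not.1 fun h2 => h1 (subset_toMeasurable P Tᶜ h2))

end NullSets

/-! ### Disintegration, stated as resampling of one coordinate -/

section Disintegration

variable {Ω X Y : Type*} [MeasurableSpace Ω] [MeasurableSpace X] [MeasurableSpace Y]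

/-- The measure `ρ` on `X × Y` is not changed if the second coordinate is sampled anew from
`K`. -/
def IsResampling (ρ : Measure (X × Y)) (K : Kernel X Y) : Prop :=
  ∀ f : X × Y → ℝ≥0∞, Measurable f → ∫⁻ z, f z ∂ρ = ∫⁻ z, ∫⁻ y, f (z.1, y) ∂K z.1 ∂ρ

/-- Dividing by the total mass gives a finite kernel, which has a conditional kernel; the resampling
identity is homogeneous, so the factor cancels wherever the mass is neither zero nor infinite. For
mass zero the identity is trivial. -/
theorem exists_isResampling [StandardBorelSpace Y] [Nonempty Y]
    [MeasurableSpace.CountablyGenerated X] (κ : Kernel Ω (X × Y)) [IsSFiniteKernel κ] :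
    ∃ K : Kernel (Ω × X) Y, IsMarkovKernel K ∧
      ∀ ω, κ ω univ < ∞ → IsResampling (κ ω) (K.sectR ω) := by
  have hm : Measurable (Function.uncurry fun (ω : Ω) (_ : X × Y) => (κ ω univ)⁻¹) :=
    ((κ.measurable_coe MeasurableSet.univ).inv).comp measurable_fst
  set κ' := κ.withDensity fun ω _ => (κ ω univ)⁻¹ with hκ'
  have happ : ∀ ω, κ' ω = (κ ω univ)⁻¹ • κ ω := fun ω => by
    rw [hκ', Kernel.withDensity_apply κ hm, withDensity_const]
  have : IsFiniteKernel κ' := ⟨1, ENNReal.one_lt_top, fun ω => by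
    rw [happ, Measure.smul_apply, smul_eq_mul]
    exact ENNReal.inv_mul_le_one _⟩
  refine ⟨κ'.condKernel, inferInstance, fun ω hω f hf => ?_⟩
  rcases eq_or_ne (κ ω univ) 0 with h0 | h0
  · simp [Measure.measure_univ_eq_zero.1 h0]
  have h1 : ∫⁻ z, f z ∂κ' ω = ∫⁻ z, ∫⁻ y, f (z.1, y) ∂(κ'.condKernel.sectR ω) z.1 ∂κ' ω := by
    conv_lhs => rw [← κ'.disintegrate κ'.condKernel]
    rw [Kernel.lintegral_compProd _ _ _ hf, Kernel.fst_apply, lintegral_map _ measurable_fst]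
    · simp [Kernel.sectR_apply]
    · exact hf.lintegral_kernel_prod_right' (κ := κ'.condKernel.sectR ω)
  simp only [happ, lintegral_smul_measure, smul_eq_mul] at h1
  exact (ENNReal.mul_right_inj (ENNReal.inv_ne_zero.2 hω.ne) (ENNReal.inv_ne_top.2 h0)).1 h1

end Disintegration

/-! ### Equivariant disintegration and gluing of couplings -/

section EquivariantExtension

variable {G : Type*} [Group G] [Countable G] {Ω X Y : Type*} [MeasurableSpace Ω]
  [MeasurableSpace X] [MeasurableSpace Y] [MulAction G Ω] [MulAction G X] [MulAction G Y]
  [MeasurableConstSMul G Ω] [MeasurableConstSMul G X] [MeasurableConstSMul G Y]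

instance : MeasurableConstSMul G (X × Y) :=
  ⟨fun g => ((measurable_const_smul g).comp measurable_fst).prodMk
    ((measurable_const_smul g).comp measurable_snd)⟩

/-- Equivariance of a kernel from `Ω × X` to `Y`, in terms of integrals. -/
def IsEquivariantKernel (G : Type*) [Group G] [MulAction G Ω] [MulAction G X] [MulAction G Y]
    (K : Kernel (Ω × X) Y) : Prop :=
  ∀ (g : G) ω x (f : Y → ℝ≥0∞), Measurable f →
    ∫⁻ y, f y ∂K (g • ω, g • x) = ∫⁻ y, f (g • y) ∂K (ω, x)

/-- A kernel known on the support of a weight extends equivariantly. -/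
theorem exists_equivariantExtension {w : X → ℝ≥0∞} (hw : IsWeight G w)
    (K₀ : Kernel (Ω × X) Y) [IsMarkovKernel K₀] :
    ∃ K : Kernel (Ω × X) Y, IsMarkovKernel K ∧ IsEquivariantKernel G K ∧
      ∀ ω x (f : Y → ℝ≥0∞), Measurable f → ∫⁻ y, f y ∂K (ω, x) =
        ∑' g : G, w (g⁻¹ • x) * ∫⁻ y, f (g • y) ∂K₀ (g⁻¹ • ω, g⁻¹ • x) := by
  have hτ : ∀ g : G, Measurable fun z : Ω × X => (g⁻¹ • z.1, g⁻¹ • z.2) := fun g =>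
    ((measurable_const_smul g⁻¹).comp measurable_fst).prodMk
      ((measurable_const_smul g⁻¹).comp measurable_snd)
  have hwm : ∀ g : G, Measurable (Function.uncurry fun (z : Ω × X) (_ : Y) => w (g⁻¹ • z.2)) :=
    fun g => hw.measurable.comp ((measurable_const_smul g⁻¹).comp
      (measurable_snd.comp measurable_fst))
  -- A mixture of all translates of K₀, the g-th one having weight w(g⁻¹x); these weights sum to
  -- one, hence the Markov property.
  set K : Kernel (Ω × X) Y := Kernel.sum fun g : G =>
    ((K₀.comap _ (hτ g)).map (fun y => g • y)).withDensity fun z _ => w (g⁻¹ • z.2) with hK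
  have key : ∀ ω x (f : Y → ℝ≥0∞), Measurable f → ∫⁻ y, f y ∂K (ω, x) =
      ∑' g : G, w (g⁻¹ • x) * ∫⁻ y, f (g • y) ∂K₀ (g⁻¹ • ω, g⁻¹ • x) := fun ω x f hf => by
    have : ∀ g : G, IsMarkovKernel ((K₀.comap _ (hτ g)).map (fun y => g • y)) := fun g =>
      Kernel.IsMarkovKernel.map _ (measurable_const_smul g)
    rw [hK, Kernel.sum_apply, lintegral_sum_measure]
    congr 1; ext g
    rw [Kernel.lintegral_withDensity _ (hwm g) _ hf, lintegral_const_mul _ hf,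
      Kernel.map_apply _ (measurable_const_smul g), lintegral_map hf (measurable_const_smul g),
      Kernel.comap_apply]
  refine ⟨K, ⟨fun z => ⟨?_⟩⟩, ?_, key⟩
  · have := key z.1 z.2 1 measurable_one
    simp only [Pi.one_apply, lintegral_one, measure_univ, mul_one] at this
    exact this.trans (((Equiv.inv G).tsum_eq fun g => w (g • z.2)).trans (hw.tsum_eq z.2))
  · intro g ω x f hf
    rw [key _ _ _ hf, key _ _ (fun y => f (g • y)) (hf.comp (measurable_const_smul g)),
      ← (Equiv.mulLeft g).tsum_eq]
    simp [mul_smul]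

theorem IsEquivariant.lintegral_smul {κ : Kernel Ω X} (hκ : IsEquivariant G κ) (g : G) (ω : Ω)
    {f : X → ℝ≥0∞} (hf : Measurable f) :
    ∫⁻ x, f x ∂κ (g • ω) = ∫⁻ x, f (g • x) ∂κ ω := by
  rw [hκ g ω, lintegral_map hf (measurable_const_smul g)]

theorem isEquivariant_of_lintegral {κ : Kernel Ω X}
    (h : ∀ (g : G) ω (f : X → ℝ≥0∞), Measurable f →
      ∫⁻ x, f x ∂κ (g • ω) = ∫⁻ x, f (g • x) ∂κ ω) : IsEquivariant G κ := fun g ω => by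
  refine Measure.ext_of_lintegral _ fun f hf => ?_
  rw [h g ω f hf, lintegral_map hf (measurable_const_smul g)]

variable {P : Measure Ω} [SMulInvariantMeasure G Ω P]

/-- Equivariant disintegration of an equivariant random measure on a product. -/
theorem exists_equivariant_isResampling [StandardBorelSpace Y] [Nonempty Y]
    [MeasurableSpace.CountablyGenerated X] {B : Set X} (hB : IsFundamentalRegion G B)
    (q : Kernel Ω (X × Y)) [IsSFiniteKernel q] (hq : IsEquivariant G q)
    (hfin : ∀ᵐ ω ∂P, q ω (B ×ˢ univ) < ∞) :
    ∃ K : Kernel (Ω × X) Y, IsMarkovKernel K ∧ IsEquivariantKernel G K ∧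
      ∀ᵐ ω ∂P, IsResampling (q ω) (K.sectR ω) := by
  have hBm : MeasurableSet (B ×ˢ (univ : Set Y)) := hB.measurableSet.prod MeasurableSet.univ
  -- Only the part of q over B, which has finite mass almost surely, is disintegrated; equivariance
  -- carries the kernel to the other translates.
  obtain ⟨K₀, hK₀, hres⟩ := exists_isResampling (q.restrict hBm)
  obtain ⟨K, hK, hKe, hKf⟩ := exists_equivariantExtension hB.isWeight K₀
  refine ⟨K, hK, hKe, ?_⟩
  filter_upwards [ae_forall_smul (G := G) hfin] with ω hω f hf
  set w : X → ℝ≥0∞ := B.indicator 1 with hw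
  have hwm : Measurable w := hB.isWeight.measurable
  have hK₀m : ∀ g : G, Measurable fun z : X × Y =>
      ∫⁻ y, f (g • z.1, g • y) ∂K₀ (g⁻¹ • ω, z.1) := fun g => by
    have : Measurable fun z : X × Y => f (g • z.1, g • z.2) :=
      hf.comp (((measurable_const_smul g).comp measurable_fst).prodMk
        ((measurable_const_smul g).comp measurable_snd))
    exact (this.lintegral_kernel_prod_right' (κ := K₀.sectR (g⁻¹ • ω))).comp measurable_fst
  have hres' : ∀ g : G, ∫⁻ z, w z.1 * f (g • z.1, g • z.2) ∂q (g⁻¹ • ω) =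
      ∫⁻ z, w z.1 * ∫⁻ y, f (g • z.1, g • y) ∂K₀ (g⁻¹ • ω, z.1) ∂q (g⁻¹ • ω) := fun g => by
    have hind : ∀ F : X × Y → ℝ≥0∞,
        ∫⁻ z, w z.1 * F z ∂q (g⁻¹ • ω) = ∫⁻ z, F z ∂(q.restrict hBm) (g⁻¹ • ω) := fun F => by
      rw [Kernel.restrict_apply, ← lintegral_indicator hBm]
      congr 1; ext z
      by_cases hz : z.1 ∈ B <;> simp [hw, indicator, hz]
    rw [hind (fun z => f (g • z.1, g • z.2)),
      hind (fun z => ∫⁻ y, f (g • z.1, g • y) ∂K₀ (g⁻¹ • ω, z.1))]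
    refine hres (g⁻¹ • ω) ?_ (fun z => f (g • z.1, g • z.2)) ?_
    · rw [Kernel.restrict_apply, Measure.restrict_apply_univ]; exact hω g⁻¹
    · exact hf.comp (((measurable_const_smul g).comp measurable_fst).prodMk
        ((measurable_const_smul g).comp measurable_snd))
  have hshift : ∀ (g : G) (F : X × Y → ℝ≥0∞), Measurable F →
      ∫⁻ z, F z ∂q ω = ∫⁻ z, F (g • z) ∂q (g⁻¹ • ω) := fun g F hF => by
    rw [← hq.lintegral_smul g (g⁻¹ • ω) hF, smul_inv_smul]
  have hwsum : ∀ x, ∑' g : G, w (g⁻¹ • x) = 1 := fun x =>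
    ((Equiv.inv G).tsum_eq fun g => w (g • x)).trans (hB.isWeight.tsum_eq x)
  have hA : ∀ g : G, Measurable fun z : X × Y => w (g⁻¹ • z.1) := fun g =>
    hwm.comp ((measurable_const_smul g⁻¹).comp measurable_fst)
  have hC : ∀ g : G, Measurable fun z : X × Y => w (g⁻¹ • z.1) *
      ∫⁻ y, f (z.1, g • y) ∂K₀ (g⁻¹ • ω, g⁻¹ • z.1) := fun g => by
    refine (hA g).mul ?_
    have := (hK₀m g).comp ((measurable_const_smul g⁻¹ : Measurable fun z : X × Y => g⁻¹ • z))
    simpa [Function.comp_def] using this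
  -- The integral is cut into the parts over the translates gB. Each part is moved back to B,
  -- resampled there with K₀ at g⁻¹ω, and moved forward again.
  calc ∫⁻ z, f z ∂q ω
      = ∫⁻ z, ∑' g : G, w (g⁻¹ • z.1) * f z ∂q ω := by
        simp_rw [ENNReal.tsum_mul_right, hwsum, one_mul]
    _ = ∑' g : G, ∫⁻ z, w (g⁻¹ • z.1) * f z ∂q ω :=
        lintegral_tsum fun g => ((hA g).mul hf).aemeasurable
    _ = ∑' g : G, ∫⁻ z, w (g⁻¹ • z.1) * ∫⁻ y, f (z.1, g • y) ∂K₀ (g⁻¹ • ω, g⁻¹ • z.1) ∂q ω := by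
        congr 1; ext g
        rw [hshift g (fun z => w (g⁻¹ • z.1) * f z) ((hA g).mul hf), hshift g _ (hC g)]
        simpa [Prod.smul_def] using hres' g
    _ = ∫⁻ z, ∑' g : G, w (g⁻¹ • z.1) * ∫⁻ y, f (z.1, g • y) ∂K₀ (g⁻¹ • ω, g⁻¹ • z.1) ∂q ω :=
        (lintegral_tsum fun g => (hC g).aemeasurable).symm
    _ = ∫⁻ z, ∫⁻ y, f (z.1, y) ∂(K.sectR ω) z.1 ∂q ω := by
        congr 1; ext z
        rw [Kernel.sectR_apply, hKf ω z.1 (fun y => f (z.1, y)) (by fun_prop)]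

/-- Gluing: the second coordinate is followed by a sample of `K`. -/
def glue {X Y Z : Type*} [MeasurableSpace X] [MeasurableSpace Y] [MeasurableSpace Z]
    (q : Kernel Ω (X × Y)) (K : Kernel (Ω × Y) Z) : Kernel Ω ((X × Y) × Z) :=
  q ⊗ₖ K.comap (fun z => (z.1, z.2.2)) (by fun_prop)

theorem lintegral_glue {X Y Z : Type*} [MeasurableSpace X] [MeasurableSpace Y] [MeasurableSpace Z]
    (q : Kernel Ω (X × Y)) [IsSFiniteKernel q] (K : Kernel (Ω × Y) Z) [IsMarkovKernel K] (ω : Ω)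
    {f : (X × Y) × Z → ℝ≥0∞} (hf : Measurable f) :
    ∫⁻ t, f t ∂glue q K ω = ∫⁻ z, ∫⁻ y, f (z, y) ∂K (ω, z.2) ∂q ω := by
  rw [glue, Kernel.lintegral_compProd _ _ _ hf]
  simp [Kernel.comap_apply]

section Glue

variable {Z : Type*} [MeasurableSpace Z] [MulAction G Z] [MeasurableConstSMul G Z]
  {q : Kernel Ω (X × Y)} [IsSFiniteKernel q] {K : Kernel (Ω × Y) Z} [IsMarkovKernel K]

theorem IsEquivariant.glue (hq : IsEquivariant G q) (hK : IsEquivariantKernel G K) :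
    IsEquivariant G (glue q K) := by
  refine isEquivariant_of_lintegral fun g ω f hf => ?_
  have hf' : Measurable fun t : (X × Y) × Z => f (g • t) := hf.comp (measurable_const_smul g)
  rw [lintegral_glue q K _ hf, lintegral_glue q K _ hf', hq.lintegral_smul]
  · congr 1; ext z
    exact hK g ω z.2 (fun y => f (g • z, y)) (by fun_prop)
  · exact hf.lintegral_kernel_prod_right' (κ := (K.sectR (g • ω)).comap Prod.snd measurable_snd)

theorem map_fst_glue (ω : Ω) : (glue q K ω).map Prod.fst = q ω := by
  refine Measure.ext_of_lintegral _ fun f hf => ?_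
  rw [lintegral_map hf measurable_fst,
    lintegral_glue q K ω (f := fun t => f t.1) (hf.comp measurable_fst)]
  simp

/-- The resampled integral depends on r only through its first marginal, which is the second
marginal of q. -/
theorem map_snd_glue {r : Measure (Y × Z)} {ω : Ω} (hr : IsResampling r (K.sectR ω))
    (hqr : (q ω).map Prod.snd = r.map Prod.fst) :
    (glue q K ω).map (fun t => (t.1.2, t.2)) = r := by
  refine Measure.ext_of_lintegral _ fun f hf => ?_
  have h1 : Measurable fun y => ∫⁻ z, f (y, z) ∂(K.sectR ω) y :=
    hf.lintegral_kernel_prod_right' (κ := K.sectR ω)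
  rw [lintegral_map hf (by fun_prop), lintegral_glue q K ω (by fun_prop), hr f hf,
    ← lintegral_map h1 measurable_fst, ← hqr, lintegral_map h1 measurable_snd]
  rfl

end Glue

end EquivariantExtension

instance {Ω X Y Z : Type*} [MeasurableSpace Ω] [MeasurableSpace X] [MeasurableSpace Y]
    [MeasurableSpace Z] (q : Kernel Ω (X × Y)) (K : Kernel (Ω × Y) Z) :
    IsSFiniteKernel (glue q K) := by
  rw [glue]; infer_instance

/-- All three terms are L^p norms with respect to the Campbell measure with density w. -/
theorem expect_minkowski {Ω X : Type*} [MeasurableSpace Ω] [MeasurableSpace X] (P : Measure Ω)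
    [SFinite P] (κ : Kernel Ω X) [IsSFiniteKernel κ] {w f g : X → ℝ≥0∞} (hw : Measurable w)
    (hf : Measurable f) (hg : Measurable g) {p : ℝ} (hp : 1 ≤ p) :
    expect P κ (fun x => w x * (f x + g x) ^ p) ^ (1 / p) ≤
      expect P κ (fun x => w x * f x ^ p) ^ (1 / p) +
        expect P κ (fun x => w x * g x ^ p) ^ (1 / p) := by
  have h : ∀ F : X → ℝ≥0∞, Measurable F → expect P κ (fun x => w x * F x ^ p) =
      ∫⁻ z, F z.1 ^ p ∂((campbell P κ).withDensity fun z => w z.1) := fun F hF => by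
    rw [expect_eq_lintegral_campbell P κ (by fun_prop),
      lintegral_withDensity_eq_lintegral_mul _ (by fun_prop) (by fun_prop)]
    rfl
  rw [h f hf, h g hg, h (fun x => f x + g x) (hf.add hg)]
  exact ENNReal.lintegral_Lp_add_le (f := fun z : X × Ω => f z.1) (g := fun z : X × Ω => g z.1)
    (by fun_prop) (by fun_prop) hp

/-! ### The triangle inequality for the transport distance -/

section Triangle

variable {M : Type*} [MetricSpace M] [ProperSpace M] [MeasurableSpace M] [BorelSpace M]
  {G : Type*} [Group G] [Countable G] [MulAction G M] [IsIsometricSMul G M]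
  {Ω : Type*} [MeasurableSpace Ω] [MulAction G Ω] [MeasurableConstSMul G Ω] {P : Measure Ω}
  [IsProbabilityMeasure P] [SMulInvariantMeasure G Ω P] {m : Measure M} {p : ℝ}

/-- A cylinder over a neighbourhood has the mass of that neighbourhood, so local finiteness of one
marginal suffices. -/
theorem isLocallyFiniteMeasure_of_isCoupling {q : Measure (M × M)} {lam nu : Measure M}
    [IsLocallyFiniteMeasure lam] (hq : IsCoupling q lam nu) : IsLocallyFiniteMeasure q := by
  refine ⟨fun z => ?_⟩
  obtain ⟨s, hs, hso, hs'⟩ := lam.exists_isOpen_measure_lt_top z.1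
  refine ⟨Prod.fst ⁻¹' s, (hso.preimage continuous_fst).mem_nhds hs, ?_⟩
  rwa [← Measure.map_apply measurable_fst hso.measurableSet, hq.1]

/-- An equivariant kernel which is almost surely a coupling can be modified on a null set so as to
be an equivariant coupling. -/
theorem exists_isEquivariantCoupling {κ : Kernel Ω (M × M)} (hκ : IsEquivariant G κ)
    {lam nu : Kernel Ω M} (hlam : IsRandomMeasure lam)
    (h : ∀ᵐ ω ∂P, IsCoupling (κ ω) (lam ω) (nu ω)) :
    ∃ q, IsEquivariantCoupling G P q lam nu ∧ ∀ᵐ ω ∂P, q ω = κ ω := by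
  classical
  -- Off an invariant set the kernel is set to zero. Invariance keeps it equivariant for every ω,
  -- and the coupling property on S makes it locally finite for every ω.
  obtain ⟨S, hSm, hS, hSinv, hSc⟩ := exists_invariant_measurableSet (G := G) h
  have hae : ∀ᵐ ω ∂P, Kernel.piecewise hSm κ 0 ω = κ ω := hS.mono fun ω hω => by
    simp [Kernel.piecewise_apply, hω]
  refine ⟨Kernel.piecewise hSm κ 0, ⟨fun ω => ?_, fun g ω => ?_, ?_⟩, hae⟩
  · rw [Kernel.piecewise_apply]
    split_ifs with hω
    · have := hlam ω
      exact isLocallyFiniteMeasure_of_isCoupling (hSc ω hω)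
    · rw [zero_apply]; infer_instance
  · rw [Kernel.piecewise_apply, Kernel.piecewise_apply, hSinv g ω]
    split_ifs
    · exact hκ g ω
    · simp
  · filter_upwards [hae, h] with ω h1 h2
    rwa [h1]

theorem isWeight_fst {B₀ : Set M} (hB₀ : IsFundamentalRegion G B₀) :
    IsWeight G (fun z : M × M => (B₀.indicator 1 z.1 : ℝ≥0∞)) :=
  hB₀.isWeight.comp measurable_fst fun _ _ => rfl

theorem isWeight_snd {B₀ : Set M} (hB₀ : IsFundamentalRegion G B₀) :
    IsWeight G (fun z : M × M => (B₀.indicator 1 z.2 : ℝ≥0∞)) :=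
  hB₀.isWeight.comp measurable_snd fun _ _ => rfl

theorem Wp_eq_iInf (hp : 0 < p) (lam nu : Kernel Ω M) : Wp G P m p lam nu =
    ⨅ (q : Kernel Ω (M × M)) (_ : IsEquivariantCoupling G P q lam nu),
      meanCost G P m p q ^ (1 / p) := by
  have := (ENNReal.orderIsoRpow (1 / p) (by positivity)).map_iInf₂
    (fun (q : Kernel Ω (M × M)) (_ : IsEquivariantCoupling G P q lam nu) => meanCost G P m p q)
  exact this

variable {B₀ : Set M} (hB₀ : IsFundamentalRegion G B₀) [SMulInvariantMeasure G M m]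
  (hmB₀ : m B₀ = 1)

include hB₀ hmB₀

/-- The cost of a coupling obtained by forgetting the middle coordinate. -/
theorem optimalMeanCost_le_expect {γ : Kernel Ω ((M × M) × M)} (hγ : IsEquivariant G γ)
    {lam nu : Kernel Ω M} (hlam : IsRandomMeasure lam)
    (h1 : ∀ᵐ ω ∂P, (γ ω).map (fun t => t.1.1) = lam ω)
    (h2 : ∀ᵐ ω ∂P, (γ ω).map (fun t => t.2) = nu ω) {w : (M × M) × M → ℝ≥0∞}
    (hw : IsWeight G w) :
    optimalMeanCost G P m p lam nu ≤ expect P γ (fun t => w t * edist t.1.1 t.2 ^ p) := by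
  have hτ : Measurable fun t : (M × M) × M => (t.1.1, t.2) := by fun_prop
  obtain ⟨q, hq, hqκ⟩ := exists_isEquivariantCoupling (G := G) (P := P) (κ := γ.map _)
    (hγ.map hτ fun _ _ => rfl) hlam (nu := nu) (by
      filter_upwards [h1, h2] with ω h1 h2
      rw [Kernel.map_apply _ hτ]
      exact ⟨by rw [Measure.map_map measurable_fst hτ]; exact h1,
        by rw [Measure.map_map measurable_snd hτ]; exact h2⟩)
  refine (iInf₂_le q hq).trans_eq ?_
  have hw' := isWeight_snd hB₀
  rw [meanCost_eq hB₀ hmB₀ hq.isEquivariant hw', expect_congr hqκ,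
    expect_map (f := fun z : M × M => B₀.indicator 1 z.2 * edist z.1 z.2 ^ p) hτ
      (hw'.measurable.mul measurable_edist_rpow)]
  exact mass_transport hγ (hw'.comp hτ fun _ _ => rfl) hw
    (measurable_edist_rpow.comp hτ) (fun g t => by simp)

/-- The couplings are glued along mu. Both costs, and the cost of the composition, are evaluated
with one and the same weight, the indicator of B₀ in the middle coordinate; then Minkowski applies.
-/
theorem Wp_triangle (hB₀bdd : Bornology.IsBounded B₀) (hp : 1 ≤ p) {lam mu nu : Kernel Ω M}
    (hlam : IsRandomMeasure lam) (hmu : IsRandomMeasure mu) :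
    Wp G P m p lam nu ≤ Wp G P m p lam mu + Wp G P m p mu nu := by
  have hp0 : 0 < p := by linarith
  rw [Wp_eq_iInf hp0 lam mu, Wp_eq_iInf hp0 mu nu]
  refine ENNReal.le_iInf₂_add_iInf₂ fun q₁ hq₁ q₂ hq₂ => ?_
  have := hq₁.isRandomMeasure.isSFiniteKernel
  have := hq₂.isRandomMeasure.isSFiniteKernel
  obtain ⟨z⟩ : Nonempty M := by
    rcases B₀.eq_empty_or_nonempty with h | ⟨z, -⟩
    · simp [h] at hmB₀
    · exact ⟨z⟩
  have : Nonempty M := ⟨z⟩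
  obtain ⟨K, hK, hKe, hKr⟩ := exists_equivariant_isResampling (P := P) hB₀ q₂ hq₂.isEquivariant (by
    filter_upwards [hq₂.isCoupling] with ω hω
    have := hmu ω
    have h1 : q₂ ω (B₀ ×ˢ univ) = mu ω B₀ := by
      rw [← hω.1, Measure.map_apply measurable_fst hB₀.measurableSet]
      congr 1; ext z; simp
    rw [h1]
    exact hB₀bdd.measure_lt_top)
  have hγ := hq₁.isEquivariant.glue hKe
  have h12 : ∀ ω, (glue q₁ K ω).map Prod.fst = q₁ ω := fun ω => map_fst_glue ω
  have hτ : Measurable fun t : (M × M) × M => (t.1.2, t.2) := by fun_prop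
  have h23 : ∀ᵐ ω ∂P, (glue q₁ K ω).map (fun t => (t.1.2, t.2)) = q₂ ω := by
    filter_upwards [hKr, hq₁.isCoupling, hq₂.isCoupling] with ω h1 h2 h3
    exact map_snd_glue h1 (by rw [h2.2, h3.1])
  have hw : IsWeight G fun t : (M × M) × M => (B₀.indicator 1 t.1.2 : ℝ≥0∞) :=
    (isWeight_snd hB₀).comp measurable_fst fun _ _ => rfl
  have hle := optimalMeanCost_le_expect (P := P) (p := p) hB₀ hmB₀ hγ hlam (nu := nu)
    (by
      filter_upwards [hq₁.isCoupling] with ω hω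
      rw [← hω.1, ← h12 ω, Measure.map_map measurable_fst measurable_fst]; rfl)
    (by
      filter_upwards [h23, hq₂.isCoupling] with ω h h2
      rw [← h2.2, ← h, Measure.map_map measurable_snd hτ]; rfl) hw
  have e1 : meanCost G P m p q₁ = expect P (glue q₁ K)
      (fun t => B₀.indicator 1 t.1.2 * edist t.1.1 t.1.2 ^ p) := by
    rw [meanCost_eq hB₀ hmB₀ hq₁.isEquivariant (isWeight_snd hB₀)]
    have : ∀ᵐ ω ∂P, q₁ ω = (glue q₁ K).map Prod.fst ω := ae_of_all _ fun ω => by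
      rw [Kernel.map_apply _ measurable_fst, h12]
    rw [expect_congr this, expect_map (f := fun z : M × M => B₀.indicator 1 z.2 * edist z.1 z.2 ^ p)
      measurable_fst ((isWeight_snd hB₀).measurable.mul measurable_edist_rpow)]
  have e2 : meanCost G P m p q₂ = expect P (glue q₁ K)
      (fun t => B₀.indicator 1 t.1.2 * edist t.1.2 t.2 ^ p) := by
    rw [meanCost_eq hB₀ hmB₀ hq₂.isEquivariant (isWeight_fst hB₀)]
    have : ∀ᵐ ω ∂P, q₂ ω = (glue q₁ K).map (fun t => (t.1.2, t.2)) ω := h23.mono fun ω h => by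
      rw [Kernel.map_apply _ hτ, h]
    rw [expect_congr this, expect_map (f := fun z : M × M => B₀.indicator 1 z.1 * edist z.1 z.2 ^ p)
      hτ ((isWeight_fst hB₀).measurable.mul measurable_edist_rpow)]
  rw [e1, e2, Wp]
  refine (ENNReal.rpow_le_rpow (hle.trans (expect_mono fun t => ?_)) (by positivity)).trans
    (expect_minkowski P (glue q₁ K) hw.measurable (by fun_prop) (by fun_prop) hp)
  gcongr
  exact edist_triangle _ _ _

end Triangle

/-! ### Campbell measures: marginals and finiteness on compact sets -/

section Campbell

variable {Ω X Y : Type*} [MeasurableSpace Ω] [MeasurableSpace X] [MeasurableSpace Y]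
  {P : Measure Ω} [SFinite P]

theorem lintegral_campbell (P : Measure Ω) [SFinite P] (κ : Kernel Ω X) [IsSFiniteKernel κ]
    {f : X × Ω → ℝ≥0∞}
    (hf : Measurable f) : ∫⁻ z, f z ∂campbell P κ = ∫⁻ ω, ∫⁻ x, f (x, ω) ∂κ ω ∂P := by
  rw [campbell, lintegral_map hf measurable_swap,
    Measure.lintegral_compProd (f := fun z => f z.swap) (hf.comp measurable_swap)]
  rfl

theorem map_campbell {κ : Kernel Ω X} [IsSFiniteKernel κ] {κ' : Kernel Ω Y} [IsSFiniteKernel κ']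
    {τ : X → Y} (hτ : Measurable τ) (h : ∀ᵐ ω ∂P, (κ ω).map τ = κ' ω) :
    (campbell P κ).map (fun z => (τ z.1, z.2)) = campbell P κ' := by
  have hm : Measurable fun z : X × Ω => (τ z.1, z.2) := by fun_prop
  refine Measure.ext_of_lintegral _ fun f hf => ?_
  rw [lintegral_map hf hm, lintegral_campbell P κ (f := fun z => f (τ z.1, z.2)) (hf.comp hm), lintegral_campbell P κ' hf]
  refine lintegral_congr_ae (h.mono fun ω hω => ?_)
  simp only [← hω]
  rw [lintegral_map (by fun_prop) hτ]

/-- A compact set lies in the cylinder over its projection, whose Campbell mass is given by m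
through unit intensity. For couplings one marginal of unit intensity is enough. -/
theorem isFiniteMeasureOnCompacts_campbell [TopologicalSpace Ω] [TopologicalSpace X]
    [TopologicalSpace Y] [T2Space Y] [OpensMeasurableSpace Y] {κ : Kernel Ω X} [IsSFiniteKernel κ]
    {lam : Kernel Ω Y} {m : Measure Y} [IsFiniteMeasureOnCompacts m] {τ : X → Y}
    (hτc : Continuous τ) (hτ : Measurable τ) (h : ∀ᵐ ω ∂P, (κ ω).map τ = lam ω)
    (hlam : HasUnitIntensity P m lam) : IsFiniteMeasureOnCompacts (campbell P κ) := by
  refine ⟨fun K hK => ?_⟩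
  have hK' : IsCompact ((fun z : X × Ω => τ z.1) '' K) := hK.image (by fun_prop)
  have hm : Measurable fun z : X × Ω => τ z.1 := by fun_prop
  refine (measure_mono (subset_preimage_image (fun z : X × Ω => τ z.1) K)).trans_lt ?_
  have h1 : campbell P κ ((fun z : X × Ω => τ z.1) ⁻¹' ((fun z : X × Ω => τ z.1) '' K)) =
      m ((fun z : X × Ω => τ z.1) '' K) := by
    rw [← hlam _ hK'.measurableSet, ← lintegral_indicator_one (hm hK'.measurableSet),
      lintegral_campbell P κ (measurable_one.indicator (hm hK'.measurableSet))]
    refine lintegral_congr_ae (h.mono fun ω hω => ?_)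
    simp only [← hω]
    rw [Measure.map_apply hτ hK'.measurableSet,
      ← lintegral_indicator_one (hτ hK'.measurableSet)]
    rfl
  rw [h1]
  exact hK'.measure_lt_top

end Campbell

/-! ### Test function integrals are controlled by the transport cost -/

section Vague

variable {M : Type*} [MetricSpace M] [ProperSpace M] [MeasurableSpace M] [BorelSpace M]
  {G : Type*} [Group G] [Countable G] [MulAction G M] [IsIsometricSMul G M]
  {Ω : Type*} [MetricSpace Ω] [MeasurableSpace Ω] [OpensMeasurableSpace Ω]
  [MulAction G Ω] [MeasurableConstSMul G Ω] {P : Measure Ω}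
  [IsProbabilityMeasure P] [SMulInvariantMeasure G Ω P] {m : Measure M}
  [IsFiniteMeasureOnCompacts m] [SMulInvariantMeasure G M m] {p : ℝ}
  {B₀ : Set M} (hB₀ : IsFundamentalRegion G B₀) (hmB₀ : m B₀ = 1)

-- The translates of B₀ indexed by I are all those that meet K, hence they cover K.
include hB₀ in
omit [MetricSpace M] [ProperSpace M] [BorelSpace M] [IsIsometricSMul G M] [Countable G] in
theorem indicator_le_sum {K : Set M} {I : Finset G}
    (hI : ∀ g : G, (∃ x ∈ B₀, g • x ∈ K) → g ∈ I) (x : M) :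
    (K.indicator 1 x : ℝ≥0∞) ≤ ∑ g ∈ I, B₀.indicator 1 (g⁻¹ • x) := by
  by_cases hx : x ∈ K
  · obtain ⟨g, y, hy, rfl⟩ := mem_iUnion.1 (hB₀.iUnion_smul ▸ mem_univ x)
    refine le_trans ?_ (Finset.single_le_sum (f := fun h : G => (B₀.indicator 1 (h⁻¹ • g • y) :
      ℝ≥0∞)) (fun _ _ => zero_le) (hI g ⟨y, hy, hx⟩))
    simp [hx, hy]
  · simp [hx]

include hB₀ in
/-- Localizing to a bounded set costs at most a finite multiple of localizing to `B₀`. -/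
theorem expect_indicator_le {κ : Kernel Ω (M × M)} (hκ : IsEquivariant G κ) {K : Set M}
    {I : Finset G} (hI : ∀ g : G, (∃ x ∈ B₀, g • x ∈ K) → g ∈ I) {τ : M × M → M}
    (hτ : Measurable τ) (hτG : ∀ (g : G) z, τ (g • z) = g • τ z) {w : M × M → ℝ≥0∞}
    (hw : IsWeight G w) {h : M × M → ℝ≥0∞} (hh : Measurable h)
    (hinv : ∀ (g : G) z, h (g • z) = h z) :
    expect P κ (fun z => K.indicator 1 (τ z) * h z) ≤ I.card * expect P κ (fun z => w z * h z) := by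
  have h1 : ∀ g : G, IsWeight G (fun z => (B₀.indicator 1 (g⁻¹ • τ z) : ℝ≥0∞)) := fun g =>
    (hB₀.isWeight.smul g⁻¹).comp hτ hτG
  calc expect P κ (fun z => K.indicator 1 (τ z) * h z)
      ≤ expect P κ (fun z => ∑' g : I, B₀.indicator 1 ((g : G)⁻¹ • τ z) * h z) :=
        expect_mono fun z => by
          rw [ENNReal.tsum_mul_right, Finset.tsum_subtype I
            (fun g => (B₀.indicator 1 (g⁻¹ • τ z) : ℝ≥0∞))]
          gcongr
          exact indicator_le_sum hB₀ hI _
    _ = I.card * expect P κ (fun z => w z * h z) := by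
        rw [expect_tsum (f := fun (g : I) z => B₀.indicator 1 ((g : G)⁻¹ • τ z) * h z)
          fun g => (h1 g).measurable.mul hh]
        simp [mass_transport hκ (h1 _) hw hh hinv]

include hB₀ hmB₀ in
/-- Integrals of test functions against the Campbell measures are controlled by the mean cost. -/
theorem enorm_integral_campbell_sub_le
    (hfinite : ∀ K : Set M, Bornology.IsBounded K → {g : G | ∃ x ∈ B₀, g • x ∈ K}.Finite)
    (hp : 0 < p) {f : M × Ω → ℝ} (hf : Continuous f) (hfc : HasCompactSupport f) {ε : ℝ≥0∞}
    (hε : ε ≠ 0) : ∃ A : ℝ≥0∞, A ≠ ∞ ∧ ∀ (lam nu : Kernel Ω M) (q : Kernel Ω (M × M)),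
      IsRandomMeasure lam → IsRandomMeasure nu →
      HasUnitIntensity P m lam → HasUnitIntensity P m nu → IsEquivariantCoupling G P q lam nu →
      ‖∫ z, f z ∂campbell P lam - ∫ z, f z ∂campbell P nu‖ₑ ≤ ε + A * meanCost G P m p q := by
  classical
  set K : Set M := Prod.fst '' tsupport f with hK
  have hKc : IsCompact K := hfc.isCompact.image continuous_fst
  set I : Finset G := (hfinite K hKc.isBounded).toFinset with hI
  have hI' : ∀ g : G, (∃ x ∈ B₀, g • x ∈ K) → g ∈ I := fun g hg => by simpa [hI] using hg
  obtain ⟨C, hC⟩ := hfc.exists_bound_of_continuous hf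
  -- The oscillation bound ε' is paid once per translate in I and once for each of the two
  -- variables, hence the factor 2|I|.
  obtain ⟨ε', hε'0, hε'⟩ : ∃ ε' : ℝ, 0 < ε' ∧ (2 * I.card : ℝ≥0∞) * ENNReal.ofReal ε' ≤ ε := by
    have htend : Tendsto (fun t : ℝ => (2 * I.card : ℝ≥0∞) * ENNReal.ofReal t) (𝓝[>] 0) (𝓝 0) := by
      have : Tendsto (fun t : ℝ => (2 * I.card : ℝ≥0∞) * ENNReal.ofReal t) (𝓝 0)
          (𝓝 ((2 * I.card : ℝ≥0∞) * ENNReal.ofReal 0)) :=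
        ENNReal.Tendsto.const_mul (ENNReal.continuous_ofReal.tendsto 0)
          (Or.inr (by finiteness))
      simp only [ENNReal.ofReal_zero, mul_zero] at this
      exact this.mono_left nhdsWithin_le_nhds
    obtain ⟨t, ht, ht0⟩ := ((htend.eventually_le_const (pos_iff_ne_zero.2 hε)).and
      self_mem_nhdsWithin).exists
    exact ⟨t, ht0, ht⟩
  obtain ⟨δ, hδ, hδf⟩ := Metric.uniformContinuous_iff.1
    (hfc.uniformContinuous_of_continuous hf) ε' hε'0
  -- Beyond distance δ the trivial bound 2C for the difference is at most D times d^p.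
  set D : ℝ≥0∞ := ENNReal.ofReal (2 * C) * (ENNReal.ofReal δ ^ p)⁻¹ with hD
  have hδ0 : ENNReal.ofReal δ ^ p ≠ 0 := by
    simp [ENNReal.rpow_eq_zero_iff, hδ, hp, not_lt.2 hp.le]
  refine ⟨2 * I.card * D, by rw [hD]; finiteness, fun lam nu q hlam hnu hlam1 hnu1 hq => ?_⟩
  have := hlam.isSFiniteKernel
  have := hnu.isSFiniteKernel
  have := hq.isRandomMeasure.isSFiniteKernel
  have m1 : (campbell P q).map (fun z => (z.1.1, z.2)) = campbell P lam :=
    map_campbell measurable_fst (hq.isCoupling.mono fun ω h => h.1)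
  have m2 : (campbell P q).map (fun z => (z.1.2, z.2)) = campbell P nu :=
    map_campbell measurable_snd (hq.isCoupling.mono fun ω h => h.2)
  have c1 : IsFiniteMeasureOnCompacts (campbell P lam) :=
    isFiniteMeasureOnCompacts_campbell (τ := id) continuous_id measurable_id
      (ae_of_all _ fun ω => Measure.map_id) hlam1
  have c2 : IsFiniteMeasureOnCompacts (campbell P nu) :=
    isFiniteMeasureOnCompacts_campbell (τ := id) continuous_id measurable_id
      (ae_of_all _ fun ω => Measure.map_id) hnu1
  have i1 : Integrable (fun z : (M × M) × Ω => f (z.1.1, z.2)) (campbell P q) := by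
    have := hf.integrable_of_hasCompactSupport (μ := campbell P lam) hfc
    rw [← m1] at this
    exact this.comp_measurable (by fun_prop)
  have i2 : Integrable (fun z : (M × M) × Ω => f (z.1.2, z.2)) (campbell P q) := by
    have := hf.integrable_of_hasCompactSupport (μ := campbell P nu) hfc
    rw [← m2] at this
    exact this.comp_measurable (by fun_prop)
  rw [← m1, ← m2, integral_map (by fun_prop) hf.aestronglyMeasurable,
    integral_map (by fun_prop) hf.aestronglyMeasurable, ← integral_sub i1 i2]
  refine (enorm_integral_le_lintegral_enorm _).trans ?_
  set h : M × M → ℝ≥0∞ := fun z => ENNReal.ofReal ε' + D * edist z.1 z.2 ^ p with hh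
  have hhm : Measurable h := by rw [hh]; fun_prop
  have hhinv : ∀ (g : G) z, h (g • z) = h z := fun g z => by simp [hh]
  -- If f does not vanish at both points, at least one of x and y lies in K, which accounts for the
  -- two indicators.
  have hpt : ∀ z : (M × M) × Ω, ‖f (z.1.1, z.2) - f (z.1.2, z.2)‖ₑ ≤
      K.indicator 1 z.1.1 * h z.1 + K.indicator 1 z.1.2 * h z.1 := fun ⟨⟨x, y⟩, ω⟩ => by
    by_cases hxy : f (x, ω) = 0 ∧ f (y, ω) = 0
    · simp [hxy.1, hxy.2]
    have hK1 : (1 : ℝ≥0∞) ≤ K.indicator 1 x + K.indicator 1 y := by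
      by_cases hx : f (x, ω) = 0
      · have hy : f (y, ω) ≠ 0 := fun hy => hxy ⟨hx, hy⟩
        have : y ∈ K := ⟨(y, ω), subset_tsupport f hy, rfl⟩
        simp [this]
      · have : x ∈ K := ⟨(x, ω), subset_tsupport f hx, rfl⟩
        simp [this]
    simp only
    rw [← add_mul]
    refine le_trans ?_ (le_mul_of_one_le_left zero_le hK1)
    rw [hh, ← ofReal_norm]
    simp only
    by_cases hd : dist x y < δ
    · refine le_trans (ENNReal.ofReal_le_ofReal ?_) le_self_add
      have := hδf (a := (x, ω)) (b := (y, ω)) (by simpa [Prod.dist_eq, hδ] using hd)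
      rw [Real.dist_eq] at this
      exact this.le
    · refine le_trans ?_ le_add_self
      push Not at hd
      have h1 : ENNReal.ofReal δ ^ p ≤ edist x y ^ p := by
        refine ENNReal.rpow_le_rpow ?_ hp.le
        rw [edist_dist]; exact ENNReal.ofReal_le_ofReal hd
      rw [hD, mul_assoc]
      have h2 : (1 : ℝ≥0∞) ≤ (ENNReal.ofReal δ ^ p)⁻¹ * edist x y ^ p := by
        rw [← ENNReal.inv_mul_cancel hδ0 (by finiteness)]
        gcongr
      refine le_trans (ENNReal.ofReal_le_ofReal ?_) (le_mul_of_one_le_right zero_le h2)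
      have := norm_sub_le (f (x, ω)) (f (y, ω))
      have := hC (x, ω)
      have := hC (y, ω)
      linarith
  have hKm : Measurable (K.indicator 1 : M → ℝ≥0∞) := measurable_one.indicator hKc.measurableSet
  have hKfst : Measurable fun z : M × M => K.indicator 1 z.1 * h z := by fun_prop
  have hKsnd : Measurable fun z : M × M => K.indicator 1 z.2 * h z := by fun_prop
  have hmean : expect P q (fun z => B₀.indicator 1 z.1 * h z) =
      ENNReal.ofReal ε' + D * meanCost G P m p q := by
    have hw := isWeight_fst hB₀
    rw [meanCost_eq hB₀ hmB₀ hq.isEquivariant hw,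
      ← expect_const_mul (f := fun z : M × M => B₀.indicator 1 z.1 * edist z.1 z.2 ^ p)
        (hw.measurable.mul measurable_edist_rpow)]
    have h1 : expect P q (fun z => ENNReal.ofReal ε' * B₀.indicator 1 z.1) = ENNReal.ofReal ε' := by
      have h2 : expect P q (fun z => B₀.indicator 1 z.1) = 1 := by
        rw [← hmB₀, ← hlam1 B₀ hB₀.measurableSet]
        refine lintegral_congr_ae (hq.isCoupling.mono fun ω hω => ?_)
        simp only [← hω.1]
        rw [← lintegral_indicator_one hB₀.measurableSet,
          lintegral_map hB₀.isWeight.measurable measurable_fst]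
      rw [expect_const_mul hw.measurable, h2, mul_one]
    refine Eq.trans ?_ (congrArg (· + _) h1)
    rw [← expect_add (hw.measurable.const_mul _)]
    congr 1; ext z
    simp only [hh]; ring
  calc ∫⁻ z, ‖f (z.1.1, z.2) - f (z.1.2, z.2)‖ₑ ∂campbell P q
      ≤ ∫⁻ z, K.indicator 1 z.1.1 * h z.1 + K.indicator 1 z.1.2 * h z.1 ∂campbell P q :=
        lintegral_mono hpt
    _ = expect P q (fun z => K.indicator 1 z.1 * h z) +
        expect P q (fun z => K.indicator 1 z.2 * h z) := by
        rw [lintegral_add_left (by fun_prop),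
          expect_eq_lintegral_campbell P q hKfst, expect_eq_lintegral_campbell P q hKsnd]
    _ ≤ I.card * expect P q (fun z => B₀.indicator 1 z.1 * h z) +
        I.card * expect P q (fun z => B₀.indicator 1 z.1 * h z) :=
        add_le_add
          (expect_indicator_le hB₀ hq.isEquivariant hI' measurable_fst (fun _ _ => rfl)
            (isWeight_fst hB₀) hhm hhinv)
          (expect_indicator_le hB₀ hq.isEquivariant hI' measurable_snd (fun _ _ => rfl)
            (isWeight_fst hB₀) hhm hhinv)
    _ = 2 * I.card * ENNReal.ofReal ε' + 2 * I.card * D * meanCost G P m p q := by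
        rw [hmean]; ring
    _ ≤ ε + 2 * I.card * D * meanCost G P m p q := by gcongr

end Vague

/-! ### Consequences of convergence in the transport distance -/

section WpConvergence

variable {M : Type*} [MetricSpace M] [ProperSpace M] [MeasurableSpace M] [BorelSpace M]
  {G : Type*} [Group G] [Countable G] [MulAction G M] [IsIsometricSMul G M]
  {Ω : Type*} [MetricSpace Ω] [MeasurableSpace Ω] [OpensMeasurableSpace Ω]
  [MulAction G Ω] [MeasurableConstSMul G Ω] {P : Measure Ω}
  [IsProbabilityMeasure P] [SMulInvariantMeasure G Ω P] {m : Measure M}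
  [IsFiniteMeasureOnCompacts m] [SMulInvariantMeasure G M m] {p : ℝ}
  {B₀ : Set M} (hB₀ : IsFundamentalRegion G B₀) (hmB₀ : m B₀ = 1)

omit [MetricSpace Ω] [OpensMeasurableSpace Ω] [MeasurableConstSMul G Ω] [Countable G]
  [IsFiniteMeasureOnCompacts m] [IsProbabilityMeasure P] [SMulInvariantMeasure G Ω P]
  [BorelSpace M] [ProperSpace M] [IsIsometricSMul G M] [SMulInvariantMeasure G M m] in
theorem Wp_rpow (hp : 0 < p) (lam nu : Kernel Ω M) :
    Wp G P m p lam nu ^ p = optimalMeanCost G P m p lam nu := by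
  rw [Wp, ← ENNReal.rpow_mul, one_div_mul_cancel hp.ne', ENNReal.rpow_one]

include hB₀ hmB₀

/-- The distance being an infimum, couplings of cost below any prescribed positive bound exist
eventually; no optimal coupling is involved. -/
theorem vagueTendsto_of_tendsto_Wp
    (hfinite : ∀ K : Set M, Bornology.IsBounded K → {g : G | ∃ x ∈ B₀, g • x ∈ K}.Finite)
    (hp : 0 < p) {μs : ℕ → Kernel Ω M} {μ : Kernel Ω M} (hμs : ∀ n, IsRandomMeasure (μs n))
    (hμ : IsRandomMeasure μ) (hμs1 : ∀ n, HasUnitIntensity P m (μs n))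
    (hμ1 : HasUnitIntensity P m μ)
    (h : Tendsto (fun n => Wp G P m p (μs n) μ) atTop (𝓝 0)) :
    VagueTendsto (fun n => campbell P (μs n)) (campbell P μ) := by
  intro f hf hfc
  have h' : Tendsto (fun n => optimalMeanCost G P m p (μs n) μ) atTop (𝓝 0) := by
    have := h.ennrpow_const p
    simpa [Wp_rpow hp, hp] using this
  rw [tendsto_iff_edist_tendsto_0, ENNReal.tendsto_nhds_zero]
  intro ε hε
  have hε2 : ε / 2 ≠ 0 := by simpa using hε.ne'
  obtain ⟨A, hA, hAle⟩ := enorm_integral_campbell_sub_le hB₀ hmB₀ (P := P) hfinite hp hf hfc hε2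
  have hA' : Tendsto (fun t : ℝ≥0∞ => A * t) (𝓝 0) (𝓝 0) := by
    simpa using ENNReal.Tendsto.const_mul (a := A) (tendsto_id (α := ℝ≥0∞) (x := 𝓝 0))
      (Or.inr hA)
  obtain ⟨η, hη, hηA⟩ : ∃ η : ℝ≥0∞, 0 < η ∧ ∀ t < η, A * t ≤ ε / 2 := by
    have := hA'.eventually_le_const (pos_iff_ne_zero.2 hε2)
    rw [ENNReal.nhds_zero_basis.eventually_iff] at this
    obtain ⟨η, hη, h⟩ := this
    exact ⟨η, hη, fun t ht => h ht⟩
  filter_upwards [h'.eventually_lt_const hη] with n hn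
  simp only [optimalMeanCost, iInf_lt_iff] at hn
  obtain ⟨q, hq, hqη⟩ := hn
  rw [edist_eq_enorm_sub]
  refine (hAle _ _ q (hμs n) hμ (hμs1 n) hμ1 hq).trans ?_
  refine (add_le_add_right (hηA _ hqη) _).trans_eq (ENNReal.add_halves ε)

/-- The two triangle inequalities squeeze the distance to lam; the lower bound is a truncated
difference, continuous here because its first term is finite. -/
theorem tendsto_Wp_of_tendsto_Wp_zero (hB₀bdd : Bornology.IsBounded B₀) (hp : 1 ≤ p)
    {μs : ℕ → Kernel Ω M} {μ lam : Kernel Ω M} (hμs : ∀ n, IsRandomMeasure (μs n))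
    (hμ : IsRandomMeasure μ) (hfin : Wp G P m p μ lam ≠ ∞)
    (h : Tendsto (fun n => Wp G P m p (μs n) μ) atTop (𝓝 0)) :
    Tendsto (fun n => Wp G P m p (μs n) lam) atTop (𝓝 (Wp G P m p μ lam)) := by
  have h1 : ∀ n, Wp G P m p (μs n) lam ≤ Wp G P m p (μs n) μ + Wp G P m p μ lam := fun n =>
    Wp_triangle hB₀ hmB₀ hB₀bdd hp (hμs n) hμ
  have h2 : ∀ n, Wp G P m p μ lam ≤ Wp G P m p (μs n) μ + Wp G P m p (μs n) lam := fun n => by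
    rw [Wp_comm hB₀ hmB₀ (μs n) μ]
    exact Wp_triangle hB₀ hmB₀ hB₀bdd hp hμ (hμs n)
  refine tendsto_of_tendsto_of_tendsto_of_le_of_le (g := fun n => Wp G P m p μ lam -
    Wp G P m p (μs n) μ) (h := fun n => Wp G P m p (μs n) μ + Wp G P m p μ lam) ?_ ?_
    (fun n => tsub_le_iff_left.2 (h2 n)) h1
  · simpa using ENNReal.Tendsto.sub (tendsto_const_nhds (x := Wp G P m p μ lam)) h (Or.inl hfin)
  · simpa using h.add_const (Wp G P m p μ lam)

end WpConvergence

/-! ### A continuous compactly supported weight -/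

/-- An action by isometries for which only finitely many translates of a bounded set meet a given
bounded set has a continuous compactly supported weight. -/
theorem exists_continuous_weight {M : Type*} [MetricSpace M] [ProperSpace M] [MeasurableSpace M]
    [BorelSpace M] {G : Type*} [Group G] [Countable G] [MulAction G M] [IsIsometricSMul G M]
    (hfinite : ∀ B K : Set M, Bornology.IsBounded B → Bornology.IsBounded K →
      {g : G | ∃ x ∈ B, g • x ∈ K}.Finite) {B₀ : Set M} (hB₀ : IsFundamentalRegion G B₀)
    (hB₀bdd : Bornology.IsBounded B₀) :
    ∃ φ : M → ℝ, Continuous φ ∧ HasCompactSupport φ ∧ (∀ x, 0 ≤ φ x) ∧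
      IsWeight G (fun x => ENNReal.ofReal (φ x)) := by
  rcases isEmpty_or_nonempty M with hM | ⟨⟨x₀⟩⟩
  · exact ⟨0, continuous_const, HasCompactSupport.zero, fun _ => le_rfl, by fun_prop,
      fun x => hM.elim x⟩
  have hne : B₀.Nonempty := by
    obtain ⟨g, y, hy, -⟩ := mem_iUnion.1 (hB₀.iUnion_smul ▸ mem_univ x₀)
    exact ⟨y, hy⟩
  -- A bump equal to one on B₀ and zero at distance at least one from it. The sum over the orbit is
  -- locally finite, positive and invariant, and dividing by it yields the weight.
  set ψ : M → ℝ := fun x => max 0 (1 - Metric.infDist x B₀) with hψ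
  have hψc : Continuous ψ := by
    have := Metric.continuous_infDist_pt B₀
    fun_prop
  have hψ0 : ∀ x, 0 ≤ ψ x := fun x => le_max_left _ _
  have hψ1 : ∀ x ∈ B₀, ψ x = 1 := fun x hx => by simp [hψ, Metric.infDist_zero_of_mem hx]
  have hψs : ∀ x, ψ x ≠ 0 → x ∈ Metric.cthickening 1 B₀ := fun x hx => by
    have h1 : Metric.infDist x B₀ < 1 := by
      by_contra hc
      exact hx (max_eq_left (by linarith))
    obtain ⟨y, hy, hxy⟩ := (Metric.infDist_lt_iff hne).1 h1
    exact Metric.mem_cthickening_of_dist_le _ _ _ _ hy hxy.le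
  have hCbdd : Bornology.IsBounded (Metric.cthickening 1 B₀) := hB₀bdd.cthickening
  have hlf : LocallyFinite fun g : G => Function.support fun x => ψ (g • x) := fun x => by
    refine ⟨Metric.ball x 1, Metric.ball_mem_nhds x one_pos, (hfinite _ _
      (Metric.isBounded_ball (x := x) (r := 1)) hCbdd).subset ?_⟩
    rintro g ⟨y, hy1, hy2⟩
    exact ⟨y, hy2, hψs _ hy1⟩
  set S : M → ℝ := fun x => ∑ᶠ g : G, ψ (g • x) with hS
  have hSc : Continuous S :=
    continuous_finsum (fun g => hψc.comp (continuous_const_smul g)) hlf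
  have hfin : ∀ x, (Function.support fun g : G => ψ (g • x)).Finite := fun x =>
    hlf.point_finite x
  have hSpos : ∀ x, 0 < S x := fun x => by
    obtain ⟨g, y, hy, rfl⟩ := mem_iUnion.1 (hB₀.iUnion_smul ▸ mem_univ x)
    refine lt_of_lt_of_le (zero_lt_one.trans_eq ?_)
      (single_le_finsum g⁻¹ (hfin _) fun h => hψ0 _)
    simp [hψ1 y hy]
  have hSinv : ∀ (g : G) x, S (g • x) = S x := fun g x => by
    simp only [hS, smul_smul]
    exact finsum_comp_equiv (Equiv.mulRight g) (f := fun h : G => ψ (h • x))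
  refine ⟨fun x => ψ x / S x, hψc.div hSc fun x => (hSpos x).ne', ?_,
    fun x => div_nonneg (hψ0 x) (hSpos x).le, ?_, fun x => ?_⟩
  · refine HasCompactSupport.intro' (K := Metric.cthickening 1 B₀)
      (Metric.isCompact_of_isClosed_isBounded Metric.isClosed_cthickening hCbdd)
      Metric.isClosed_cthickening fun x hx => ?_
    have : ψ x = 0 := by
      by_contra h
      exact hx (hψs x h)
    simp [this]
  · exact (hψc.div hSc fun x => (hSpos x).ne').measurable.ennreal_ofReal
  · have hsupp : (Function.support fun g : G => ψ (g • x) / S x).Finite :=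
      (hfin x).subset fun g hg h => hg (by simp only at h; simp [h])
    simp only [hSinv]
    rw [← ENNReal.ofReal_tsum_of_nonneg (fun g => div_nonneg (hψ0 _) (hSpos x).le)
      (summable_of_hasFiniteSupport hsupp), tsum_div_const, tsum_eq_finsum (hfin x),
      div_self (hSpos x).ne', ENNReal.ofReal_one]

/-! ### Splitting the cost into near and far parts -/

section Cutoff

variable {M : Type*} [MetricSpace M]

/-- The cost `d(x,y)^p`, cut off continuously between distances `R` and `R + 1`. -/
def nearCost (p R : ℝ) (z : M × M) : ℝ :=
  dist z.1 z.2 ^ p * max 0 (min 1 (R + 1 - dist z.1 z.2))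

/-- The complement of `nearCost`. -/
def farCost (p R : ℝ) (z : M × M) : ℝ :=
  dist z.1 z.2 ^ p * (1 - max 0 (min 1 (R + 1 - dist z.1 z.2)))

variable {p R : ℝ}

theorem nearCost_nonneg (z : M × M) : 0 ≤ nearCost p R z :=
  mul_nonneg (by positivity) (le_max_left _ _)

theorem farCost_nonneg (z : M × M) : 0 ≤ farCost p R z :=
  mul_nonneg (by positivity) (sub_nonneg.2 (max_le zero_le_one (min_le_left _ _)))

theorem ofReal_nearCost_add_farCost (hp : 0 ≤ p) (z : M × M) :
    ENNReal.ofReal (nearCost p R z) + ENNReal.ofReal (farCost p R z) = edist z.1 z.2 ^ p := by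
  rw [← ENNReal.ofReal_add (nearCost_nonneg z) (farCost_nonneg z), edist_dist,
    ENNReal.ofReal_rpow_of_nonneg dist_nonneg hp]
  congr 1
  simp only [nearCost, farCost]; ring

theorem farCost_eq_zero {z : M × M} (h : dist z.1 z.2 ≤ R) : farCost p R z = 0 := by
  rw [farCost, min_eq_left (by linarith), max_eq_right zero_le_one]; simp

theorem nearCost_eq_zero {z : M × M} (h : R + 1 ≤ dist z.1 z.2) : nearCost p R z = 0 := by
  rw [nearCost, max_eq_left (min_le_of_right_le (by linarith))]; simp

theorem ofReal_farCost_eq (hp : 0 ≤ p) {z : M × M} (h : R + 1 ≤ dist z.1 z.2) :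
    ENNReal.ofReal (farCost p R z) = edist z.1 z.2 ^ p := by
  rw [← ofReal_nearCost_add_farCost (R := R) hp z, nearCost_eq_zero h]; simp

theorem ofReal_farCost_le (hp : 0 ≤ p) (z : M × M) :
    ENNReal.ofReal (farCost p R z) ≤ edist z.1 z.2 ^ p := by
  rw [← ofReal_nearCost_add_farCost (R := R) hp z]; exact le_add_self

theorem continuous_nearCost (hp : 0 ≤ p) : Continuous (nearCost p R : M × M → ℝ) := by
  have : Continuous fun z : M × M => dist z.1 z.2 ^ p :=
    continuous_dist.rpow_const fun _ => Or.inr hp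
  unfold nearCost
  exact this.mul (by fun_prop)

theorem continuous_farCost (hp : 0 ≤ p) : Continuous (farCost p R : M × M → ℝ) := by
  have : Continuous fun z : M × M => dist z.1 z.2 ^ p :=
    continuous_dist.rpow_const fun _ => Or.inr hp
  unfold farCost
  exact this.mul (by fun_prop)

end Cutoff

theorem limsup_add_le_of_tendsto {u : ℕ → ℝ≥0∞} {a : ℝ≥0∞} (hu : Tendsto u atTop (𝓝 a))
    (v : ℕ → ℝ≥0∞) : limsup (fun n => u n + v n) atTop ≤ a + limsup v atTop := by
  rcases eq_or_ne a ∞ with rfl | ha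
  · simp
  refine ENNReal.le_of_forall_pos_le_add fun ε hε _ => ?_
  have h1 : ∀ᶠ n in atTop, u n + v n ≤ (a + ε) + v n := by
    filter_upwards [hu.eventually_le_const (ENNReal.lt_add_right ha
      (ENNReal.coe_ne_zero.2 hε.ne'))] with n hn
    gcongr
  refine (limsup_le_limsup h1).trans ?_
  rw [limsup_const_add atTop v (a + ε) (by isBoundedDefault) (by isBoundedDefault), add_right_comm]

/-- Convergence of a sequence split into a converging near part and a far part, in terms of the
far parts. -/
theorem tendsto_iff_limsup_far {C : ℕ → ℝ≥0∞} {C' : ℝ≥0∞} {A T : ℕ → ℕ → ℝ≥0∞} {A' T' : ℕ → ℝ≥0∞}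
    (hC : ∀ n k, C n = A n k + T n k) (hC' : ∀ k, C' = A' k + T' k) (hfin : C' ≠ ∞)
    (hA : ∀ k, Tendsto (fun n => A n k) atTop (𝓝 (A' k))) (hT' : Tendsto T' atTop (𝓝 0)) :
    Tendsto C atTop (𝓝 C') ↔ Tendsto (fun k => limsup (fun n => T n k) atTop) atTop (𝓝 0) := by
  have hA'fin : ∀ k, A' k ≠ ∞ := fun k => ne_top_of_le_ne_top hfin (hC' k ▸ le_self_add)
  constructor
  · intro h
    -- The far part is the total minus the near part, and both converge with finite limits.
    have h1 : ∀ k, limsup (fun n => T n k) atTop = T' k := fun k => by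
      have h2 : Tendsto (fun n => C n - A n k) atTop (𝓝 (C' - A' k)) :=
        ENNReal.Tendsto.sub h (hA k) (Or.inl hfin)
      have h3 : C' - A' k = T' k := by rw [hC' k]; exact ENNReal.add_sub_cancel_left (hA'fin k)
      rw [h3] at h2
      refine (h2.congr' ?_).limsup_eq
      filter_upwards [(hA k).eventually_ne (hA'fin k)] with n hn
      rw [hC n k]
      exact ENNReal.add_sub_cancel_left hn
    simpa only [h1] using hT'
  · intro h
    have hA'lim : Tendsto A' atTop (𝓝 C') := by
      have h2 : Tendsto (fun k => C' - T' k) atTop (𝓝 (C' - 0)) :=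
        ENNReal.Tendsto.sub tendsto_const_nhds hT' (Or.inl hfin)
      rw [tsub_zero] at h2
      refine h2.congr fun k => ?_
      have hT'fin : T' k ≠ ∞ := ne_top_of_le_ne_top hfin (hC' k ▸ le_add_self)
      rw [hC' k]
      exact ENNReal.add_sub_cancel_right hT'fin
    -- The lower bound comes for free, since the total dominates every near part; only the upper
    -- bound uses the smallness of the far parts.
    refine tendsto_of_le_liminf_of_limsup_le ?_ ?_
    · refine le_of_tendsto' hA'lim fun k => ?_
      rw [← (hA k).liminf_eq]
      exact liminf_le_liminf (Eventually.of_forall fun n => hC n k ▸ le_self_add)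
    · have h3 : Tendsto (fun k => C' + limsup (fun n => T n k) atTop) atTop (𝓝 C') := by
        simpa using h.const_add C'
      refine ge_of_tendsto' h3 fun k => ?_
      calc limsup C atTop = limsup (fun n => A n k + T n k) atTop := by simp_rw [← hC]
        _ ≤ A' k + limsup (fun n => T n k) atTop := limsup_add_le_of_tendsto (hA k) _
        _ ≤ C' + limsup (fun n => T n k) atTop := by
          gcongr
          exact hC' k ▸ le_self_add

/-- Finiteness on compacts makes f integrable for all the measures, so that the real integral
carries the same information as the lower one. -/
theorem tendsto_lintegral_of_vagueTendsto {X : Type*} [TopologicalSpace X] [MeasurableSpace X]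
    [OpensMeasurableSpace X] {ν : ℕ → Measure X} {ν' : Measure X}
    [∀ n, IsFiniteMeasureOnCompacts (ν n)] [IsFiniteMeasureOnCompacts ν']
    (h : VagueTendsto ν ν') {f : X → ℝ} (hf : Continuous f) (hfc : HasCompactSupport f)
    (hf0 : ∀ x, 0 ≤ f x) :
    Tendsto (fun n => ∫⁻ x, ENNReal.ofReal (f x) ∂ν n) atTop
      (𝓝 (∫⁻ x, ENNReal.ofReal (f x) ∂ν')) := by
  have h1 : ∀ ρ : Measure X, IsFiniteMeasureOnCompacts ρ →
      ∫⁻ x, ENNReal.ofReal (f x) ∂ρ = ENNReal.ofReal (∫ x, f x ∂ρ) := fun ρ _ =>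
    (ofReal_integral_eq_lintegral_ofReal (hf.integrable_of_hasCompactSupport hfc)
      (ae_of_all _ hf0)).symm
  simp only [h1 _ inferInstance]
  exact (ENNReal.continuous_ofReal.tendsto _).comp (h f hf hfc)

/-! ### Convergence of costs under vague convergence -/

section CostConvergence

variable {M : Type*} [MetricSpace M] [ProperSpace M] [MeasurableSpace M] [BorelSpace M]
  {G : Type*} [Group G] [Countable G] [MulAction G M] [IsIsometricSMul G M]
  {Ω : Type*} [MetricSpace Ω] [CompactSpace Ω] [MeasurableSpace Ω] [OpensMeasurableSpace Ω]
  [MulAction G Ω] [MeasurableConstSMul G Ω] {P : Measure Ω}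
  [IsProbabilityMeasure P] [SMulInvariantMeasure G Ω P] {m : Measure M}
  [IsFiniteMeasureOnCompacts m] [SMulInvariantMeasure G M m] {p : ℝ}

omit [MetricSpace M] [ProperSpace M] [BorelSpace M] [SMulInvariantMeasure G Ω P]
  [IsFiniteMeasureOnCompacts m] [MetricSpace Ω] [CompactSpace Ω] [OpensMeasurableSpace Ω]
  [MeasurableConstSMul G Ω] [Countable G] [IsIsometricSMul G M] [SMulInvariantMeasure G M m]
  [MulAction G M] [MulAction G Ω] in
theorem hasUnitIntensity_const : HasUnitIntensity P m (Kernel.const Ω m) := fun A _ => by simp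

theorem IsEquivariantCoupling.isFiniteMeasureOnCompacts {q : Kernel Ω (M × M)} {mu : Kernel Ω M}
    (hq : IsEquivariantCoupling G P q (Kernel.const Ω m) mu) :
    IsFiniteMeasureOnCompacts (campbell P q) := by
  have := hq.isRandomMeasure.isSFiniteKernel
  exact isFiniteMeasureOnCompacts_campbell continuous_fst measurable_fst
    (hq.isCoupling.mono fun ω h => h.1) hasUnitIntensity_const

/-- The first point stays in the support of φ and the second in its closed (R + 1)-neighbourhood,
compact since M is proper; in the last variable the compactness of Ω is used. -/
theorem hasCompactSupport_mul_nearCost {φ : M → ℝ} (hφ : HasCompactSupport φ) (p R : ℝ) :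
    HasCompactSupport fun z : (M × M) × Ω => φ z.1.1 * nearCost p R z.1 := by
  refine HasCompactSupport.intro (K := (tsupport φ ×ˢ Metric.cthickening (R + 1) (tsupport φ)) ×ˢ
    univ) ((hφ.isCompact.prod (hφ.isCompact.cthickening)).prod isCompact_univ) fun z hz => ?_
  by_contra h
  have h1 : φ z.1.1 ≠ 0 := left_ne_zero_of_mul h
  have h2 : nearCost p R z.1 ≠ 0 := right_ne_zero_of_mul h
  have h3 : dist z.1.1 z.1.2 ≤ R + 1 := by
    by_contra hc
    exact h2 (nearCost_eq_zero (not_le.1 hc).le)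
  have h4 := subset_tsupport φ h1
  exact hz ⟨⟨h4, Metric.mem_cthickening_of_dist_le _ _ _ _ h4 (by rwa [dist_comm])⟩, mem_univ _⟩

variable {φ : M → ℝ} (hφc : Continuous φ) (hφs : HasCompactSupport φ) (hφ0 : ∀ x, 0 ≤ φ x)
  (hφw : IsWeight G (fun x => ENNReal.ofReal (φ x)))

include hφc hφs hφ0 in
theorem tendsto_expect_nearCost (hp : 0 ≤ p) (R : ℝ) {qs : ℕ → Kernel Ω (M × M)}
    {q : Kernel Ω (M × M)} {μs : ℕ → Kernel Ω M} {μ : Kernel Ω M}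
    (hqs : ∀ n, IsEquivariantCoupling G P (qs n) (Kernel.const Ω m) (μs n))
    (hq : IsEquivariantCoupling G P q (Kernel.const Ω m) μ)
    (h : VagueTendsto (fun n => campbell P (qs n)) (campbell P q)) :
    Tendsto (fun n => expect P (qs n) fun z =>
        ENNReal.ofReal (φ z.1) * ENNReal.ofReal (nearCost p R z)) atTop
      (𝓝 (expect P q fun z => ENNReal.ofReal (φ z.1) * ENNReal.ofReal (nearCost p R z))) := by
  have hc : Continuous (nearCost p R : M × M → ℝ) := continuous_nearCost hp
  have := fun n => (hqs n).isRandomMeasure.isSFiniteKernel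
  have := hq.isRandomMeasure.isSFiniteKernel
  have := fun n => (hqs n).isFiniteMeasureOnCompacts
  have := hq.isFiniteMeasureOnCompacts
  have key : ∀ (κ : Kernel Ω (M × M)) [IsSFiniteKernel κ],
      (expect P κ fun z => ENNReal.ofReal (φ z.1) * ENNReal.ofReal (nearCost p R z)) =
      ∫⁻ z, ENNReal.ofReal (φ z.1.1 * nearCost p R z.1) ∂campbell P κ := fun κ _ => by
    rw [expect_eq_lintegral_campbell P κ (by fun_prop)]
    simp_rw [ENNReal.ofReal_mul (hφ0 _)]
  simp only [key]
  exact tendsto_lintegral_of_vagueTendsto h (by fun_prop) (hasCompactSupport_mul_nearCost hφs p R)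
    fun z => mul_nonneg (hφ0 _) (nearCost_nonneg _)

variable {B₀ : Set M} (hB₀ : IsFundamentalRegion G B₀) (hmB₀ : m B₀ = 1)

omit [IsFiniteMeasureOnCompacts m] [OpensMeasurableSpace Ω] [CompactSpace Ω] [MetricSpace Ω] in
include hφc hφw hB₀ hmB₀ in
theorem meanCost_eq_near_add_far (hp : 0 ≤ p) {q : Kernel Ω (M × M)} (hq : IsEquivariant G q)
    (R : ℝ) : meanCost G P m p q =
      (expect P q fun z => ENNReal.ofReal (φ z.1) * ENNReal.ofReal (nearCost p R z)) +
      expect P q fun z => ENNReal.ofReal (φ z.1) * ENNReal.ofReal (farCost p R z) := by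
  have hc : Continuous (nearCost p R : M × M → ℝ) := continuous_nearCost hp
  rw [meanCost_eq hB₀ hmB₀ hq (hφw.comp measurable_fst fun _ _ => rfl),
    ← expect_add (by fun_prop)]
  simp_rw [← mul_add, ofReal_nearCost_add_farCost hp]

-- Dominated convergence: the far parts lie below the full weighted cost, which is integrable, and
-- vanish pointwise once k exceeds the distance.
omit [IsFiniteMeasureOnCompacts m] [OpensMeasurableSpace Ω] [CompactSpace Ω] [MetricSpace Ω] in
include hφc hφw hB₀ hmB₀ in
theorem tendsto_expect_farCost (hp : 0 ≤ p) {q : Kernel Ω (M × M)} [IsSFiniteKernel q]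
    (hq : IsEquivariant G q) (hfin : meanCost G P m p q ≠ ∞) :
    Tendsto (fun k : ℕ => expect P q fun z => ENNReal.ofReal (φ z.1) *
      ENNReal.ofReal (farCost p k z)) atTop (𝓝 0) := by
  have hc : ∀ k : ℕ, Continuous (farCost p k : M × M → ℝ) := fun k => continuous_farCost hp
  have h1 : ∀ k : ℕ, Measurable fun z : M × M =>
      ENNReal.ofReal (φ z.1) * ENNReal.ofReal (farCost p k z) := fun k => by
    have := hc k; fun_prop
  simp only [expect_eq_lintegral_campbell P q (h1 _)]
  rw [meanCost_eq hB₀ hmB₀ hq (hφw.comp measurable_fst fun _ _ => rfl),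
    expect_eq_lintegral_campbell P q (by fun_prop)] at hfin
  rw [← lintegral_zero (μ := campbell P q)]
  refine tendsto_lintegral_of_dominated_convergence _ (fun k => (h1 k).comp measurable_fst)
    (fun k => ae_of_all _ fun z => ?_) hfin (ae_of_all _ fun z => ?_)
  · exact mul_le_mul' le_rfl (ofReal_farCost_le hp _)
  · refine tendsto_const_nhds.congr' ?_
    obtain ⟨N, hN⟩ := exists_nat_ge (dist z.1.1 z.1.2)
    filter_upwards [eventually_ge_atTop N] with k hk
    rw [farCost_eq_zero (hN.trans (by exact_mod_cast hk))]
    simp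

-- Mass transport trades the weight φ(x) for the indicator of B₀ in y. A point x outside the
-- S-neighbourhood of B₀ is then at distance at least R + 1 from y, where the far cost is the whole
-- cost.
omit [IsFiniteMeasureOnCompacts m] [OpensMeasurableSpace Ω] [CompactSpace Ω] [MetricSpace Ω]
  [SMulInvariantMeasure G M m] in
include hφw hB₀ in
theorem expectedCostOn_le_expect_farCost (hp : 0 ≤ p) {q : Kernel Ω (M × M)}
    (hq : IsEquivariant G q) {R S : ℝ} (hRS : R + 1 ≤ S) :
    expectedCostOn P p q (Metric.thickening S B₀)ᶜ B₀ ≤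
      expect P q fun z => ENNReal.ofReal (φ z.1) * ENNReal.ofReal (farCost p R z) := by
  have hc : Continuous (farCost p R : M × M → ℝ) := continuous_farCost hp
  rw [mass_transport hq (hφw.comp measurable_fst fun _ _ => rfl) (isWeight_snd hB₀)
    (by fun_prop) (fun g z => by simp [farCost]),
    expectedCostOn_eq Metric.isOpen_thickening.measurableSet.compl hB₀.measurableSet]
  refine expect_mono fun z => ?_
  by_cases h1 : z.1 ∈ Metric.thickening S B₀
  · simp [h1]
  by_cases h2 : z.2 ∈ B₀
  · have h3 : S ≤ dist z.1 z.2 := by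
      by_contra hcon
      exact h1 (Metric.mem_thickening_iff.2 ⟨z.2, h2, not_le.1 hcon⟩)
    rw [ofReal_farCost_eq hp (hRS.trans h3)]
    simp [h1, h2]
  · simp [h2]

-- After the same exchange of weights, a point of the S-neighbourhood of B₀ has distance less than S
-- + D ≤ R from y, where the far cost vanishes.
omit [IsFiniteMeasureOnCompacts m] [OpensMeasurableSpace Ω] [CompactSpace Ω] [MetricSpace Ω]
  [SMulInvariantMeasure G M m] in
include hφw hB₀ in
theorem expect_farCost_le_expectedCostOn (hp : 0 ≤ p) {q : Kernel Ω (M × M)}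
    (hq : IsEquivariant G q) {D R S : ℝ} (hD : ∀ x ∈ B₀, ∀ y ∈ B₀, dist x y ≤ D)
    (hRS : S + D ≤ R) :
    (expect P q fun z => ENNReal.ofReal (φ z.1) * ENNReal.ofReal (farCost p R z)) ≤
      expectedCostOn P p q (Metric.thickening S B₀)ᶜ B₀ := by
  have hc : Continuous (farCost p R : M × M → ℝ) := continuous_farCost hp
  rw [mass_transport hq (hφw.comp measurable_fst fun _ _ => rfl) (isWeight_snd hB₀)
    (by fun_prop) (fun g z => by simp [farCost]),
    expectedCostOn_eq Metric.isOpen_thickening.measurableSet.compl hB₀.measurableSet]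
  refine expect_mono fun z => ?_
  by_cases h2 : z.2 ∈ B₀
  · by_cases h1 : z.1 ∈ Metric.thickening S B₀
    · obtain ⟨b, hb, hzb⟩ := Metric.mem_thickening_iff.1 h1
      have := dist_triangle z.1 b z.2
      have := hD b hb z.2 h2
      rw [farCost_eq_zero (by linarith)]
      simp
    · simp only [indicator_of_mem h2, Pi.one_apply, one_mul, mem_compl_iff, h1, not_false_eq_true,
        indicator_of_mem]
      exact ofReal_farCost_le hp _
  · simp [h2]

include hφc hφs hφ0 hφw hB₀ hmB₀

/-- Under vague convergence, convergence of the costs is equivalent to the vanishing of the far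
parts of the costs. -/
theorem tendsto_meanCost_iff_far (hp : 0 ≤ p) {qs : ℕ → Kernel Ω (M × M)}
    {q : Kernel Ω (M × M)} {μs : ℕ → Kernel Ω M} {μ : Kernel Ω M}
    (hqs : ∀ n, IsEquivariantCoupling G P (qs n) (Kernel.const Ω m) (μs n))
    (hq : IsEquivariantCoupling G P q (Kernel.const Ω m) μ) (hfin : meanCost G P m p q ≠ ∞)
    (h : VagueTendsto (fun n => campbell P (qs n)) (campbell P q)) :
    Tendsto (fun n => meanCost G P m p (qs n)) atTop (𝓝 (meanCost G P m p q)) ↔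
      Tendsto (fun k : ℕ => limsup (fun n => expect P (qs n) fun z =>
        ENNReal.ofReal (φ z.1) * ENNReal.ofReal (farCost p k z)) atTop) atTop (𝓝 0) := by
  have := hq.isRandomMeasure.isSFiniteKernel
  exact tendsto_iff_limsup_far
    (A := fun n k => expect P (qs n) fun z =>
      ENNReal.ofReal (φ z.1) * ENNReal.ofReal (nearCost p k z))
    (A' := fun k => expect P q fun z => ENNReal.ofReal (φ z.1) * ENNReal.ofReal (nearCost p k z))
    (fun n k => meanCost_eq_near_add_far hφc hφw hB₀ hmB₀ hp (hqs n).isEquivariant k)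
    (fun k => meanCost_eq_near_add_far hφc hφw hB₀ hmB₀ hp hq.isEquivariant k) hfin
    (fun k => tendsto_expect_nearCost hφc hφs hφ0 hp k hqs hq h)
    (tendsto_expect_farCost hφc hφw hB₀ hmB₀ hp hq.isEquivariant hfin)

omit [IsFiniteMeasureOnCompacts m] [OpensMeasurableSpace Ω] [CompactSpace Ω] [MetricSpace Ω]
  [SMulInvariantMeasure G M m] hφc hφs hφ0 hmB₀ in
theorem tendsto_far_iff_tendsto_expectedCostOn (hB₀bdd : Bornology.IsBounded B₀) (hp : 0 ≤ p)
    {qs : ℕ → Kernel Ω (M × M)} (hqs : ∀ n, IsEquivariant G (qs n)) :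
    Tendsto (fun k : ℕ => limsup (fun n => expect P (qs n) fun z =>
        ENNReal.ofReal (φ z.1) * ENNReal.ofReal (farCost p k z)) atTop) atTop (𝓝 0) ↔
      Tendsto (fun R : ℝ => limsup (fun n => expectedCostOn P p (qs n)
        (Metric.thickening R B₀)ᶜ B₀) atTop) atTop (𝓝 0) := by
  obtain ⟨D, hD⟩ := Metric.isBounded_iff.1 hB₀bdd
  constructor
  · intro h
    refine tendsto_of_tendsto_of_tendsto_of_le_of_le' tendsto_const_nhds
      (h.comp ((tendsto_nat_floor_atTop (α := ℝ)).comp (tendsto_atTop_add_const_right _ (-1)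
        tendsto_id))) (Eventually.of_forall fun _ => zero_le) ?_
    filter_upwards [eventually_ge_atTop 1] with R hR
    refine limsup_le_limsup (Eventually.of_forall fun n => ?_)
    refine expectedCostOn_le_expect_farCost hφw hB₀ hp (hqs n) ?_
    have := Nat.floor_le (a := R + -1) (by linarith)
    simp only [Function.comp_apply, id]
    linarith
  · intro h
    refine tendsto_of_tendsto_of_tendsto_of_le_of_le tendsto_const_nhds
      (h.comp (tendsto_atTop_add_const_right _ (-D) tendsto_natCast_atTop_atTop))
      (fun _ => zero_le) fun k => ?_
    refine limsup_le_limsup (Eventually.of_forall fun n => ?_)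
    exact expect_farCost_le_expectedCostOn hφw hB₀ hp (hqs n) (fun x hx y hy => hD hx hy)
      (by simp)

end CostConvergence

/-! ### Completing a subcoupling to a coupling -/

section Rearrangement

variable {X Y : Type*} [MeasurableSpace X] [MeasurableSpace Y]

/-- The density with respect to `lam ⊗ nu` of the coupling obtained from a subcoupling with density
`h` by filling the defects of the marginals independently. -/
def filledDensity (h : X × Y → ℝ≥0∞) (lam : Measure X) (nu : Measure Y) (z : X × Y) : ℝ≥0∞ :=
  h z + (1 - ∫⁻ y, h (z.1, y) ∂nu) * (1 - ∫⁻ x, h (x, z.2) ∂lam) /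
    ∫⁻ x, (1 - ∫⁻ y, h (x, y) ∂nu) ∂lam

/-- The coupling with density `filledDensity`. -/
def filled (h : X × Y → ℝ≥0∞) (lam : Measure X) (nu : Measure Y) : Measure (X × Y) :=
  (lam.prod nu).withDensity (filledDensity h lam nu)

variable {lam : Measure X} {nu : Measure Y} [IsFiniteMeasure lam] [IsFiniteMeasure nu]
  {h : X × Y → ℝ≥0∞}

theorem lintegral_defect (hh : Measurable h) (h1 : ∀ᵐ x ∂lam, ∫⁻ y, h (x, y) ∂nu ≤ 1) :
    ∫⁻ x, (1 - ∫⁻ y, h (x, y) ∂nu) ∂lam = lam univ - ∫⁻ z, h z ∂lam.prod nu := by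
  have hle : ∫⁻ x, ∫⁻ y, h (x, y) ∂nu ∂lam ≤ lam univ := by
    calc _ ≤ ∫⁻ _, 1 ∂lam := lintegral_mono_ae h1
      _ = lam univ := lintegral_one
  rw [lintegral_sub hh.lintegral_prod_right' (ne_top_of_le_ne_top (by finiteness) hle) h1,
    lintegral_prod _ hh.aemeasurable, lintegral_one]

theorem lintegral_defect_right (hh : Measurable h) (h2 : ∀ᵐ y ∂nu, ∫⁻ x, h (x, y) ∂lam ≤ 1) :
    ∫⁻ y, (1 - ∫⁻ x, h (x, y) ∂lam) ∂nu = nu univ - ∫⁻ z, h z ∂lam.prod nu := by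
  have hle : ∫⁻ y, ∫⁻ x, h (x, y) ∂lam ∂nu ≤ nu univ := by
    calc _ ≤ ∫⁻ _, 1 ∂nu := lintegral_mono_ae h2
      _ = nu univ := lintegral_one
  rw [lintegral_sub hh.lintegral_prod_left' (ne_top_of_le_ne_top (by finiteness) hle) h2,
    lintegral_prod_symm _ hh.aemeasurable, lintegral_one]

theorem measurable_filledDensity (hh : Measurable h) : Measurable (filledDensity h lam nu) := by
  have m1 : Measurable fun x => ∫⁻ y, h (x, y) ∂nu := hh.lintegral_prod_right'
  have m2 : Measurable fun y => ∫⁻ x, h (x, y) ∂lam := hh.lintegral_prod_left'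
  unfold filledDensity
  exact hh.add ((((measurable_const.sub m1).comp measurable_fst).mul
    ((measurable_const.sub m2).comp measurable_snd)).div_const _)

/-- When the total defect is zero the quotient is zero by convention, which is harmless because then
A = 1 almost everywhere. -/
theorem ae_add_defect {A : X → ℝ≥0∞} (hA : Measurable A) (h1 : ∀ᵐ x ∂lam, A x ≤ 1) :
    ∀ᵐ x ∂lam, A x + (1 - A x) * (∫⁻ x, (1 - A x) ∂lam) / ∫⁻ x, (1 - A x) ∂lam = 1 := by
  have hfin : ∫⁻ x, (1 - A x) ∂lam ≠ ∞ := by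
    refine ne_top_of_le_ne_top (b := lam univ) (by finiteness) ?_
    calc _ ≤ ∫⁻ _, 1 ∂lam := lintegral_mono fun x => tsub_le_self
      _ = lam univ := lintegral_one
  by_cases h0 : ∫⁻ x, (1 - A x) ∂lam = 0
  · have h3 := (lintegral_eq_zero_iff (measurable_const.sub hA)).1 h0
    filter_upwards [h1, h3] with x hx hx3
    have hx3 : 1 - A x = 0 := hx3
    rw [hx3, zero_mul, ENNReal.zero_div, add_zero]
    exact le_antisymm hx (tsub_eq_zero_iff_le.1 hx3)
  · filter_upwards [h1] with x hx
    rw [mul_div_assoc, ENNReal.div_self h0 hfin, mul_one, add_tsub_cancel_of_le hx]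

/-- As lam and nu have equal mass, the two defects have the same total. Their product divided by
this total therefore has precisely the defects as marginal densities. -/
theorem isCoupling_filled (hh : Measurable h) (hmass : lam univ = nu univ)
    (h1 : ∀ᵐ x ∂lam, ∫⁻ y, h (x, y) ∂nu ≤ 1) (h2 : ∀ᵐ y ∂nu, ∫⁻ x, h (x, y) ∂lam ≤ 1) :
    IsCoupling (filled h lam nu) lam nu := by
  have m1 : Measurable fun x => ∫⁻ y, h (x, y) ∂nu := hh.lintegral_prod_right'
  have m2 : Measurable fun y => ∫⁻ x, h (x, y) ∂lam := hh.lintegral_prod_left'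
  have hF := measurable_filledDensity (lam := lam) (nu := nu) hh
  have heq : ∫⁻ y, (1 - ∫⁻ x, h (x, y) ∂lam) ∂nu = ∫⁻ x, (1 - ∫⁻ y, h (x, y) ∂nu) ∂lam := by
    rw [lintegral_defect hh h1, lintegral_defect_right hh h2, hmass]
  constructor
  · refine Measure.ext_of_lintegral _ fun f hf => ?_
    rw [lintegral_map hf measurable_fst, filled,
      lintegral_withDensity_eq_lintegral_mul _ hF (by fun_prop),
      lintegral_prod _ (hF.mul (by fun_prop)).aemeasurable]
    refine lintegral_congr_ae ?_
    filter_upwards [ae_add_defect m1 h1] with x hx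
    simp only [Pi.mul_apply]
    rw [lintegral_mul_const _ (by fun_prop)]
    simp only [filledDensity]
    rw [lintegral_add_left (by fun_prop)]
    simp_rw [mul_div_assoc, ENNReal.div_eq_inv_mul]
    rw [lintegral_const_mul _ (by fun_prop), lintegral_const_mul _ (by fun_prop), heq,
      ← ENNReal.div_eq_inv_mul, ← mul_div_assoc, hx, one_mul]
  · refine Measure.ext_of_lintegral _ fun f hf => ?_
    rw [lintegral_map hf measurable_snd, filled,
      lintegral_withDensity_eq_lintegral_mul _ hF (by fun_prop),
      lintegral_prod_symm _ (hF.mul (by fun_prop)).aemeasurable]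
    refine lintegral_congr_ae ?_
    have h3 := ae_add_defect m2 h2
    simp only [heq] at h3
    filter_upwards [h3] with y hy
    simp only [Pi.mul_apply]
    rw [lintegral_mul_const _ (by fun_prop)]
    simp only [filledDensity]
    rw [lintegral_add_left (by fun_prop)]
    simp_rw [mul_comm (1 - ∫⁻ y, h (_, y) ∂nu), mul_div_assoc, ENNReal.div_eq_inv_mul]
    rw [lintegral_const_mul _ (by fun_prop), lintegral_const_mul _ (by fun_prop),
      ← ENNReal.div_eq_inv_mul, ← mul_div_assoc, hy, one_mul]

/-- The added part has at most the mass of the total defect, and each unit of it costs at most D. -/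
theorem lintegral_filled_le (hh : Measurable h) (hmass : lam univ = nu univ)
    (h1 : ∀ᵐ x ∂lam, ∫⁻ y, h (x, y) ∂nu ≤ 1) (h2 : ∀ᵐ y ∂nu, ∫⁻ x, h (x, y) ∂lam ≤ 1)
    {c : X × Y → ℝ≥0∞} (hc : Measurable c) {D : ℝ≥0∞} (hD : ∀ᵐ z ∂lam.prod nu, c z ≤ D) :
    ∫⁻ z, c z ∂filled h lam nu ≤ ∫⁻ z, h z * c z ∂lam.prod nu +
      (lam univ - ∫⁻ z, h z ∂lam.prod nu) * D := by
  have m1 : Measurable fun x => ∫⁻ y, h (x, y) ∂nu := hh.lintegral_prod_right'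
  have m2 : Measurable fun y => ∫⁻ x, h (x, y) ∂lam := hh.lintegral_prod_left'
  have hF := measurable_filledDensity (lam := lam) (nu := nu) hh
  set R := ∫⁻ x, (1 - ∫⁻ y, h (x, y) ∂nu) ∂lam with hR
  have heq : ∫⁻ y, (1 - ∫⁻ x, h (x, y) ∂lam) ∂nu = R := by
    rw [hR, lintegral_defect hh h1, lintegral_defect_right hh h2, hmass]
  rw [filled, lintegral_withDensity_eq_lintegral_mul _ hF hc, ← lintegral_defect hh h1]
  simp only [Pi.mul_apply, filledDensity, add_mul]
  rw [lintegral_add_left (by fun_prop)]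
  gcongr
  calc _ ≤ ∫⁻ z, (1 - ∫⁻ y, h (z.1, y) ∂nu) * (1 - ∫⁻ x, h (x, z.2) ∂lam) * (D / R)
          ∂lam.prod nu := by
        refine lintegral_mono_ae (hD.mono fun z hz => ?_)
        rw [← hR, ENNReal.div_eq_inv_mul, ENNReal.div_eq_inv_mul, mul_comm R⁻¹, mul_assoc]
        gcongr
    _ = R * R * (D / R) := by
        rw [lintegral_mul_const _ (by fun_prop),
          lintegral_prod_mul (f := fun x => 1 - ∫⁻ y, h (x, y) ∂nu)
            (g := fun y => 1 - ∫⁻ x, h (x, y) ∂lam) (by fun_prop) (by fun_prop), heq, ← hR]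
    _ ≤ R * D := by
        rw [mul_assoc, ENNReal.div_eq_inv_mul, ← mul_assoc R R⁻¹]
        gcongr
        exact (mul_le_mul_left (ENNReal.mul_inv_le_one _) _).trans_eq (one_mul D)

end Rearrangement

/-- Replaces a density by one from a countable family at the price of a mass η. The sum is truncated
to a finite set and t is shrunk by a factor r < 1, which leaves room for rationals below t. -/
theorem exists_rat_finsupp {ι : Type*} {t c : ι → ℝ≥0∞} (htc : ∀ i, t i = ∞ → c i = 0)
    (hfin : ∑' i, t i * c i ≠ ∞) {η : ℝ≥0∞} (hη : η ≠ 0) :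
    ∃ θ : ι →₀ ℚ, (∀ i, ENNReal.ofReal (θ i) ≤ t i) ∧
      ∑' i, t i * c i ≤ ∑' i, ENNReal.ofReal (θ i) * c i + η := by
  classical
  rcases eq_or_ne (∑' i, t i * c i) 0 with h0 | h0
  · exact ⟨0, by simp, by simp [h0]⟩
  obtain ⟨s, hs⟩ : ∃ s : Finset ι, ∑' i, t i * c i - η < ∑ i ∈ s, t i * c i := by
    have h1 := ENNReal.sub_lt_self hfin h0 hη
    nth_rw 2 [ENNReal.tsum_eq_iSup_sum] at h1
    exact lt_iSup_iff.1 h1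
  set L := ∑' i, t i * c i - η
  have hsfin : ∑ i ∈ s, t i * c i ≠ ∞ := ne_top_of_le_ne_top hfin (ENNReal.sum_le_tsum s)
  have hs0 : ∑ i ∈ s, t i * c i ≠ 0 := (zero_le.trans_lt hs).ne'
  -- The factor r shrinks the finite sum while keeping it above the target L.
  obtain ⟨r, hr, hr1⟩ : ∃ r : ℝ≥0∞, L / ∑ i ∈ s, t i * c i < r ∧ r < 1 := by
    refine exists_between ?_
    rw [ENNReal.div_lt_iff (Or.inl hs0) (Or.inl hsfin), one_mul]
    exact hs
  have hrs : L < r * ∑ i ∈ s, t i * c i := by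
    rwa [ENNReal.div_lt_iff (Or.inl hs0) (Or.inl hsfin)] at hr
  have hq : ∀ i, ∃ q : ℚ, ENNReal.ofReal q ≤ t i ∧ r * (t i * c i) ≤ ENNReal.ofReal q * c i := by
    intro i
    rcases eq_or_ne (t i) 0 with h | h
    · exact ⟨0, by simp, by simp [h]⟩
    rcases eq_or_ne (t i) ∞ with h' | h'
    · exact ⟨0, by simp, by simp [htc i h']⟩
    have h2 : r * t i < t i := by
      calc r * t i < 1 * t i := (ENNReal.mul_lt_mul_iff_left h h').2 hr1
        _ = t i := one_mul _
    obtain ⟨q, -, hq1, hq2⟩ := ENNReal.lt_iff_exists_rat_btwn.1 h2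
    refine ⟨q, hq2.le, ?_⟩
    rw [← mul_assoc]
    gcongr
    exact hq1.le
  choose q hq1 hq2 using hq
  refine ⟨Finsupp.onFinset s (fun i => if i ∈ s then q i else 0) fun i hi => by
    by_contra h; simp [h] at hi, fun i => ?_, ?_⟩
  · by_cases hi : i ∈ s <;> simp [hi, hq1]
  · refine tsub_le_iff_right.1 (hrs.le.trans ?_)
    rw [Finset.mul_sum]
    refine le_trans (Finset.sum_le_sum fun i hi => ?_) (ENNReal.sum_le_tsum s)
    simpa [hi] using hq2 i

/-! ### Countably many competitors: rational block densities -/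

section Block

variable {M : Type*} [MetricSpace M] [SecondCountableTopology M] [Nonempty M] [MeasurableSpace M]
  [BorelSpace M]

theorem exists_cell (M : Type*) [MetricSpace M] [SecondCountableTopology M] [Nonempty M]
    [MeasurableSpace M] [BorelSpace M] {δ : ℝ} (hδ : 0 < δ) :
    ∃ c : M → ℕ, Measurable c ∧ ∀ x, dist x (TopologicalSpace.denseSeq M (c x)) < δ := by
  classical
  have hex : ∀ x : M, ∃ n, dist x (TopologicalSpace.denseSeq M n) < δ := fun x => by
    obtain ⟨y, ⟨n, rfl⟩, hn⟩ := Metric.dense_iff.1 (TopologicalSpace.denseRange_denseSeq M) x δ hδ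
      |>.imp fun y hy => (show _ ∧ _ from ⟨hy.2, hy.1⟩)
    exact ⟨n, by rwa [Metric.mem_ball, dist_comm] at hn⟩
  exact ⟨fun x => Nat.find (hex x), measurable_find hex fun n =>
    (measurableSet_lt (by fun_prop) (by fun_prop)), fun x => Nat.find_spec (hex x)⟩

/-- A measurable decomposition of `M` into countably many cells of size `1 / (k + 1)`. -/
def cell (M : Type*) [MetricSpace M] [SecondCountableTopology M] [Nonempty M]
    [MeasurableSpace M] [BorelSpace M] (k : ℕ) : M → ℕ :=
  (exists_cell M (Nat.one_div_pos_of_nat (n := k) (α := ℝ))).choose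

theorem measurable_cell (k : ℕ) : Measurable (cell M k) :=
  (exists_cell M (Nat.one_div_pos_of_nat (n := k) (α := ℝ))).choose_spec.1

theorem edist_cell_le (k : ℕ) (x : M) :
    edist x (TopologicalSpace.denseSeq M (cell M k x)) ≤ ENNReal.ofReal (1 / (k + 1)) := by
  rw [edist_dist]
  exact ENNReal.ofReal_le_ofReal
    ((exists_cell M (Nat.one_div_pos_of_nat (n := k) (α := ℝ))).choose_spec.2 x).le

/-- A density which is constant on products of cells. -/
def blockDensity (i : ℕ × (ℕ × ℕ →₀ ℚ)) (z : M × M) : ℝ≥0∞ :=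
  ENNReal.ofReal (i.2 (cell M i.1 z.1, cell M i.1 z.2))

theorem measurable_blockDensity (i : ℕ × (ℕ × ℕ →₀ ℚ)) :
    Measurable (blockDensity (M := M) i) := by
  have h : Measurable fun j : ℕ × ℕ => ENNReal.ofReal (i.2 j) := measurable_of_countable _
  exact h.comp (((measurable_cell i.1).comp measurable_fst).prodMk
    ((measurable_cell i.1).comp measurable_snd))

/-- A coupling which is not optimal can be improved by filling a block density. -/
theorem exists_filled_block_cost_lt {p : ℝ} (hp : 1 ≤ p) {lam nu : Measure M} [IsFiniteMeasure lam]
    [IsFiniteMeasure nu] {γ : Measure (M × M)} (hγ : IsCoupling γ lam nu) {D c : ℝ≥0∞}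
    (hDtop : D ≠ ∞) (hD : ∀ᵐ z ∂lam.prod nu, edist z.1 z.2 ^ p ≤ D) (hc : cost p γ < c) :
    ∃ i : ℕ × (ℕ × ℕ →₀ ℚ),
      (∀ᵐ x ∂lam, ∫⁻ y, blockDensity i (x, y) ∂nu ≤ 1) ∧
      (∀ᵐ y ∂nu, ∫⁻ x, blockDensity i (x, y) ∂lam ≤ 1) ∧
      cost p (filled (blockDensity i) lam nu) < c := by
  have hp0 : 0 < p := by linarith
  have hmγ : γ univ = lam univ := by rw [← hγ.1, Measure.map_apply measurable_fst .univ]; rfl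
  have hmass : lam univ = nu univ := by
    rw [← hmγ, ← hγ.2, Measure.map_apply measurable_snd .univ]; rfl
  have hγfin : IsFiniteMeasure γ := ⟨by rw [hmγ]; finiteness⟩
  set δ : ℕ → ℝ≥0∞ := fun k => ENNReal.ofReal (1 / (k + 1)) with hδ
  have hδ0 : Tendsto δ atTop (𝓝 0) := by
    have := (ENNReal.continuous_ofReal.tendsto 0).comp
      (tendsto_one_div_add_atTop_nhds_zero_nat (𝕜 := ℝ))
    simpa [hδ, Function.comp_def] using this
  -- Passing to cell centres and back moves each endpoint by at most δ twice, four times δ in all.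
  -- By Minkowski the cost stays below c if the cells are small.
  obtain ⟨k, hk⟩ : ∃ k, (cost p γ ^ (1 / p) + 4 * δ k * γ univ ^ (1 / p)) ^ p < c := by
    have h1 : Tendsto (fun k => (cost p γ ^ (1 / p) + 4 * δ k * γ univ ^ (1 / p)) ^ p) atTop
        (𝓝 ((cost p γ ^ (1 / p) + 4 * 0 * γ univ ^ (1 / p)) ^ p)) := by
      refine Filter.Tendsto.ennrpow_const _ (tendsto_const_nhds.add ?_)
      refine ENNReal.Tendsto.mul_const (ENNReal.Tendsto.const_mul hδ0 (Or.inr (by simp)))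
        (Or.inr ?_)
      exact ENNReal.rpow_ne_top_of_nonneg (by positivity) (measure_ne_top γ univ)
    rw [mul_zero, zero_mul, add_zero, ← ENNReal.rpow_mul, one_div_mul_cancel hp0.ne',
      ENNReal.rpow_one] at h1
    exact (h1.eventually_lt_const hc).exists
  -- A mass η lost in the rational approximation is refilled at unit cost at most D.
  obtain ⟨η, hη, hηc⟩ : ∃ η : ℝ≥0∞, η ≠ 0 ∧
      (cost p γ ^ (1 / p) + 4 * δ k * γ univ ^ (1 / p)) ^ p + η * D < c := by
    have h1 : Tendsto (fun η : ℝ≥0∞ => (cost p γ ^ (1 / p) + 4 * δ k * γ univ ^ (1 / p)) ^ p +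
        η * D) (𝓝[>] 0)
        (𝓝 ((cost p γ ^ (1 / p) + 4 * δ k * γ univ ^ (1 / p)) ^ p + 0 * D)) :=
      tendsto_const_nhds.add (ENNReal.Tendsto.mul_const
        (tendsto_id.mono_left nhdsWithin_le_nhds) (Or.inr hDtop))
    rw [zero_mul, add_zero] at h1
    obtain ⟨η, h2, h3⟩ := ((h1.eventually_lt_const hk).and self_mem_nhdsWithin).exists
    exact ⟨η, (ne_of_gt h3), h2⟩
  -- pushing everything forward to the cells
  set τ : M → ℕ := cell M k with hτ
  have hτm : Measurable τ := measurable_cell k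
  set e : ℕ → M := TopologicalSpace.denseSeq M
  have hττ : Measurable fun z : M × M => (τ z.1, τ z.2) := by fun_prop
  set a : ℕ × ℕ → ℝ≥0∞ := fun j => (γ.map fun z => (τ z.1, τ z.2)) {j} with ha
  set l : ℕ → ℝ≥0∞ := fun i => (lam.map τ) {i} with hl
  set n : ℕ → ℝ≥0∞ := fun i => (nu.map τ) {i} with hn
  have hlfin : ∀ i, l i ≠ ∞ := fun i => by simp only [hl]; finiteness
  have hnfin : ∀ i, n i ≠ ∞ := fun i => by simp only [hn]; finiteness
  have hprod : ∀ F : ℕ × ℕ → ℝ≥0∞, ∫⁻ z, F (τ z.1, τ z.2) ∂lam.prod nu =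
      ∑' j, F j * (l j.1 * n j.2) := fun F => by
    have h1 : (lam.prod nu).map (fun z => (τ z.1, τ z.2)) = (lam.map τ).prod (nu.map τ) :=
      (Measure.map_prod_map lam nu hτm hτm).symm
    rw [← lintegral_map (f := F) (measurable_of_countable _) hττ, h1, lintegral_countable']
    congr 1; ext j
    rw [← singleton_prod_singleton, Measure.prod_prod]
  have hint : ∀ F : ℕ × ℕ → ℝ≥0∞, ∫⁻ z, F (τ z.1, τ z.2) ∂γ = ∑' j, F j * a j := fun F => by
    rw [← lintegral_map (f := F) (measurable_of_countable _) hττ, lintegral_countable']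
  have hrow : ∀ i, ∑' j, a (i, j) = l i := fun i => by
    have h1 := hint (fun j => ({i} : Set ℕ).indicator 1 j.1)
    rw [ENNReal.tsum_prod', tsum_eq_single i (by
      intro i' hi'; simp [indicator, hi'])] at h1
    simp only [mem_singleton_iff, indicator_of_mem, Pi.one_apply, one_mul] at h1
    rw [← h1]
    simp only [hl]
    rw [← lintegral_indicator_one (measurableSet_singleton i), ← hγ.1,
      Measure.map_map hτm measurable_fst, lintegral_map (measurable_of_countable _)
        (hτm.comp measurable_fst)]
    rfl
  have hcol : ∀ j, ∑' i, a (i, j) = n j := fun j => by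
    have h1 := hint (fun i => ({j} : Set ℕ).indicator 1 i.2)
    rw [ENNReal.tsum_prod', ENNReal.tsum_comm, tsum_eq_single j (by
      intro i' hi'; simp [indicator, hi'])] at h1
    simp only [mem_singleton_iff, indicator_of_mem, Pi.one_apply, one_mul] at h1
    rw [← h1]
    simp only [hn]
    rw [← lintegral_indicator_one (measurableSet_singleton j), ← hγ.2,
      Measure.map_map hτm measurable_snd, lintegral_map (measurable_of_countable _)
        (hτm.comp measurable_snd)]
    rfl
  have hal : ∀ i j, a (i, j) ≤ l i := fun i j => hrow i ▸ ENNReal.le_tsum j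
  have han : ∀ i j, a (i, j) ≤ n j := fun i j =>
    hcol j ▸ ENNReal.le_tsum (f := fun i => a (i, j)) i
  -- The density of the discretized γ with respect to the product of the discretized marginals. It
  -- reproduces `a` even on cells of product mass zero, since `a` is dominated by each marginal.
  set t : ℕ × ℕ → ℝ≥0∞ := fun j => a j / (l j.1 * n j.2) with ht
  have htc : ∀ j, t j * (l j.1 * n j.2) = a j := fun j => by
    rcases eq_or_ne (l j.1 * n j.2) 0 with h0 | h0
    · have : a j = 0 := by
        rcases mul_eq_zero.1 h0 with h | h
        · exact le_antisymm (h ▸ hal j.1 j.2) zero_le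
        · exact le_antisymm (h ▸ han j.1 j.2) zero_le
      rw [h0, mul_zero, this]
    · exact ENNReal.div_mul_cancel h0 (ENNReal.mul_ne_top (hlfin _) (hnfin _))
  have htn : ∀ i j, t (i, j) * n j ≤ a (i, j) / l i := fun i j => by
    simp only [ht]
    rw [ENNReal.div_eq_inv_mul, ENNReal.div_eq_inv_mul,
      ENNReal.mul_inv (Or.inr (hnfin _)) (Or.inl (hlfin _))]
    calc (l i)⁻¹ * (n j)⁻¹ * a (i, j) * n j = ((n j) * (n j)⁻¹) * ((l i)⁻¹ * a (i, j)) := by ring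
      _ ≤ 1 * ((l i)⁻¹ * a (i, j)) := by gcongr; exact ENNReal.mul_inv_le_one _
      _ = _ := one_mul _
  have htl : ∀ i j, t (i, j) * l i ≤ a (i, j) / n j := fun i j => by
    simp only [ht]
    rw [ENNReal.div_eq_inv_mul, ENNReal.div_eq_inv_mul,
      ENNReal.mul_inv (Or.inr (hnfin _)) (Or.inl (hlfin _))]
    calc (l i)⁻¹ * (n j)⁻¹ * a (i, j) * l i = ((l i) * (l i)⁻¹) * ((n j)⁻¹ * a (i, j)) := by ring
      _ ≤ 1 * ((n j)⁻¹ * a (i, j)) := by gcongr; exact ENNReal.mul_inv_le_one _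
      _ = _ := one_mul _
  have hasum : ∑' j, a j = lam univ := by
    have := hint 1
    simp only [Pi.one_apply, one_mul, lintegral_one] at this
    rw [← this, hmγ]
  obtain ⟨θ, hθt, hθη⟩ := exists_rat_finsupp (t := t) (c := fun j => l j.1 * n j.2) (fun j hj => by
      by_contra h0
      exact ENNReal.div_ne_top (ne_top_of_le_ne_top (hlfin j.1) (hal j.1 j.2)) h0 hj)
    (by simp only [htc]; rw [hasum]; finiteness) hη
  simp only [htc, hasum] at hθη
  have hbd : ∀ z : M × M, blockDensity (k, θ) z = ENNReal.ofReal (θ (τ z.1, τ z.2)) := fun z => rfl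
  have c1 : ∀ x, ∫⁻ y, blockDensity (k, θ) (x, y) ∂nu ≤ 1 := fun x => by
    simp only [hbd]
    rw [← lintegral_map (f := fun j => ENNReal.ofReal (θ (τ x, j))) (measurable_of_countable _) hτm,
      lintegral_countable']
    calc _ ≤ ∑' j, a (τ x, j) / l (τ x) := ENNReal.tsum_le_tsum fun j =>
          (mul_le_mul_left (hθt _) _).trans (htn _ _)
      _ = l (τ x) / l (τ x) := by
          simp_rw [ENNReal.div_eq_inv_mul]; rw [ENNReal.tsum_mul_left, hrow]
      _ ≤ 1 := ENNReal.div_self_le_one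
  have c2 : ∀ y, ∫⁻ x, blockDensity (k, θ) (x, y) ∂lam ≤ 1 := fun y => by
    simp only [hbd]
    rw [← lintegral_map (f := fun j => ENNReal.ofReal (θ (j, τ y))) (measurable_of_countable _) hτm,
      lintegral_countable']
    calc _ ≤ ∑' i, a (i, τ y) / n (τ y) := ENNReal.tsum_le_tsum fun j =>
          (mul_le_mul_left (hθt _) _).trans (htl _ _)
      _ = n (τ y) / n (τ y) := by
          simp_rw [ENNReal.div_eq_inv_mul]; rw [ENNReal.tsum_mul_left, hcol]
      _ ≤ 1 := ENNReal.div_self_le_one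
  refine ⟨(k, θ), ae_of_all _ c1, ae_of_all _ c2, ?_⟩
  refine (lintegral_filled_le (measurable_blockDensity _) hmass (ae_of_all _ c1) (ae_of_all _ c2)
    measurable_edist_rpow hD).trans_lt (lt_of_le_of_lt (add_le_add ?_ ?_) hηc)
  · have hcell : ∀ x, edist x (e (τ x)) ≤ δ k := edist_cell_le k
    calc ∫⁻ z, blockDensity (k, θ) z * edist z.1 z.2 ^ p ∂lam.prod nu
        ≤ ∫⁻ z, ENNReal.ofReal (θ (τ z.1, τ z.2)) *
            (edist (e (τ z.1)) (e (τ z.2)) + 2 * δ k) ^ p ∂lam.prod nu := by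
          refine lintegral_mono fun z => ?_
          rw [hbd]
          gcongr
          calc edist z.1 z.2 ≤ edist z.1 (e (τ z.1)) + edist (e (τ z.1)) (e (τ z.2)) +
              edist (e (τ z.2)) z.2 := edist_triangle4 _ _ _ _
            _ ≤ δ k + edist (e (τ z.1)) (e (τ z.2)) + δ k := by
              gcongr
              · exact hcell _
              · rw [edist_comm]; exact hcell _
            _ = _ := by ring
      -- The integrand is now constant on products of cells, so the product measure with block
      -- density below t may be replaced by γ.
      _ ≤ ∫⁻ z, (edist (e (τ z.1)) (e (τ z.2)) + 2 * δ k) ^ p ∂γ := by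
          rw [hprod (fun j => ENNReal.ofReal (θ j) * (edist (e j.1) (e j.2) + 2 * δ k) ^ p),
            hint (fun j => (edist (e j.1) (e j.2) + 2 * δ k) ^ p)]
          refine ENNReal.tsum_le_tsum fun j => ?_
          rw [← htc j]
          calc _ = (edist (e j.1) (e j.2) + 2 * δ k) ^ p *
              (ENNReal.ofReal (θ j) * (l j.1 * n j.2)) := by ring
            _ ≤ _ := by gcongr; exact hθt j
      _ ≤ ∫⁻ z, (edist z.1 z.2 + 4 * δ k) ^ p ∂γ := by
          refine lintegral_mono fun z => ?_
          refine ENNReal.rpow_le_rpow ?_ hp0.le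
          calc edist (e (τ z.1)) (e (τ z.2)) + 2 * δ k ≤
              edist (e (τ z.1)) z.1 + edist z.1 z.2 + edist z.2 (e (τ z.2)) + 2 * δ k := by
                gcongr; exact edist_triangle4 _ _ _ _
            _ ≤ δ k + edist z.1 z.2 + δ k + 2 * δ k := by
              gcongr
              · rw [edist_comm]; exact hcell _
              · exact hcell _
            _ = _ := by ring
      _ ≤ _ := by
          have h1 := ENNReal.lintegral_Lp_add_le (μ := γ) (f := fun z => edist z.1 z.2)
            (g := fun _ => 4 * δ k) (by fun_prop) (by fun_prop) hp
          rw [lintegral_const, ENNReal.mul_rpow_of_nonneg _ _ (by positivity : (0:ℝ) ≤ 1 / p),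
            ← ENNReal.rpow_mul (4 * δ k), mul_one_div_cancel hp0.ne', ENNReal.rpow_one] at h1
          have h2 := ENNReal.rpow_le_rpow h1 hp0.le
          rwa [← ENNReal.rpow_mul, one_div_mul_cancel hp0.ne', ENNReal.rpow_one] at h2
  · gcongr
    rw [tsub_le_iff_left]
    refine hθη.trans_eq ?_
    congr 1
    exact (hprod fun j => ENNReal.ofReal (θ j)).symm

end Block

/-! ### Equivariant random measures as sums of translates -/

section OrbitSum

variable {G : Type*} [Group G] [Countable G] {Ω X : Type*} [MeasurableSpace Ω]
  [MeasurableSpace X] [MulAction G Ω] [MulAction G X]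
  [MeasurableConstSMul G Ω] [MeasurableConstSMul G X]

/-- The sum of all translates of a kernel. -/
def orbitSum (G : Type*) [Group G] [Countable G] [MulAction G Ω] [MulAction G X]
    [MeasurableConstSMul G Ω] (r : Kernel Ω X) : Kernel Ω X :=
  Kernel.sum fun g : G => (r.comap (fun ω => g⁻¹ • ω) (measurable_const_smul g⁻¹)).map
    (fun x => g • x)

theorem lintegral_orbitSum (r : Kernel Ω X) (ω : Ω) {f : X → ℝ≥0∞} (hf : Measurable f) :
    ∫⁻ x, f x ∂orbitSum G r ω = ∑' g : G, ∫⁻ x, f (g • x) ∂r (g⁻¹ • ω) := by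
  rw [orbitSum, Kernel.sum_apply, lintegral_sum_measure]
  congr 1; ext g
  rw [Kernel.map_apply _ (measurable_const_smul g), lintegral_map hf (measurable_const_smul g),
    Kernel.comap_apply]

theorem isEquivariant_orbitSum (r : Kernel Ω X) : IsEquivariant G (orbitSum G r) := by
  refine isEquivariant_of_lintegral fun g ω f hf => ?_
  rw [lintegral_orbitSum r _ hf,
    lintegral_orbitSum r _ (f := fun x => f (g • x)) (hf.comp (measurable_const_smul g)),
    ← (Equiv.mulLeft g).tsum_eq]
  simp [mul_smul]

/-- Invariance of P undoes the shift of ω in each summand; the translates of w then add up to one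
and leave a single copy of r. -/
theorem expect_orbitSum {P : Measure Ω} [SMulInvariantMeasure G Ω P] (r : Kernel Ω X)
    {w h : X → ℝ≥0∞} (hw : IsWeight G w) (hh : Measurable h)
    (hinv : ∀ (g : G) x, h (g • x) = h x) :
    expect P (orbitSum G r) (fun x => w x * h x) = expect P r h := by
  have hm : ∀ g : G, Measurable fun x => w (g • x) * h x := fun g =>
    (hw.measurable.comp (measurable_const_smul g)).mul hh
  calc expect P (orbitSum G r) (fun x => w x * h x)
      = ∫⁻ ω, ∑' g : G, ∫⁻ x, w (g • x) * h x ∂r (g⁻¹ • ω) ∂P := by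
        refine lintegral_congr fun ω => ?_
        rw [lintegral_orbitSum r ω (f := fun x => w x * h x) (hw.measurable.mul hh)]
        simp only [hinv]
    _ = ∑' g : G, ∫⁻ ω, ∫⁻ x, w (g • x) * h x ∂r (g⁻¹ • ω) ∂P :=
        lintegral_tsum fun g =>
          ((hm g).lintegral_kernel.comp (measurable_const_smul g⁻¹)).aemeasurable
    _ = ∑' g : G, expect P r (fun x => w (g • x) * h x) := by
        congr 1; ext g
        exact (measurePreserving_smul g⁻¹ P).lintegral_comp
          (f := fun ω => ∫⁻ x, w (g • x) * h x ∂r ω) (hm g).lintegral_kernel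
    _ = expect P r h := by
        rw [← expect_tsum hm]
        simp_rw [ENNReal.tsum_mul_right, hw.tsum_eq, one_mul]

/-- If the kernel `r` has the same image under `τ` as the equivariant kernel `q` weighted by `w`,
then its orbit sum has the same image as `q`. -/
theorem map_orbitSum {Y : Type*} [MeasurableSpace Y] [MulAction G Y] [MeasurableConstSMul G Y]
    {q r : Kernel Ω X} (hq : IsEquivariant G q) {w : X → ℝ≥0∞} (hw : IsWeight G w) {τ : X → Y}
    (hτ : Measurable τ) (hτG : ∀ (g : G) x, τ (g • x) = g • τ x)
    (h : ∀ ω (f : Y → ℝ≥0∞), Measurable f → ∫⁻ x, f (τ x) ∂r ω = ∫⁻ x, w x * f (τ x) ∂q ω)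
    (ω : Ω) : (orbitSum G r ω).map τ = (q ω).map τ := by
  refine Measure.ext_of_lintegral _ fun f hf => ?_
  rw [lintegral_map hf hτ, lintegral_map hf hτ,
    lintegral_orbitSum r ω (f := fun x => f (τ x)) (hf.comp hτ)]
  have hm : ∀ g : G, Measurable fun x => w (g⁻¹ • x) * f (τ x) := fun g =>
    (hw.measurable.comp (measurable_const_smul g⁻¹)).mul (hf.comp hτ)
  calc ∑' g : G, ∫⁻ x, f (τ (g • x)) ∂r (g⁻¹ • ω)
      = ∑' g : G, ∫⁻ x, w (g⁻¹ • x) * f (τ x) ∂q ω := by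
        congr 1; ext g
        simp only [hτG]
        rw [h (g⁻¹ • ω) (fun y => f (g • y)) (hf.comp (measurable_const_smul g))]
        nth_rw 2 [← smul_inv_smul g ω]
        rw [hq.lintegral_smul g (g⁻¹ • ω) (hm g)]
        simp [hτG]
    _ = ∫⁻ x, f (τ x) ∂q ω := by
        rw [← lintegral_tsum fun g => (hm g).aemeasurable]
        simp_rw [ENNReal.tsum_mul_right]
        refine lintegral_congr fun x => ?_
        rw [show ∑' g : G, w (g⁻¹ • x) = 1 from
          ((Equiv.inv G).tsum_eq fun g => w (g • x)).trans (hw.tsum_eq x), one_mul]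

end OrbitSum

/-! ### Measurability in ω of the completed couplings -/

section FilledKernel

variable {Ω X Y : Type*} [MeasurableSpace Ω] [MeasurableSpace X] [MeasurableSpace Y]
  {h : X × Y → ℝ≥0∞} (hh : Measurable h) (lam : Kernel Ω X) (nu : Kernel Ω Y)
  [IsSFiniteKernel lam] [IsSFiniteKernel nu]

include hh

omit [IsSFiniteKernel lam] in
theorem measurable_lintegral_right : Measurable fun z : Ω × X => ∫⁻ y, h (z.2, y) ∂nu z.1 := by
  have : Measurable fun z : (Ω × X) × Y => h (z.1.2, z.2) := by fun_prop
  exact this.lintegral_kernel_prod_right' (κ := nu.comap Prod.fst measurable_fst)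

omit [IsSFiniteKernel nu] in
theorem measurable_lintegral_left : Measurable fun z : Ω × Y => ∫⁻ x, h (x, z.2) ∂lam z.1 := by
  have : Measurable fun z : (Ω × Y) × X => h (z.2, z.1.2) := by fun_prop
  exact this.lintegral_kernel_prod_right' (κ := lam.comap Prod.fst measurable_fst)

theorem measurable_filledDensity_kernel :
    Measurable (Function.uncurry fun ω => filledDensity h (lam ω) (nu ω)) := by
  have m1 := measurable_lintegral_right hh nu
  have m2 := measurable_lintegral_left hh lam
  have m3 : Measurable fun ω => ∫⁻ x, (1 - ∫⁻ y, h (x, y) ∂nu ω) ∂lam ω :=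
    (measurable_const.sub m1).lintegral_kernel_prod_right' (κ := lam)
  have m1' : Measurable fun z : Ω × X × Y => ∫⁻ y, h (z.2.1, y) ∂nu z.1 :=
    m1.comp (by fun_prop : Measurable fun z : Ω × X × Y => (z.1, z.2.1))
  have m2' : Measurable fun z : Ω × X × Y => ∫⁻ x, h (x, z.2.2) ∂lam z.1 :=
    m2.comp (by fun_prop : Measurable fun z : Ω × X × Y => (z.1, z.2.2))
  exact (hh.comp measurable_snd).add (((measurable_const.sub m1').mul
    (measurable_const.sub m2')).div (m3.comp measurable_fst))

/-- The couplings `filled`, as a kernel. -/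
theorem exists_filledKernel : ∃ κ : Kernel Ω (X × Y), ∀ ω, κ ω = filled h (lam ω) (nu ω) :=
  ⟨(lam ×ₖ nu).withDensity fun ω => filledDensity h (lam ω) (nu ω), fun ω => by
    rw [Kernel.withDensity_apply _ (measurable_filledDensity_kernel hh lam nu),
      Kernel.prod_apply]; rfl⟩

end FilledKernel

/-! ### Optimal couplings are carried by graphs -/

section Graph

variable {M : Type*} [MetricSpace M] [MeasurableSpace M]

theorem cost_smul (p : ℝ) (c : ℝ≥0∞) (q : Measure (M × M)) : cost p (c • q) = c * cost p q := by
  simp [cost]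

theorem IsCoupling.smul {q : Measure (M × M)} {lam mu : Measure M} (h : IsCoupling q lam mu)
    (c : ℝ≥0∞) : IsCoupling (c • q) (c • lam) (c • mu) :=
  ⟨by rw [Measure.map_smul, h.1], by rw [Measure.map_smul, h.2]⟩

/-- A finite measure on a compact product is either concentrated on a graph, or can be replaced by
a cheaper coupling of its marginals. -/
theorem UniqueMongeSolutions.graph_or_improvement {p : ℝ} {m : Measure M}
    (hM : UniqueMongeSolutions p m) {γ : Measure (M × M)} [IsFiniteMeasure γ] {A B : Set M}
    (hA : IsCompact A) (hB : IsCompact B) (hAγ : γ.map Prod.fst Aᶜ = 0)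
    (hBγ : γ.map Prod.snd Bᶜ = 0) (hac : γ.map Prod.fst ≪ m) :
    (∃ T : M → M, Measurable T ∧ γ = (γ.map Prod.fst).map (fun x => (x, T x))) ∨
      ∃ q, IsCoupling q (γ.map Prod.fst) (γ.map Prod.snd) ∧ cost p q < cost p γ := by
  by_cases h0 : γ univ = 0
  · refine Or.inl ⟨id, measurable_id, ?_⟩
    rw [Measure.measure_univ_eq_zero.1 h0]; simp
  -- The uniqueness hypothesis concerns probability measures, so γ is normalized by its mass; costs
  -- and couplings scale linearly.
  set c := γ univ with hc
  have hctop : c ≠ ∞ := measure_ne_top γ univ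
  have hcc : c * c⁻¹ = 1 := ENNReal.mul_inv_cancel h0 hctop
  have hprob : ∀ τ : M × M → M, Measurable τ → IsProbabilityMeasure (c⁻¹ • γ.map τ) :=
    fun τ hτ => ⟨by
      rw [Measure.smul_apply, Measure.map_apply hτ .univ, preimage_univ, smul_eq_mul, ← hc,
        ENNReal.inv_mul_cancel h0 hctop]⟩
  obtain ⟨T, hT, hTiff⟩ := hM (c⁻¹ • γ.map Prod.fst) (c⁻¹ • γ.map Prod.snd)
    (hprob _ measurable_fst) (hprob _ measurable_snd) ⟨A, hA, by simp [hAγ]⟩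
    ⟨B, hB, by simp [hBγ]⟩ (hac.smul_left _)
  have hγc : IsCoupling (c⁻¹ • γ) (c⁻¹ • γ.map Prod.fst) (c⁻¹ • γ.map Prod.snd) :=
    IsCoupling.smul ⟨rfl, rfl⟩ _
  by_cases hmin : IsCostMinimizer p (c⁻¹ • γ) (c⁻¹ • γ.map Prod.fst) (c⁻¹ • γ.map Prod.snd)
  · refine Or.inl ⟨T, hT, ?_⟩
    have h1 := congrArg (c • ·) ((hTiff _).1 hmin)
    simpa only [Measure.map_smul, smul_smul, hcc, one_smul] using h1
  · right
    simp only [IsCostMinimizer, hγc, true_and, not_forall, not_le] at hmin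
    obtain ⟨q, hq, hlt⟩ := hmin
    refine ⟨c • q, ?_, ?_⟩
    · have := hq.smul c
      simpa only [smul_smul, hcc, one_smul] using this
    · rw [cost_smul] at hlt ⊢
      calc c * cost p q < c * (c⁻¹ * cost p γ) := (ENNReal.mul_lt_mul_iff_right h0 hctop).2 hlt
        _ = cost p γ := by rw [← mul_assoc, hcc, one_mul]

variable [ProperSpace M] [BorelSpace M]
  {G : Type*} [Group G] [Countable G] [MulAction G M] [IsIsometricSMul G M]
  {Ω : Type*} [MeasurableSpace Ω] [MulAction G Ω] [MeasurableConstSMul G Ω] {P : Measure Ω}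
  [IsProbabilityMeasure P] [SMulInvariantMeasure G Ω P] {m : Measure M}
  [IsFiniteMeasureOnCompacts m] [SMulInvariantMeasure G M m] {p : ℝ}
  {B₀ : Set M} (hB₀ : IsFundamentalRegion G B₀) (hmB₀ : m B₀ = 1)

include hB₀ hmB₀

/-- The part of an optimal coupling starting in the fundamental region cannot be improved on a
measurable set of positive probability. -/
theorem IsOptimalCoupling.measure_improvement_eq_zero {q : Kernel Ω (M × M)} {μ : Kernel Ω M}
    (hq : IsOptimalCoupling G P m p q (Kernel.const Ω m) μ) (hfin : meanCost G P m p q ≠ ∞)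
    {B : Set M} (hB : MeasurableSet B) {Φ : Kernel Ω (M × M)} {S : Set Ω} (hS : MeasurableSet S)
    (hΦ : ∀ ω ∈ S, IsCoupling (Φ ω) (((q ω).restrict (B₀ ×ˢ B)).map Prod.fst)
      (((q ω).restrict (B₀ ×ˢ B)).map Prod.snd))
    (hΦc : ∀ ω ∈ S, cost p (Φ ω) < cost p ((q ω).restrict (B₀ ×ˢ B))) : P S = 0 := by
  classical
  by_contra hPS
  have hm : IsRandomMeasure (Kernel.const Ω m) := fun ω => by
    rw [Kernel.const_apply]; infer_instance
  have hBm : MeasurableSet (B₀ ×ˢ B) := hB₀.measurableSet.prod hB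
  have hBm' : MeasurableSet (B₀ ×ˢ Bᶜ) := hB₀.measurableSet.prod hB.compl
  set γ := q.restrict hBm with hγ
  -- The competitor over B₀: transports leaving for the complement of B are kept, those into B are
  -- replaced by Φ when ω is in S.
  set r := q.restrict hBm' + Kernel.piecewise hS Φ γ with hr
  have hγω : ∀ ω, γ ω = (q ω).restrict (B₀ ×ˢ B) := fun ω => Kernel.restrict_apply _ _ _
  have hrω : ∀ ω (F : M × M → ℝ≥0∞), ∫⁻ z, F z ∂r ω =
      ∫⁻ z in B₀ ×ˢ Bᶜ, F z ∂q ω + ∫⁻ z, F z ∂(if ω ∈ S then Φ ω else γ ω) := fun ω F => by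
    rw [hr, add_apply, lintegral_add_measure, Kernel.restrict_apply,
      Kernel.piecewise_apply]
  have hsplit : ∀ ω (F : M × M → ℝ≥0∞), ∫⁻ z, B₀.indicator 1 z.1 * F z ∂q ω =
      ∫⁻ z in B₀ ×ˢ Bᶜ, F z ∂q ω + ∫⁻ z, F z ∂γ ω := fun ω F => by
    have h1 : ∫⁻ z, B₀.indicator 1 z.1 * F z ∂q ω = ∫⁻ z in B₀ ×ˢ univ, F z ∂q ω := by
      rw [← lintegral_indicator (hB₀.measurableSet.prod .univ)]
      congr 1; ext z
      by_cases hz : z.1 ∈ B₀ <;> simp [indicator, hz]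
    have h2 : B₀ ×ˢ (univ : Set M) = B₀ ×ˢ Bᶜ ∪ B₀ ×ˢ B := by
      rw [← prod_union, compl_union_self]
    rw [h1, hγω, h2, lintegral_union hBm]
    rw [disjoint_left]
    rintro z ⟨-, hz⟩ ⟨-, hz'⟩
    exact hz hz'
  have hmarg : ∀ τ : M × M → M, Measurable τ → (∀ ω ∈ S, (Φ ω).map τ = (γ ω).map τ) →
      ∀ ω (f : M → ℝ≥0∞), Measurable f →
        ∫⁻ z, f (τ z) ∂r ω = ∫⁻ z, B₀.indicator 1 z.1 * f (τ z) ∂q ω := fun τ hτ hτS ω f hf => by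
    rw [hrω ω (fun z => f (τ z)), hsplit ω (fun z => f (τ z))]
    congr 1
    split_ifs with hω
    · rw [← lintegral_map hf hτ, hτS ω hω, lintegral_map hf hτ]
    · rfl
  have hqe := hq.isEquivariantCoupling
  -- The competitor has the same marginals as the part of q starting in B₀, so its orbit sum has the
  -- marginals of q.
  have hfst := map_orbitSum hqe.isEquivariant (isWeight_fst hB₀) measurable_fst
    (fun _ _ => rfl) (hmarg _ measurable_fst fun ω hω => by rw [hγω]; exact (hΦ ω hω).1)
  have hsnd := map_orbitSum hqe.isEquivariant (isWeight_fst hB₀) measurable_snd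
    (fun _ _ => rfl) (hmarg _ measurable_snd fun ω hω => by rw [hγω]; exact (hΦ ω hω).2)
  obtain ⟨q', hq', hq'r⟩ := exists_isEquivariantCoupling (P := P) (nu := μ)
    (isEquivariant_orbitSum (G := G) r) hm
    (hqe.isCoupling.mono fun ω hω => ⟨(hfst ω).trans hω.1, (hsnd ω).trans hω.2⟩)
  have hinv : ∀ (g : G) (z : M × M), edist (g • z).1 (g • z).2 ^ p = edist z.1 z.2 ^ p :=
    fun g z => by simp
  have hle : meanCost G P m p q ≤ meanCost G P m p q' := by
    rw [hq.meanCost_eq]; exact iInf₂_le q' hq'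
  rw [RandomTransport.meanCost_eq hB₀ hmB₀ hq'.isEquivariant (isWeight_fst hB₀), expect_congr hq'r,
    expect_orbitSum r (isWeight_fst hB₀) measurable_edist_rpow hinv] at hle
  have hC : meanCost G P m p q = ∫⁻ ω, ∫⁻ z in B₀ ×ˢ Bᶜ, edist z.1 z.2 ^ p ∂q ω ∂P +
      ∫⁻ ω, cost p (γ ω) ∂P := by
    have hm1 : Measurable fun ω => ∫⁻ z in B₀ ×ˢ Bᶜ, edist z.1 z.2 ^ p ∂q ω := by
      have := (measurable_edist_rpow (M := M) (p := p)).lintegral_kernel (κ := q.restrict hBm')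
      simpa only [Kernel.restrict_apply] using this
    rw [RandomTransport.meanCost_eq hB₀ hmB₀ hqe.isEquivariant (isWeight_fst hB₀), ← lintegral_add_left hm1]
    exact lintegral_congr fun ω => hsplit ω fun z => edist z.1 z.2 ^ p
  have hR : expect P r (fun z => edist z.1 z.2 ^ p) =
      ∫⁻ ω, ∫⁻ z in B₀ ×ˢ Bᶜ, edist z.1 z.2 ^ p ∂q ω ∂P +
      ∫⁻ ω, cost p (if ω ∈ S then Φ ω else γ ω) ∂P := by
    have hm1 : Measurable fun ω => ∫⁻ z in B₀ ×ˢ Bᶜ, edist z.1 z.2 ^ p ∂q ω := by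
      have := (measurable_edist_rpow (M := M) (p := p)).lintegral_kernel (κ := q.restrict hBm')
      simpa only [Kernel.restrict_apply] using this
    rw [← lintegral_add_left hm1]
    exact lintegral_congr fun ω => hrω ω fun z => edist z.1 z.2 ^ p
  rw [hC] at hfin hle
  rw [hR] at hle
  -- The cost of the unchanged part is finite and cancels, so the modified parts can be compared
  -- directly.
  have hle2 := (ENNReal.add_le_add_iff_left (ne_top_of_le_ne_top hfin le_self_add)).1 hle
  have hγm : Measurable fun ω => cost p (γ ω) := measurable_edist_rpow.lintegral_kernel
  have hpt : ∀ ω, cost p (if ω ∈ S then Φ ω else γ ω) ≤ cost p (γ ω) := fun ω => by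
    split_ifs with hω
    · rw [hγω]; exact (hΦc ω hω).le
    · exact le_rfl
  have hlt : ∫⁻ ω, cost p (if ω ∈ S then Φ ω else γ ω) ∂P < ∫⁻ ω, cost p (γ ω) ∂P := by
    refine lintegral_strict_mono_of_ae_le_of_ae_lt_on hγm.aemeasurable
      (ne_top_of_le_ne_top hfin ((lintegral_mono hpt).trans le_add_self)) (ae_of_all _ hpt)
      (s := S) hPS (ae_of_all _ fun ω hω => ?_)
    rw [if_pos hω, hγω]
    exact hΦc ω hω
  exact absurd hle2 (not_le.2 hlt)

/-- Optimal couplings of `m` and `μ` are concentrated on graphs. -/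
theorem IsOptimalCoupling.ae_graph (hB₀bdd : Bornology.IsBounded B₀) (hp : 1 ≤ p)
    (hM : UniqueMongeSolutions p m) {q : Kernel Ω (M × M)} {μ : Kernel Ω M}
    (hq : IsOptimalCoupling G P m p q (Kernel.const Ω m) μ) (hfin : meanCost G P m p q ≠ ∞)
    {B : Set M} (hB : IsCompact B) :
    ∀ᵐ ω ∂P, ∃ T : M → M, Measurable T ∧ (q ω).restrict (B₀ ×ˢ B) =
      (((q ω).restrict (B₀ ×ˢ B)).map Prod.fst).map (fun x => (x, T x)) := by
  classical
  have hne : Nonempty M := by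
    rcases B₀.eq_empty_or_nonempty with h | ⟨z, -⟩
    · simp [h] at hmB₀
    · exact ⟨z⟩
  have hqe := hq.isEquivariantCoupling
  have := hqe.isRandomMeasure.isSFiniteKernel
  have hBm : MeasurableSet (B₀ ×ˢ B) := hB₀.measurableSet.prod hB.measurableSet
  set γ := q.restrict hBm with hγ
  have hγω : ∀ ω, γ ω = (q ω).restrict (B₀ ×ˢ B) := fun ω => Kernel.restrict_apply _ _ _
  set lam := γ.map Prod.fst with hlam
  set nu := γ.map Prod.snd with hnu
  have hlamω : ∀ ω, lam ω = ((q ω).restrict (B₀ ×ˢ B)).map Prod.fst := fun ω => by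
    rw [hlam, Kernel.map_apply _ measurable_fst, hγω]
  have hnuω : ∀ ω, nu ω = ((q ω).restrict (B₀ ×ˢ B)).map Prod.snd := fun ω => by
    rw [hnu, Kernel.map_apply _ measurable_snd, hγω]
  have huniv : ∀ ω, lam ω univ = γ ω univ ∧ nu ω univ = γ ω univ := fun ω => by
    rw [hlam, hnu, Kernel.map_apply _ measurable_fst, Kernel.map_apply _ measurable_snd,
      Measure.map_apply measurable_fst .univ, Measure.map_apply measurable_snd .univ]
    exact ⟨rfl, rfl⟩
  have hblock := fun i : ℕ × (ℕ × ℕ →₀ ℚ) => measurable_blockDensity (M := M) i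
  choose Φ hΦ using fun i : ℕ × (ℕ × ℕ →₀ ℚ) => exists_filledKernel (hblock i) lam nu
  -- The ω at which the i-th completed block density is a cheaper coupling. Being one of countably
  -- many measurable null sets, it replaces a measurable selection of improvements.
  set S : ℕ × (ℕ × ℕ →₀ ℚ) → Set Ω := fun i => {ω | γ ω univ < ∞ ∧
    lam ω {x | 1 < ∫⁻ y, blockDensity i (x, y) ∂nu ω} = 0 ∧
    nu ω {y | 1 < ∫⁻ x, blockDensity i (x, y) ∂lam ω} = 0 ∧ cost p (Φ i ω) < cost p (γ ω)} with hSdef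
  have hSm : ∀ i, MeasurableSet (S i) := fun i => by
    have m1 : Measurable fun ω => γ ω univ := γ.measurable_coe .univ
    have m2 : Measurable fun ω => lam ω {x | 1 < ∫⁻ y, blockDensity i (x, y) ∂nu ω} :=
      Kernel.measurable_kernel_prodMk_left (κ := lam)
        (t := {z : Ω × M | 1 < ∫⁻ y, blockDensity i (z.2, y) ∂nu z.1})
        (measurableSet_lt measurable_const (measurable_lintegral_right (hblock i) nu))
    have m3 : Measurable fun ω => nu ω {y | 1 < ∫⁻ x, blockDensity i (x, y) ∂lam ω} :=
      Kernel.measurable_kernel_prodMk_left (κ := nu)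
        (t := {z : Ω × M | 1 < ∫⁻ x, blockDensity i (x, z.2) ∂lam z.1})
        (measurableSet_lt measurable_const (measurable_lintegral_left (hblock i) lam))
    have m4 : Measurable fun ω => cost p (γ ω) := measurable_edist_rpow.lintegral_kernel
    have m5 : Measurable fun ω => cost p (Φ i ω) := measurable_edist_rpow.lintegral_kernel
    exact (measurableSet_lt m1 measurable_const).inter ((m2 (measurableSet_singleton 0)).inter
      ((m3 (measurableSet_singleton 0)).inter (measurableSet_lt m5 m4)))
  have hae : ∀ {ρ : Measure M} {F : M → ℝ≥0∞}, ρ {x | 1 < F x} = 0 ↔ ∀ᵐ x ∂ρ, F x ≤ 1 :=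
    fun {ρ F} => by simp only [ae_iff, not_le]
  have hSnull : ∀ i, P (S i) = 0 := fun i => by
    refine hq.measure_improvement_eq_zero hB₀ hmB₀ hfin hB.measurableSet (Φ := Φ i) (hSm i)
      (fun ω hω => ?_) (fun ω hω => ?_)
    · obtain ⟨h1, h2, h3, h4⟩ := hω
      have f1 : IsFiniteMeasure (lam ω) := ⟨by rwa [(huniv ω).1]⟩
      have f2 : IsFiniteMeasure (nu ω) := ⟨by rwa [(huniv ω).2]⟩
      rw [← hlamω, ← hnuω, hΦ]
      exact isCoupling_filled (hblock i) ((huniv ω).1.trans (huniv ω).2.symm) (hae.1 h2) (hae.1 h3)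
    · rw [← hγω]; exact hω.2.2.2
  have hall : ∀ᵐ ω ∂P, ∀ i, ω ∉ S i := ae_all_iff.2 fun i =>
    measure_eq_zero_iff_ae_notMem.1 (hSnull i)
  filter_upwards [hall, hqe.isCoupling] with ω hω hωc
  have hle : lam ω ≤ m := by
    rw [hlamω]
    refine (Measure.map_mono Measure.restrict_le_self measurable_fst).trans_eq ?_
    rw [hωc.1, Kernel.const_apply]
  have hlamc : lam ω B₀ᶜ = 0 := by
    rw [hlamω, Measure.map_apply measurable_fst hB₀.measurableSet.compl, Measure.restrict_apply
      (measurable_fst hB₀.measurableSet.compl)]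
    convert measure_empty (μ := q ω)
    ext z; simp; tauto
  have hnuc : nu ω Bᶜ = 0 := by
    rw [hnuω, Measure.map_apply measurable_snd hB.measurableSet.compl, Measure.restrict_apply
      (measurable_snd hB.measurableSet.compl)]
    convert measure_empty (μ := q ω)
    ext z; simp; tauto
  have hγfin : γ ω univ < ∞ := by
    rw [← (huniv ω).1, ← measure_add_measure_compl hB₀.measurableSet, hlamc, add_zero]
    exact (hle B₀).trans_lt (by rw [hmB₀]; exact ENNReal.one_lt_top)
  have f0 : IsFiniteMeasure (γ ω) := ⟨hγfin⟩
  have f1 : IsFiniteMeasure (lam ω) := ⟨by rwa [(huniv ω).1]⟩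
  have f2 : IsFiniteMeasure (nu ω) := ⟨by rwa [(huniv ω).2]⟩
  rw [← hγω]
  have hl : lam ω = (γ ω).map Prod.fst := by rw [hlamω, hγω]
  have hn : nu ω = (γ ω).map Prod.snd := by rw [hnuω, hγω]
  refine (hM.graph_or_improvement (γ := γ ω) (hB₀bdd.isCompact_closure) hB
    (measure_mono_null (compl_subset_compl.2 subset_closure) (hl ▸ hlamc)) (hn ▸ hnuc)
    (hl ▸ Measure.absolutelyContinuous_of_le hle)).resolve_right ?_
  rintro ⟨q', hq', hlt⟩
  rw [← hl, ← hn] at hq'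
  -- Both marginals live on bounded sets, so d^p is bounded and refilling lost mass is affordable.
  obtain ⟨C, hC⟩ := Metric.isBounded_iff.1 (hB₀bdd.union hB.isBounded)
  have hD : ∀ᵐ z ∂(lam ω).prod (nu ω), edist z.1 z.2 ^ p ≤ ENNReal.ofReal C ^ p := by
    have h1 := (Measure.quasiMeasurePreserving_fst (μ := lam ω) (ν := nu ω)).ae
      (measure_eq_zero_iff_ae_notMem.1 hlamc)
    have h2 := (Measure.quasiMeasurePreserving_snd (μ := lam ω) (ν := nu ω)).ae
      (measure_eq_zero_iff_ae_notMem.1 hnuc)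
    filter_upwards [h1, h2] with z hz1 hz2
    refine ENNReal.rpow_le_rpow ?_ (by linarith)
    rw [edist_dist]
    exact ENNReal.ofReal_le_ofReal (hC (Or.inl (not_not.1 hz1)) (Or.inr (not_not.1 hz2)))
  obtain ⟨i, hi1, hi2, hi3⟩ := exists_filled_block_cost_lt hp hq'
    (ENNReal.rpow_ne_top_of_nonneg (by linarith) ENNReal.ofReal_ne_top) hD hlt
  exact hω i ⟨hγfin, hae.2 hi1, hae.2 hi2, by rw [hΦ]; exact hi3⟩

end Graph

/-! ### Resampling a coordinate that is a function of the other -/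

section Diagonal

variable {M : Type*} [MetricSpace M] [SecondCountableTopology M] [MeasurableSpace M] [BorelSpace M]

/-- If the second coordinate is almost surely a function of the first one, then sampling it anew
does not change it. -/
theorem IsResampling.ae_measure_ne_eq_zero {ρ : Measure (M × M)} {K : Kernel M M}
    [IsMarkovKernel K] (h : IsResampling ρ K) {A : Set M} (hA : MeasurableSet A) {B : ℕ → Set M}
    (hBm : ∀ k, MeasurableSet (B k)) (hBmono : Monotone B) (hB : ⋃ k, B k = univ)
    (hT : ∀ k, ∃ T : M → M, Measurable T ∧ ρ.restrict (A ×ˢ B k) =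
      ((ρ.restrict (A ×ˢ B k)).map Prod.fst).map (fun x => (x, T x))) :
    ∀ᵐ z ∂ρ, z.1 ∈ A → K z.1 {y | y ≠ z.2} = 0 := by
  have key : ∀ k, ∀ᵐ z ∂ρ, z.1 ∈ A → z.2 ∈ B k → K z.1 {y | y ∈ B k ∧ y ≠ z.2} = 0 := fun k => by
    obtain ⟨T, hTm, hTk⟩ := hT k
    have hAB := hA.prod (hBm k)
    have hne : MeasurableSet {z : M × M | z.2 ≠ T z.1} :=
      (measurableSet_eq_fun measurable_snd (hTm.comp measurable_fst)).compl
    have hgraph : ρ ({z | z.2 ≠ T z.1} ∩ A ×ˢ B k) = 0 := by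
      rw [← Measure.restrict_apply hne, hTk, Measure.map_apply (by fun_prop) hne]
      simp
    have hS : MeasurableSet ({z : M × M | z.2 ≠ T z.1} ∩ A ×ˢ B k) := hne.inter hAB
    -- The off-graph set is null for ρ, hence also after resampling: the law K(x) does not charge
    -- the points of `B k` other than T(x).
    have h1 := h (({z | z.2 ≠ T z.1} ∩ A ×ˢ B k).indicator 1) (measurable_one.indicator hS)
    rw [lintegral_indicator_one hS, hgraph, eq_comm, lintegral_eq_zero_iff] at h1
    · filter_upwards [h1, measure_eq_zero_iff_ae_notMem.1 hgraph] with z hz hz' hzA hzB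
      have h2 : z.2 = T z.1 := by
        by_contra hc
        exact hz' ⟨hc, hzA, hzB⟩
      have h3 : MeasurableSet {y | y ∈ B k ∧ y ≠ z.2} :=
        (hBm k).inter (measurableSet_singleton _).compl
      rw [← lintegral_indicator_one h3]
      refine Eq.trans (lintegral_congr fun y => ?_) hz
      by_cases h4 : y ∈ B k <;> by_cases h5 : y = T z.1 <;> simp [indicator, h2, h4, h5, hzA]
    · exact ((measurable_one.indicator hS).lintegral_kernel_prod_right' (κ := K)).comp
        measurable_fst
  filter_upwards [ae_all_iff.2 key] with z hz hzA
  obtain ⟨k₀, hk₀⟩ := mem_iUnion.1 (hB ▸ mem_univ z.2)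
  -- The maps T for different k need not be compared: each bound mentions only `z.2`, and applies
  -- from the first index whose set contains it.
  refine measure_mono_null (t := ⋃ k, {y | y ∈ B (k₀ + k) ∧ y ≠ z.2}) (fun y hy => ?_)
    (measure_iUnion_null fun k => hz _ hzA (hBmono (Nat.le_add_right _ _) hk₀))
  obtain ⟨k, hk⟩ := mem_iUnion.1 (hB ▸ mem_univ y)
  exact mem_iUnion.2 ⟨k, hBmono (Nat.le_add_left _ _) hk, hy⟩

end Diagonal

/-! ### Composing a reversed coupling with a disintegration -/

section GlueSwap

variable {M : Type*} [MetricSpace M] [ProperSpace M] [MeasurableSpace M] [BorelSpace M]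
  {G : Type*} [Group G] [Countable G] [MulAction G M] [IsIsometricSMul G M]
  {Ω : Type*} [MeasurableSpace Ω] [MulAction G Ω] [MeasurableConstSMul G Ω] {P : Measure Ω}
  [IsProbabilityMeasure P] [SMulInvariantMeasure G Ω P] {m : Measure M}
  [IsFiniteMeasureOnCompacts m] [SMulInvariantMeasure G M m] {p : ℝ}

theorem lintegral_glue_swap (q : Kernel Ω (M × M)) [IsSFiniteKernel q] (K : Kernel (Ω × M) M)
    [IsMarkovKernel K] (ω : Ω) {f : (M × M) × M → ℝ≥0∞} (hf : Measurable f) :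
    ∫⁻ t, f t ∂glue (q.map Prod.swap) K ω = ∫⁻ z, ∫⁻ y, f (z.swap, y) ∂K (ω, z.1) ∂q ω := by
  have h : Measurable fun z : M × M => ∫⁻ y, f (z, y) ∂K (ω, z.2) :=
    hf.lintegral_kernel_prod_right' (κ := (K.sectR ω).comap Prod.snd measurable_snd)
  rw [lintegral_glue _ K ω hf, Kernel.map_apply _ measurable_swap, lintegral_map h measurable_swap]
  rfl

/-- Integrating out the last coordinate leaves K(ω,x)(C), a function of the first point and ω alone.
-/
theorem expect_glue_swap_mul_indicator (q : Kernel Ω (M × M)) [IsSFiniteKernel q]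
    (K : Kernel (Ω × M) M) [IsMarkovKernel K] {F : M × M → ℝ≥0∞} (hF : Measurable F) {C : Set M}
    (hC : MeasurableSet C) :
    expect P (glue (q.map Prod.swap) K) (fun t => F t.1.swap * C.indicator 1 t.2) =
      ∫⁻ z, F z.1 * K (z.2, z.1.1) C ∂campbell P q := by
  have hK : Measurable fun z : Ω × M => K z C := K.measurable_coe hC
  have h1 : Measurable (C.indicator (1 : M → ℝ≥0∞)) := measurable_one.indicator hC
  rw [lintegral_campbell P q (f := fun z => F z.1 * K (z.2, z.1.1) C) (by fun_prop)]
  refine lintegral_congr fun ω => ?_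
  rw [lintegral_glue_swap q K ω (by fun_prop)]
  refine lintegral_congr fun z => ?_
  simp only [Prod.swap_swap]
  rw [lintegral_const_mul _ h1, lintegral_indicator_one hC]

theorem isEquivariant_const : IsEquivariant G (Kernel.const Ω m) := fun g ω => by
  simp [(measurePreserving_smul g m).map_eq]

theorem expect_const_of_isWeight {B₀ : Set M} (hB₀ : IsFundamentalRegion G B₀) (hmB₀ : m B₀ = 1)
    {w : M → ℝ≥0∞} (hw : IsWeight G w) : expect P (Kernel.const Ω m) w = 1 := by
  have h := mass_transport (P := P) (isEquivariant_const (G := G) (Ω := Ω) (m := m)) hw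
    hB₀.isWeight (h := fun _ => 1) measurable_const (fun _ _ => rfl)
  simp only [mul_one] at h
  rw [h]
  simp [expect, lintegral_indicator_one hB₀.measurableSet, hmB₀]

variable {B₀ : Set M} (hB₀ : IsFundamentalRegion G B₀) (hmB₀ : m B₀ = 1)

include hB₀ hmB₀

/-- Sampling the second coordinate of an optimal coupling anew does not change it. -/
theorem IsOptimalCoupling.expect_glue_ne_eq_zero (hB₀bdd : Bornology.IsBounded B₀) (hp : 1 ≤ p)
    (hM : UniqueMongeSolutions p m) {q : Kernel Ω (M × M)} [IsSFiniteKernel q] {μ : Kernel Ω M}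
    (hq : IsOptimalCoupling G P m p q (Kernel.const Ω m) μ) (hfin : meanCost G P m p q ≠ ∞)
    {K : Kernel (Ω × M) M} [IsMarkovKernel K] (hKe : IsEquivariantKernel G K)
    (hK : ∀ᵐ ω ∂P, IsResampling (q ω) (K.sectR ω)) {w : (M × M) × M → ℝ≥0∞} (hw : IsWeight G w) :
    expect P (glue (q.map Prod.swap) K)
      (fun t => w t * {t : (M × M) × M | t.1.1 ≠ t.2}.indicator 1 t) = 0 := by
  obtain ⟨x₀⟩ : Nonempty M := by
    rcases B₀.eq_empty_or_nonempty with h | ⟨z, -⟩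
    · simp [h] at hmB₀
    · exact ⟨z⟩
  have hqe := hq.isEquivariantCoupling.isEquivariant
  have hne : MeasurableSet {t : (M × M) × M | t.1.1 ≠ t.2} :=
    (measurableSet_eq_fun (by fun_prop) (by fun_prop)).compl
  have hne1 : Measurable ({t : (M × M) × M | t.1.1 ≠ t.2}.indicator (1 : (M × M) × M → ℝ≥0∞)) :=
    measurable_one.indicator hne
  have hw' : IsWeight G fun t : (M × M) × M => (B₀.indicator 1 t.1.2 : ℝ≥0∞) :=
    hB₀.isWeight.comp (by fun_prop) fun _ _ => rfl
  -- The graph property is available over B₀, so the weight is exchanged for the indicator of B₀ in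
  -- the middle coordinate.
  rw [mass_transport ((hqe.map measurable_swap fun _ _ => rfl).glue hKe) hw hw' hne1 (fun g t => by
    have h1 : g • t ∈ {t : (M × M) × M | t.1.1 ≠ t.2} ↔ t ∈ {t : (M × M) × M | t.1.1 ≠ t.2} :=
      not_congr (smul_left_cancel_iff g)
    by_cases h : t ∈ {t : (M × M) × M | t.1.1 ≠ t.2}
    · rw [indicator_of_mem h, indicator_of_mem (h1.2 h)]; rfl
    · rw [indicator_of_notMem h, indicator_of_notMem (mt h1.1 h)])]
  rw [expect, lintegral_eq_zero_iff (by
    exact (Measurable.mul hw'.measurable hne1).lintegral_kernel)]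
  have hgr := ae_all_iff.2 fun k : ℕ =>
    hq.ae_graph hB₀ hmB₀ hB₀bdd hp hM hfin (isCompact_closedBall x₀ k)
  filter_upwards [hK, hgr] with ω hω hT
  rw [lintegral_glue_swap q K ω (f := fun t => B₀.indicator 1 t.1.2 *
    {t : (M × M) × M | t.1.1 ≠ t.2}.indicator 1 t) (Measurable.mul hw'.measurable hne1)]
  have := hω.ae_measure_ne_eq_zero hB₀.measurableSet
    (fun k => Metric.isClosed_closedBall.measurableSet)
    (fun k l hkl => Metric.closedBall_subset_closedBall (by exact_mod_cast hkl))
    (Metric.iUnion_closedBall_nat x₀) hT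
  refine (lintegral_congr_ae (this.mono fun z hz => ?_)).trans lintegral_zero
  simp only [Prod.snd_swap]
  by_cases hzB : z.1 ∈ B₀
  · have hz' := hz hzB
    rw [Kernel.sectR_apply] at hz'
    simp only [hzB, indicator_of_mem, Pi.one_apply, one_mul]
    have hs : MeasurableSet {y | y ≠ z.2} := (measurableSet_singleton z.2).compl
    rw [← hz', ← lintegral_indicator_one hs]
    refine lintegral_congr fun y => ?_
    by_cases hy : y = z.2
    · simp [hy]
    · simp [hy, Ne.symm hy]
  · simp [hzB]

end GlueSwap

/-! ### Continuous approximation of measurable functions on M × Ω -/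

section Approximation

variable {M : Type*} [MetricSpace M] [SecondCountableTopology M] [MeasurableSpace M] [BorelSpace M]
  {Ω : Type*} [MetricSpace Ω] [SecondCountableTopology Ω] [MeasurableSpace Ω]
  [OpensMeasurableSpace Ω] {P : Measure Ω}

/-- If the `σ`-field of `Ω` lies between the Borel `σ`-field and its completion, then measurable
subsets of `M × Ω` are Borel up to null sets. -/
theorem exists_borel_ae_eq
    (hΩ : ∀ A : Set Ω, MeasurableSet A → ∃ B : Set Ω, MeasurableSet[borel Ω] B ∧ A =ᵐ[P] B)
    {ρ : Measure (M × Ω)} (hρ : ρ.map Prod.snd ≪ P) {A : Set (M × Ω)} (hA : MeasurableSet A) :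
    ∃ B, MeasurableSet[borel (M × Ω)] B ∧ A =ᵐ[ρ] B := by
  have hle : (inferInstance : MeasurableSpace (M × Ω)) ≤
      eventuallyMeasurableSpace (borel (M × Ω)) (ae ρ) := by
    refine sup_le ?_ ?_
    · rintro _ ⟨s, hs, rfl⟩
      refine ⟨Prod.fst ⁻¹' s, ?_, EventuallyEq.rfl⟩
      have : Measurable[borel (M × Ω), borel M] (Prod.fst : M × Ω → M) :=
        continuous_fst.borel_measurable
      rw [BorelSpace.measurable_eq (α := M)] at hs
      exact this hs
    · rintro _ ⟨s, hs, rfl⟩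
      obtain ⟨t, ht, hst⟩ := hΩ s hs
      have : Measurable[borel (M × Ω), borel Ω] (Prod.snd : M × Ω → Ω) :=
        continuous_snd.borel_measurable
      exact ⟨Prod.snd ⁻¹' t, this ht, (⟨measurable_snd, hρ⟩ :
        Measure.QuasiMeasurePreserving Prod.snd ρ P).preimage_ae_eq hst⟩
  exact hle A hA

theorem exists_stronglyMeasurable_eLpNorm_indicator_sub_le {X : Type*} [MetricSpace X]
    [MeasurableSpace X] [BorelSpace X] {ρ : Measure X} [IsFiniteMeasure ρ] {B : Set X}
    (hB : MeasurableSet B) (c : ℝ) {ε : ℝ≥0∞} (hε : ε ≠ 0) :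
    ∃ v : X → ℝ, eLpNorm ((B.indicator fun _ => c) - v) 1 ρ ≤ ε ∧ Continuous v ∧
      StronglyMeasurable v := by
  obtain ⟨v, hv, -⟩ := (memLp_indicator_const 1 hB c
    (Or.inr (measure_ne_top ρ B))).exists_boundedContinuous_eLpNorm_sub_le ENNReal.one_ne_top hε
  exact ⟨v, hv, v.continuous, v.continuous.stronglyMeasurable⟩

/-- The σ-field on M × Ω may exceed the Borel field, so A is replaced by an almost equal Borel set
and the approximation takes place for the measure trimmed to the Borel field. -/
theorem exists_continuous_eLpNorm_indicator_sub_le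
    (hΩ : ∀ A : Set Ω, MeasurableSet A → ∃ B : Set Ω, MeasurableSet[borel Ω] B ∧ A =ᵐ[P] B)
    {ρ : Measure (M × Ω)} [IsFiniteMeasure ρ] (hρ : ρ.map Prod.snd ≪ P) {A : Set (M × Ω)}
    (hA : MeasurableSet A) (c : ℝ) {ε : ℝ≥0∞} (hε : ε ≠ 0) :
    ∃ v : M × Ω → ℝ, eLpNorm (v - A.indicator fun _ => c) 1 ρ ≤ ε ∧ Continuous v := by
  obtain ⟨B, hB, hAB⟩ := exists_borel_ae_eq hΩ hρ hA
  have hle : borel (M × Ω) ≤ (inferInstance : MeasurableSpace (M × Ω)) :=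
    OpensMeasurableSpace.borel_le
  have hae : (A.indicator fun _ => c) =ᵐ[ρ] (B.indicator fun _ => c) :=
    indicator_ae_eq_of_ae_eq_set hAB
  have hfin : IsFiniteMeasure (ρ.trim hle) := isFiniteMeasure_trim hle
  have hSM : StronglyMeasurable[borel (M × Ω)] (B.indicator fun _ => c) :=
    StronglyMeasurable.indicator (@stronglyMeasurable_const _ _ (borel _) _ c) hB
  obtain ⟨v, hv, hvc, hvm⟩ := @exists_stronglyMeasurable_eLpNorm_indicator_sub_le (M × Ω) _
    (borel _) (@BorelSpace.mk _ _ (borel _) rfl) (ρ.trim hle) hfin B hB c ε hε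
  refine ⟨v, ?_, hvc⟩
  rw [eLpNorm_trim hle (hSM.sub hvm)] at hv
  rw [eLpNorm_sub_comm, eLpNorm_congr_ae (hae.sub (ae_eq_refl v))]
  exact hv

/-- Integrable functions on `M × Ω` are approximated by continuous functions. -/
theorem exists_continuous_eLpNorm_sub_le
    (hΩ : ∀ A : Set Ω, MeasurableSet A → ∃ B : Set Ω, MeasurableSet[borel Ω] B ∧ A =ᵐ[P] B)
    {ρ : Measure (M × Ω)} [IsFiniteMeasure ρ] (hρ : ρ.map Prod.snd ≪ P) {w : M × Ω → ℝ}
    (hw : MemLp w 1 ρ) {ε : ℝ≥0∞} (hε : ε ≠ 0) :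
    ∃ v : M × Ω → ℝ, eLpNorm (w - v) 1 ρ ≤ ε ∧ Continuous v :=
  hw.induction_dense ENNReal.one_ne_top Continuous
    (fun c _ hs _ _ hε => exists_continuous_eLpNorm_indicator_sub_le hΩ hρ hs c hε)
    (fun _ _ hf hg => hf.add hg) (fun _ hf => hf.aestronglyMeasurable) hε

end Approximation

/-! ### From vague convergence to measurable test functions -/

section WeakStrong

variable {M : Type*} [MetricSpace M] [ProperSpace M] [MeasurableSpace M] [BorelSpace M]
  {G : Type*} [Group G] [Countable G] [MulAction G M] [IsIsometricSMul G M]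
  {Ω : Type*} [MetricSpace Ω] [CompactSpace Ω] [MeasurableSpace Ω] [OpensMeasurableSpace Ω]
  [MulAction G Ω] [MeasurableConstSMul G Ω] {P : Measure Ω}
  [IsProbabilityMeasure P] [SMulInvariantMeasure G Ω P] {m : Measure M}
  [IsFiniteMeasureOnCompacts m] [SMulInvariantMeasure G M m] {p : ℝ}
  (hΩ : ∀ A : Set Ω, MeasurableSet A → ∃ B : Set Ω, MeasurableSet[borel Ω] B ∧ A =ᵐ[P] B)
  {φ : M → ℝ} (hφc : Continuous φ) (hφs : HasCompactSupport φ) (hφ0 : ∀ x, 0 ≤ φ x)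
  (hφw : IsWeight G (fun x => ENNReal.ofReal (φ x)))
  {B₀ : Set M} (hB₀ : IsFundamentalRegion G B₀) (hmB₀ : m B₀ = 1)

include hΩ hφc hφs hφ0 hφw hB₀ hmB₀

/-- Vague convergence of couplings with a common first marginal improves to convergence against
functions which are merely measurable in the first variable and in `ω`. -/
theorem eventually_lintegral_le_of_vagueTendsto {qs : ℕ → Kernel Ω (M × M)}
    {q : Kernel Ω (M × M)} {μs : ℕ → Kernel Ω M} {μ : Kernel Ω M}
    (hqs : ∀ n, IsEquivariantCoupling G P (qs n) (Kernel.const Ω m) (μs n))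
    (hq : IsEquivariantCoupling G P q (Kernel.const Ω m) μ)
    (h : VagueTendsto (fun n => campbell P (qs n)) (campbell P q)) {u : M → ℝ}
    (huc : Continuous u) (hus : HasCompactSupport u) (hu0 : ∀ x, 0 ≤ u x) {W : M × Ω → ℝ≥0∞}
    (hW : Measurable W) (hW1 : ∀ z, W z ≤ 1) {ε : ℝ≥0∞} (hε : ε ≠ 0) :
    ∀ᶠ n in atTop,
      ∫⁻ z, ENNReal.ofReal (φ z.1.1) * ENNReal.ofReal (u z.1.2) * W (z.1.1, z.2)
        ∂campbell P (qs n) ≤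
      ∫⁻ z, ENNReal.ofReal (φ z.1.1) * ENNReal.ofReal (u z.1.2) * W (z.1.1, z.2)
        ∂campbell P q + ε := by
  rcases eq_or_ne ε ∞ with rfl | hεtop
  · simp
  have hsqs := fun n => (hqs n).isRandomMeasure.isSFiniteKernel
  have hsq := hq.isRandomMeasure.isSFiniteKernel
  have := fun n => (hqs n).isFiniteMeasureOnCompacts
  have := hq.isFiniteMeasureOnCompacts
  have hm : IsRandomMeasure (Kernel.const Ω m) := fun ω => by
    rw [Kernel.const_apply]; infer_instance
  have := hm.isSFiniteKernel
  -- This finite measure is the φ-weighted (x,ω)-marginal of every coupling involved, which is what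
  -- makes the approximation error uniform in n.
  set ρ := (campbell P (Kernel.const Ω m)).withDensity fun z => ENNReal.ofReal (φ z.1) with hρ
  have hρint : ∀ F : M × Ω → ℝ≥0∞, Measurable F → ∫⁻ z, F z ∂ρ =
      ∫⁻ z, ENNReal.ofReal (φ z.1) * F z ∂campbell P (Kernel.const Ω m) := fun F hF => by
    rw [hρ, lintegral_withDensity_eq_lintegral_mul _ (by fun_prop) hF]
    rfl
  have hρfin : IsFiniteMeasure ρ := ⟨by
    rw [← lintegral_one, hρint _ measurable_const]
    simp only [mul_one]
    rw [← expect_eq_lintegral_campbell P _ (f := fun x => ENNReal.ofReal (φ x)) (by fun_prop),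
      expect_const_of_isWeight hB₀ hmB₀ hφw]
    exact ENNReal.one_lt_top⟩
  have hρac : ρ.map Prod.snd ≪ P := by
    refine Measure.AbsolutelyContinuous.mk fun s hs hs0 => ?_
    rw [Measure.map_apply measurable_snd hs]
    refine withDensity_absolutelyContinuous _ _ ?_
    rw [← lintegral_indicator_one (measurable_snd hs), lintegral_campbell P _
      (measurable_one.indicator (measurable_snd hs))]
    refine (lintegral_congr_ae ((measure_eq_zero_iff_ae_notMem.1 hs0).mono fun ω hω => ?_)).trans
      lintegral_zero
    simp [indicator, hω]
  have hmarg : ∀ (κ : Kernel Ω (M × M)) [IsSFiniteKernel κ] (nu : Kernel Ω M),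
      IsEquivariantCoupling G P κ (Kernel.const Ω m) nu → ∀ F : M × Ω → ℝ≥0∞, Measurable F →
      ∫⁻ z, ENNReal.ofReal (φ z.1.1) * F (z.1.1, z.2) ∂campbell P κ = ∫⁻ z, F z ∂ρ := by
    intro κ _ nu hκ F hF
    rw [hρint F hF, ← map_campbell (κ := κ) measurable_fst (hκ.isCoupling.mono fun ω h => h.1),
      lintegral_map (f := fun z : M × Ω => ENNReal.ofReal (φ z.1) * F z) (by fun_prop)
        (by fun_prop)]
  obtain ⟨C, hC⟩ : ∃ C : ℝ, ∀ x, u x ≤ C := by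
    obtain ⟨C, hC⟩ := hus.exists_bound_of_continuous huc
    exact ⟨C, fun x => (Real.le_norm_self _).trans (hC x)⟩
  set C' : ℝ≥0∞ := ENNReal.ofReal C + 1 with hC'
  have hcmp : ∀ (κ : Kernel Ω (M × M)) [IsSFiniteKernel κ] (nu : Kernel Ω M),
      IsEquivariantCoupling G P κ (Kernel.const Ω m) nu → ∀ W₁ W₂ D : M × Ω → ℝ≥0∞,
      Measurable W₁ → Measurable W₂ → Measurable D → (∀ z, W₁ z ≤ W₂ z + D z) →
      ∫⁻ z, ENNReal.ofReal (φ z.1.1) * ENNReal.ofReal (u z.1.2) * W₁ (z.1.1, z.2) ∂campbell P κ ≤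
      ∫⁻ z, ENNReal.ofReal (φ z.1.1) * ENNReal.ofReal (u z.1.2) * W₂ (z.1.1, z.2) ∂campbell P κ +
        C' * ∫⁻ z, D z ∂ρ := by
    intro κ _ nu hκ W₁ W₂ D hW₁ hW₂ hD hle
    rw [← hmarg κ nu hκ D hD, ← lintegral_const_mul _ (by fun_prop),
      ← lintegral_add_left (by fun_prop)]
    refine lintegral_mono fun z => ?_
    have h1 : ENNReal.ofReal (u z.1.2) ≤ C' :=
      (ENNReal.ofReal_le_ofReal (hC _)).trans le_self_add
    calc _ ≤ ENNReal.ofReal (φ z.1.1) * ENNReal.ofReal (u z.1.2) *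
          (W₂ (z.1.1, z.2) + D (z.1.1, z.2)) := by gcongr; exact hle _
      _ = ENNReal.ofReal (φ z.1.1) * ENNReal.ofReal (u z.1.2) * W₂ (z.1.1, z.2) +
          ENNReal.ofReal (u z.1.2) * (ENNReal.ofReal (φ z.1.1) * D (z.1.1, z.2)) := by ring
      _ ≤ _ := by gcongr
  -- One third of ε each for replacing W by v under q_n, for the convergence, and for returning from
  -- v to W under q. The summand 1 in `C'` keeps it nonzero.
  set δ : ℝ≥0∞ := ε / (3 * C') with hδ
  have hC'top : 3 * C' ≠ ∞ := by simp only [hC']; finiteness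
  have hC'0 : 3 * C' ≠ 0 := by simp [hC']
  have hδ0 : δ ≠ 0 := (ENNReal.div_pos hε hC'top).ne'
  have hδε : C' * δ = ε / 3 := by
    have hne : C' ≠ 0 := by simp [hC']
    have hnt : C' ≠ ∞ := by simp only [hC']; finiteness
    rw [hδ, mul_comm 3 C', ← mul_div_assoc, ENNReal.mul_div_mul_left _ _ hne hnt]
  have hε3 : ε / 3 ≠ 0 := (ENNReal.div_pos hε (by simp)).ne'
  have hwmem : MemLp (fun z => (W z).toReal) 1 ρ :=
    MemLp.of_bound hW.ennreal_toReal.aestronglyMeasurable 1 (ae_of_all _ fun z => by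
      rw [Real.norm_of_nonneg ENNReal.toReal_nonneg]
      exact ENNReal.toReal_le_of_le_ofReal zero_le_one (by simpa using hW1 z))
  obtain ⟨v, hv, hvc⟩ := exists_continuous_eLpNorm_sub_le hΩ hρac hwmem hδ0
  rw [eLpNorm_one_eq_lintegral_enorm] at hv
  have hWr : ∀ z, ENNReal.ofReal (W z).toReal = W z := fun z =>
    ENNReal.ofReal_toReal (ne_top_of_le_ne_top ENNReal.one_ne_top (hW1 z))
  have htri : ∀ a b : ℝ, ENNReal.ofReal a ≤ ENNReal.ofReal b + ‖a - b‖ₑ := fun a b => by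
    calc ENNReal.ofReal a = ENNReal.ofReal (b + (a - b)) := by congr 1; ring
      _ ≤ ENNReal.ofReal b + ENNReal.ofReal (a - b) := ENNReal.ofReal_add_le
      _ ≤ _ := by gcongr; exact Real.ofReal_le_enorm _
  have hvm : Measurable fun z => ENNReal.ofReal (v z) := by fun_prop
  have hDm : Measurable fun z => ‖((fun z => (W z).toReal) - v) z‖ₑ := by
    have := hW.ennreal_toReal
    exact (this.sub hvc.measurable).enorm
  have h1 : ∀ z, W z ≤ ENNReal.ofReal (v z) + ‖((fun z => (W z).toReal) - v) z‖ₑ := fun z => by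
    conv_lhs => rw [← hWr z]
    exact htri _ _
  have h2 : ∀ z, ENNReal.ofReal (v z) ≤ W z + ‖((fun z => (W z).toReal) - v) z‖ₑ := fun z => by
    conv_rhs => rw [← hWr z, Pi.sub_apply, enorm_sub_rev]
    exact htri _ _
  have hconv : Tendsto (fun n => ∫⁻ z, ENNReal.ofReal (φ z.1.1) * ENNReal.ofReal (u z.1.2) *
      ENNReal.ofReal (v (z.1.1, z.2)) ∂campbell P (qs n)) atTop
      (𝓝 (∫⁻ z, ENNReal.ofReal (φ z.1.1) * ENNReal.ofReal (u z.1.2) *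
      ENNReal.ofReal (v (z.1.1, z.2)) ∂campbell P q)) := by
    -- The approximant v may be negative; its positive part is still continuous and gives the same
    -- value under `ENNReal.ofReal`.
    have hsupp : HasCompactSupport fun z : (M × M) × Ω =>
        φ z.1.1 * u z.1.2 * max 0 (v (z.1.1, z.2)) := by
      refine HasCompactSupport.intro (K := (tsupport φ ×ˢ tsupport u) ×ˢ univ)
        ((hφs.isCompact.prod hus.isCompact).prod isCompact_univ) fun z hz => ?_
      by_contra hne
      have hne' := left_ne_zero_of_mul hne
      exact hz ⟨⟨subset_tsupport _ (left_ne_zero_of_mul hne'),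
        subset_tsupport _ (right_ne_zero_of_mul hne')⟩, mem_univ _⟩
    have := tendsto_lintegral_of_vagueTendsto h (by fun_prop) hsupp fun z =>
      mul_nonneg (mul_nonneg (hφ0 _) (hu0 _)) (le_max_left _ _)
    have hfac : ∀ z : (M × M) × Ω, ENNReal.ofReal (φ z.1.1 * u z.1.2 * max 0 (v (z.1.1, z.2))) =
        ENNReal.ofReal (φ z.1.1) * ENNReal.ofReal (u z.1.2) * ENNReal.ofReal (v (z.1.1, z.2)) :=
      fun z => by
        rw [ENNReal.ofReal_mul (mul_nonneg (hφ0 _) (hu0 _)), ENNReal.ofReal_mul (hφ0 _)]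
        congr 1
        rcases le_total (v (z.1.1, z.2)) 0 with h0 | h0
        · rw [max_eq_left h0, ENNReal.ofReal_of_nonpos h0, ENNReal.ofReal_zero]
        · rw [max_eq_right h0]
    simpa only [hfac] using this
  have hlim_le := hcmp q μ hq _ _ _ hvm hW hDm h2
  rcases eq_or_ne (∫⁻ z, ENNReal.ofReal (φ z.1.1) * ENNReal.ofReal (u z.1.2) *
      ENNReal.ofReal (v (z.1.1, z.2)) ∂campbell P q) ∞ with htop | htop
  · rw [htop, top_le_iff, ENNReal.add_eq_top] at hlim_le
    rcases hlim_le with h3 | h3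
    · rw [h3]; simp
    · refine absurd h3 (ne_top_of_le_ne_top ?_ (mul_le_mul_right hv C'))
      rw [hδε]; finiteness
  filter_upwards [hconv.eventually_le_const (ENNReal.lt_add_right htop hε3)] with n hn
  have h3 : C' * ∫⁻ z, ‖((fun z => (W z).toReal) - v) z‖ₑ ∂ρ ≤ ε / 3 := by
    rw [← hδε]; gcongr
  calc _ ≤ _ := hcmp (qs n) (μs n) (hqs n) _ _ _ hW hvm hDm h1
    _ ≤ (_ + ε / 3 + ε / 3) + ε / 3 := by
      gcongr
      exact hn.trans (by gcongr; exact hlim_le.trans (by gcongr))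
    _ = _ := by
      rw [add_assoc, add_assoc, ← add_assoc (ε / 3), ENNReal.add_thirds]

/-- The near part of the cost of the composition of couplings converging to an optimal one is
eventually small. -/
theorem eventually_expect_glue_near_le (hp : 0 ≤ p) {qs : ℕ → Kernel Ω (M × M)}
    {q : Kernel Ω (M × M)} {μs : ℕ → Kernel Ω M} {μ : Kernel Ω M}
    (hqs : ∀ n, IsEquivariantCoupling G P (qs n) (Kernel.const Ω m) (μs n))
    (hq : IsEquivariantCoupling G P q (Kernel.const Ω m) μ)
    (h : VagueTendsto (fun n => campbell P (qs n)) (campbell P q)) {K : Kernel (Ω × M) M}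
    [IsMarkovKernel K] (hdiag : expect P (glue (q.map Prod.swap) K) (fun t =>
      ENNReal.ofReal (φ t.1.2) * {t : (M × M) × M | t.1.1 ≠ t.2}.indicator 1 t) = 0)
    {A : Set M} (hA : IsCompact A) {δ : ℝ} (hδ : 0 < δ) {ε : ℝ≥0∞} (hε : ε ≠ 0) :
    ∀ᶠ n in atTop, expect P (glue ((qs n).map Prod.swap) K) (fun t => ENNReal.ofReal (φ t.1.2) *
      (A.indicator 1 t.1.1 * A.indicator 1 t.2 * edist t.1.1 t.2 ^ p)) ≤
        ENNReal.ofReal (2 * δ) ^ p + ε := by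
  have hne : Nonempty M := by
    rcases B₀.eq_empty_or_nonempty with h | ⟨z, -⟩
    · simp [h] at hmB₀
    · exact ⟨z⟩
  have hsqs := fun n => (hqs n).isRandomMeasure.isSFiniteKernel
  have hsq := hq.isRandomMeasure.isSFiniteKernel
  set e : ℕ → M := TopologicalSpace.denseSeq M with he
  -- The points e 0, …, e N form a δ-net of A, and the nearest-point index cuts A into finitely many
  -- measurable cells.
  obtain ⟨N, hN⟩ : ∃ N, ∀ x ∈ A, ∃ k ≤ N, dist (e k) x < δ := by
    obtain ⟨t, ht⟩ := hA.elim_finite_subcover (fun k => Metric.ball (e k) δ)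
      (fun k => Metric.isOpen_ball) fun x _ => by
        obtain ⟨y, hy, k, rfl⟩ := Metric.dense_iff.1 (TopologicalSpace.denseRange_denseSeq M) x δ hδ
        exact mem_iUnion.2 ⟨k, by rwa [Metric.mem_ball, dist_comm] at hy⟩
    refine ⟨t.sup id, fun x hx => ?_⟩
    obtain ⟨k, hk, hxk⟩ := mem_iUnion₂.1 (ht hx)
    exact ⟨k, Finset.le_sup (f := id) hk, by rwa [dist_comm]⟩
  set ι := SimpleFunc.nearestPtInd e N with hι
  have hιd : ∀ x ∈ A, dist (e (ι x)) x ≤ δ := fun x hx => by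
    obtain ⟨k, hk, hkx⟩ := hN x hx
    have := SimpleFunc.edist_nearestPt_le e x hk
    rw [edist_dist, edist_dist, ENNReal.ofReal_le_ofReal_iff dist_nonneg] at this
    exact this.trans hkx.le
  obtain ⟨ψ, hψ1, -, hψs, hψ⟩ := exists_continuous_one_zero_of_isCompact hA isClosed_empty
    (disjoint_empty A)
  -- For y in A and z in the j-th cell this dominates d(y,z)^p, and it separates the variables:
  -- continuous and compactly supported in y, an indicator in z.
  set u : ℕ → M → ℝ := fun j y => (dist y (e j) + δ) ^ p * ψ y with hu
  have huc : ∀ j, Continuous (u j) := fun j => by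
    have : Continuous fun y => (dist y (e j) + δ) ^ p :=
      Continuous.rpow_const (by fun_prop) fun _ => Or.inr hp
    exact this.mul ψ.continuous
  have hus : ∀ j, HasCompactSupport (u j) := fun j => hψs.mul_left
  have hu0 : ∀ j y, 0 ≤ u j y := fun j y =>
    mul_nonneg (Real.rpow_nonneg (add_nonneg dist_nonneg hδ.le) _) (hψ y).1
  set C : ℕ → Set M := fun j => ι ⁻¹' {j} ∩ A with hC
  have hCm : ∀ j, MeasurableSet (C j) := fun j =>
    (ι.measurable (measurableSet_singleton j)).inter hA.measurableSet
  have hC1 : ∀ j, Measurable ((C j).indicator (1 : M → ℝ≥0∞)) := fun j =>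
    measurable_one.indicator (hCm j)
  have hle : ∀ y z : M, A.indicator 1 y * A.indicator 1 z * edist y z ^ p ≤
      ∑ j ∈ Finset.range (N + 1), ENNReal.ofReal (u j y) * (C j).indicator 1 z := fun y z => by
    by_cases hy : y ∈ A
    · by_cases hz : z ∈ A
      · refine le_trans ?_ (Finset.single_le_sum (f := fun j => ENNReal.ofReal (u j y) *
          (C j).indicator 1 z) (fun _ _ => zero_le) (Finset.mem_range.2
          (Nat.lt_succ_of_le (SimpleFunc.nearestPtInd_le e N z))))
        have hzC : z ∈ C (SimpleFunc.nearestPtInd e N z) := ⟨rfl, hz⟩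
        have hdp : edist y z ^ p ≤ ENNReal.ofReal ((dist y (e (ι z)) + δ) ^ p) := by
          rw [edist_dist, ENNReal.ofReal_rpow_of_nonneg dist_nonneg hp]
          refine ENNReal.ofReal_le_ofReal (Real.rpow_le_rpow dist_nonneg ?_ hp)
          linarith [dist_triangle y (e (ι z)) z, hιd z hz]
        simpa [hu, hy, hz, hzC, hψ1 hy] using hdp
      · simp [hz]
    · simp [hy]
  have hsum : ∀ κ : Kernel Ω ((M × M) × M), expect P κ (fun t => ENNReal.ofReal (φ t.1.2) *
      ∑ j ∈ Finset.range (N + 1), ENNReal.ofReal (u j t.1.1) * (C j).indicator 1 t.2) =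
      ∑ j ∈ Finset.range (N + 1), expect P κ (fun t => ENNReal.ofReal (φ t.1.2) *
        ENNReal.ofReal (u j t.1.1) * (C j).indicator 1 t.2) := fun κ => by
    have hmj : ∀ j, Measurable fun t : (M × M) × M => ENNReal.ofReal (φ t.1.2) *
        ENNReal.ofReal (u j t.1.1) * (C j).indicator 1 t.2 := fun j => by
      have := huc j; have := hC1 j; fun_prop
    simp only [expect]
    rw [← lintegral_finsetSum _ fun j _ => (hmj j).lintegral_kernel]
    refine lintegral_congr fun ω => ?_
    rw [← lintegral_finsetSum _ fun j _ => hmj j]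
    simp_rw [Finset.mul_sum, mul_assoc]
  have hF : ∀ j, Measurable fun z : M × M =>
      ENNReal.ofReal (φ z.1) * ENNReal.ofReal (u j z.2) := fun j => by
    have := huc j; fun_prop
  have hglue : ∀ (κ : Kernel Ω (M × M)) [IsSFiniteKernel κ] (j : ℕ),
      expect P (glue (κ.map Prod.swap) K) (fun t => ENNReal.ofReal (φ t.1.2) *
        ENNReal.ofReal (u j t.1.1) * (C j).indicator 1 t.2) =
      ∫⁻ z, ENNReal.ofReal (φ z.1.1) * ENNReal.ofReal (u j z.1.2) * K (z.2, z.1.1) (C j)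
        ∂campbell P κ := fun κ _ j =>
    expect_glue_swap_mul_indicator κ K (hF j) (hCm j)
  have hdiag_le : ∑ j ∈ Finset.range (N + 1), expect P (glue (q.map Prod.swap) K) (fun t =>
      ENNReal.ofReal (φ t.1.2) * ENNReal.ofReal (u j t.1.1) * (C j).indicator 1 t.2) ≤
      ENNReal.ofReal (2 * δ) ^ p := by
    rw [← hsum]
    have hne : MeasurableSet {t : (M × M) × M | t.1.1 ≠ t.2} :=
      (measurableSet_eq_fun (by fun_prop) (by fun_prop)).compl
    have hne1 : Measurable ({t : (M × M) × M | t.1.1 ≠ t.2}.indicator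
      (1 : (M × M) × M → ℝ≥0∞)) := measurable_one.indicator hne
    have hone : expect P (glue (q.map Prod.swap) K) (fun t => ENNReal.ofReal (φ t.1.2)) = 1 := by
      rw [← expect_const_of_isWeight (P := P) hB₀ hmB₀ hφw]
      refine lintegral_congr_ae (hq.isCoupling.mono fun ω hω => ?_)
      simp only
      rw [lintegral_glue_swap q K ω (by fun_prop), ← hω.1,
        lintegral_map (f := fun x => ENNReal.ofReal (φ x)) (by fun_prop) measurable_fst]
      simp
    -- On the diagonal only the cell of the point contributes, at most (2δ)^p. The infinite
    -- coefficient off the diagonal is harmless because that part has expectation zero.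
    calc expect P (glue (q.map Prod.swap) K) (fun t => ENNReal.ofReal (φ t.1.2) *
          ∑ j ∈ Finset.range (N + 1), ENNReal.ofReal (u j t.1.1) * (C j).indicator 1 t.2)
        ≤ expect P (glue (q.map Prod.swap) K) (fun t => ∞ * (ENNReal.ofReal (φ t.1.2) *
            {t : (M × M) × M | t.1.1 ≠ t.2}.indicator 1 t) +
            ENNReal.ofReal (2 * δ) ^ p * ENNReal.ofReal (φ t.1.2)) := expect_mono fun t => by
          by_cases hφt : ENNReal.ofReal (φ t.1.2) = 0
          · simp [hφt]
          by_cases ht : t.1.1 = t.2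
          · refine le_trans ?_ le_add_self
            rw [mul_comm]
            gcongr
            rw [ht]
            by_cases htA : t.2 ∈ A
            · rw [Finset.sum_eq_single (ι t.2)]
              · have htC : t.2 ∈ C (ι t.2) := ⟨rfl, htA⟩
                have hd := hιd t.2 htA
                rw [dist_comm] at hd
                simp only [hu, htC, indicator_of_mem, Pi.one_apply, mul_one, hψ1 htA]
                rw [ENNReal.ofReal_rpow_of_nonneg (by positivity) hp]
                refine ENNReal.ofReal_le_ofReal (Real.rpow_le_rpow
                  (add_nonneg dist_nonneg hδ.le) (by linarith) hp)
              · intro j _ hj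
                have htC : t.2 ∉ C j := fun htC => hj htC.1.symm
                simp [htC]
              · intro hj
                exact absurd (Finset.mem_range.2
                  (Nat.lt_succ_of_le (SimpleFunc.nearestPtInd_le e N t.2))) hj
            · rw [Finset.sum_eq_zero]
              · exact zero_le
              · intro j _
                have htC : t.2 ∉ C j := fun htC => htA htC.2
                simp [htC]
          · have : t ∈ {t : (M × M) × M | t.1.1 ≠ t.2} := ht
            rw [indicator_of_mem this, Pi.one_apply, mul_one, ENNReal.top_mul hφt]
            simp
      _ = ENNReal.ofReal (2 * δ) ^ p := by
          rw [expect_add (by fun_prop), expect_const_mul (by fun_prop), hdiag,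
            expect_const_mul (by fun_prop), hone]
          simp
  have hε' : ε / (N + 1 : ℕ) ≠ 0 := (ENNReal.div_pos hε (ENNReal.natCast_ne_top _)).ne'
  have hev := fun j => eventually_lintegral_le_of_vagueTendsto hΩ hφc hφs hφ0 hφw hB₀ hmB₀ hqs hq h
    (huc j) (hus j) (hu0 j) (W := fun z => K (z.2, z.1) (C j))
    ((K.measurable_coe (hCm j)).comp measurable_swap) (fun z => prob_le_one) hε'
  filter_upwards [(Finset.eventually_all (Finset.range (N + 1))).2 fun j _ => hev j] with n hn
  calc _ ≤ expect P (glue ((qs n).map Prod.swap) K) (fun t => ENNReal.ofReal (φ t.1.2) *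
        ∑ j ∈ Finset.range (N + 1), ENNReal.ofReal (u j t.1.1) * (C j).indicator 1 t.2) :=
        expect_mono fun t => by gcongr; exact hle _ _
    _ ≤ ∑ j ∈ Finset.range (N + 1), (expect P (glue (q.map Prod.swap) K) (fun t =>
          ENNReal.ofReal (φ t.1.2) * ENNReal.ofReal (u j t.1.1) * (C j).indicator 1 t.2) +
          ε / (N + 1 : ℕ)) := by
        rw [hsum]
        refine Finset.sum_le_sum fun j hj => ?_
        rw [hglue, hglue]
        exact hn j hj
    _ ≤ _ := by
        rw [Finset.sum_add_distrib, Finset.sum_const, Finset.card_range, nsmul_eq_mul]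
        gcongr
        exact ENNReal.mul_div_le

end WeakStrong

/-! ### Convergence in transport distance from vanishing far costs -/

section WeakStrong

variable {M : Type*} [MetricSpace M] [ProperSpace M] [MeasurableSpace M] [BorelSpace M]
  {G : Type*} [Group G] [Countable G] [MulAction G M] [IsIsometricSMul G M]
  {Ω : Type*} [MetricSpace Ω] [CompactSpace Ω] [MeasurableSpace Ω] [OpensMeasurableSpace Ω]
  [MulAction G Ω] [MeasurableConstSMul G Ω] {P : Measure Ω}
  [IsProbabilityMeasure P] [SMulInvariantMeasure G Ω P] {m : Measure M}
  [IsFiniteMeasureOnCompacts m] [SMulInvariantMeasure G M m] {p : ℝ}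

omit [ProperSpace M] [MeasurableSpace M] [BorelSpace M] in
/-- Splitting the cost of a detour into a part close to the middle point and two far parts. -/
theorem edist_rpow_le_near_add_far (hp : 0 ≤ p) {R : ℝ} {A S : Set M}
    (hSA : ∀ x ∈ S, ∀ y, dist x y ≤ R + 1 → y ∈ A) {x : M} (hx : x ∈ S) (y z : M) :
    edist y z ^ p ≤ A.indicator 1 y * A.indicator 1 z * edist y z ^ p +
      (2 ^ p * ENNReal.ofReal (farCost p R (x, y)) +
        2 ^ p * ENNReal.ofReal (farCost p R (x, z))) := by
  have htri : ∀ a b c : M, edist a b ≤ edist c b → edist a c ≤ 2 * edist c b := fun a b c h =>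
    (edist_triangle a b c).trans (by rw [two_mul, edist_comm b c]; gcongr)
  -- If one detour leg exceeds R + 1, then so does the longer leg. Its far cost is its full cost,
  -- and d(y,z) is at most twice its length.
  by_cases h : dist x y ≤ R + 1 ∧ dist x z ≤ R + 1
  · simp [hSA x hx y h.1, hSA x hx z h.2]
  · refine le_trans ?_ le_add_self
    rcases le_total (dist x y) (dist x z) with hle | hle
    · have hz : R + 1 ≤ dist x z := by
        by_contra hc
        exact h ⟨by linarith, by linarith⟩
      refine le_trans ?_ le_add_self
      rw [ofReal_farCost_eq hp hz, ← ENNReal.mul_rpow_of_nonneg _ _ hp]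
      refine ENNReal.rpow_le_rpow ?_ hp
      rw [edist_comm x z]
      refine htri y x z ?_
      rw [edist_dist, edist_dist, dist_comm y, dist_comm z]
      exact ENNReal.ofReal_le_ofReal hle
    · have hy : R + 1 ≤ dist x y := by
        by_contra hc
        exact h ⟨by linarith, by linarith⟩
      refine le_trans ?_ le_self_add
      rw [ofReal_farCost_eq hp hy, ← ENNReal.mul_rpow_of_nonneg _ _ hp]
      refine ENNReal.rpow_le_rpow ?_ hp
      rw [edist_comm x y, edist_comm y z]
      refine htri z x y ?_
      rw [edist_dist, edist_dist, dist_comm y, dist_comm z]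
      exact ENNReal.ofReal_le_ofReal hle

variable (hΩ : ∀ A : Set Ω, MeasurableSet A → ∃ B : Set Ω, MeasurableSet[borel Ω] B ∧ A =ᵐ[P] B)
  {φ : M → ℝ} (hφc : Continuous φ) (hφs : HasCompactSupport φ) (hφ0 : ∀ x, 0 ≤ φ x)
  (hφw : IsWeight G (fun x => ENNReal.ofReal (φ x)))
  {B₀ : Set M} (hB₀ : IsFundamentalRegion G B₀) (hmB₀ : m B₀ = 1)

omit [CompactSpace Ω] [MetricSpace Ω] [OpensMeasurableSpace Ω] in
include hφc hφw hB₀ hmB₀ in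
/-- The cost of the composition of two couplings which share the marginal `m`. -/
theorem optimalMeanCost_le_near_add_far (hp : 0 ≤ p) {q q' : Kernel Ω (M × M)} {μ μ' : Kernel Ω M}
    (hμ' : IsRandomMeasure μ') (hq' : IsEquivariantCoupling G P q' (Kernel.const Ω m) μ')
    (hq : IsEquivariantCoupling G P q (Kernel.const Ω m) μ) {K : Kernel (Ω × M) M}
    [IsMarkovKernel K] (hKe : IsEquivariantKernel G K)
    (hK : ∀ᵐ ω ∂P, IsResampling (q ω) (K.sectR ω)) (R : ℝ) {A : Set M} (hA : MeasurableSet A)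
    (hφA : ∀ x, φ x ≠ 0 → ∀ y, dist x y ≤ R + 1 → y ∈ A) :
    optimalMeanCost G P m p μ' μ ≤ expect P (glue (q'.map Prod.swap) K) (fun t =>
        ENNReal.ofReal (φ t.1.2) *
          (A.indicator 1 t.1.1 * A.indicator 1 t.2 * edist t.1.1 t.2 ^ p)) +
      (2 ^ p * expect P q' (fun z => ENNReal.ofReal (φ z.1) * ENNReal.ofReal (farCost p R z)) +
        2 ^ p * expect P q (fun z => ENNReal.ofReal (φ z.1) * ENNReal.ofReal (farCost p R z))) := by
  have := hq'.isRandomMeasure.isSFiniteKernel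
  have := hq.isRandomMeasure.isSFiniteKernel
  have hfc : Continuous (farCost p R : M × M → ℝ) := continuous_farCost hp
  have hF : Measurable fun z : M × M =>
      ENNReal.ofReal (φ z.1) * ENNReal.ofReal (farCost p R z) := by fun_prop
  have hA1 : Measurable (A.indicator (1 : M → ℝ≥0∞)) := measurable_one.indicator hA
  have hτ : Measurable fun t : (M × M) × M => (t.1.2, t.2) := by fun_prop
  have hτ' : Measurable fun t : (M × M) × M => t.1.swap := by fun_prop
  have h12 : ∀ ω, (glue (q'.map Prod.swap) K ω).map (fun t => t.1.swap) = q' ω := fun ω => by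
    have := map_fst_glue (q := q'.map Prod.swap) (K := K) ω
    rw [Kernel.map_apply _ measurable_swap] at this
    have h2 := congrArg (Measure.map Prod.swap) this
    rw [Measure.map_map measurable_swap measurable_fst,
      Measure.map_map measurable_swap measurable_swap, Prod.swap_swap_eq, Measure.map_id] at h2
    exact h2
  have h23 : ∀ᵐ ω ∂P, (glue (q'.map Prod.swap) K ω).map (fun t => (t.1.2, t.2)) = q ω := by
    filter_upwards [hK, hq'.isCoupling, hq.isCoupling] with ω h1 h2 h3
    refine map_snd_glue h1 ?_
    rw [Kernel.map_apply _ measurable_swap, Measure.map_map measurable_snd measurable_swap, h3.1,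
      ← h2.1]
    rfl
  have e1 : expect P q' (fun z => ENNReal.ofReal (φ z.1) * ENNReal.ofReal (farCost p R z)) =
      expect P (glue (q'.map Prod.swap) K) (fun t =>
        ENNReal.ofReal (φ t.1.2) * ENNReal.ofReal (farCost p R t.1.swap)) := by
    have : ∀ᵐ ω ∂P, q' ω = (glue (q'.map Prod.swap) K).map (fun t => t.1.swap) ω :=
      ae_of_all _ fun ω => by rw [Kernel.map_apply _ hτ', h12]
    rw [expect_congr this, expect_map hτ' hF]
    rfl
  have e2 : expect P q (fun z => ENNReal.ofReal (φ z.1) * ENNReal.ofReal (farCost p R z)) =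
      expect P (glue (q'.map Prod.swap) K) (fun t =>
        ENNReal.ofReal (φ t.1.2) * ENNReal.ofReal (farCost p R (t.1.2, t.2))) := by
    have : ∀ᵐ ω ∂P, q ω = (glue (q'.map Prod.swap) K).map (fun t => (t.1.2, t.2)) ω :=
      h23.mono fun ω h => by rw [Kernel.map_apply _ hτ, h]
    rw [expect_congr this, expect_map hτ hF]
  have hw : IsWeight G fun t : (M × M) × M => ENNReal.ofReal (φ t.1.2) :=
    hφw.comp (by fun_prop) fun _ _ => rfl
  have hle := optimalMeanCost_le_expect (P := P) (p := p) hB₀ hmB₀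
    ((hq'.isEquivariant.map measurable_swap fun _ _ => rfl).glue hKe) hμ' (nu := μ)
    (by
      filter_upwards [hq'.isCoupling] with ω hω
      rw [← hω.2, ← h12 ω, Measure.map_map measurable_snd hτ']; rfl)
    (by
      filter_upwards [h23, hq.isCoupling] with ω h h2
      rw [← h2.2, ← h, Measure.map_map measurable_snd hτ]; rfl) hw
  rw [e1, e2, ← expect_const_mul (by fun_prop), ← expect_const_mul (by fun_prop),
    ← expect_add (by fun_prop), ← expect_add (by fun_prop)]
  refine hle.trans (expect_mono fun t => ?_)
  by_cases hx : φ t.1.2 = 0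
  · simp [hx]
  · calc _ ≤ _ := mul_le_mul_right (edist_rpow_le_near_add_far hp (S := {x | φ x ≠ 0}) hφA hx
        t.1.1 t.2) _
      _ = _ := by
        rw [mul_add, mul_add, mul_left_comm _ ((2 : ℝ≥0∞) ^ p), mul_left_comm _ ((2 : ℝ≥0∞) ^ p)]
        rfl

include hΩ hφc hφs hφ0 hφw hB₀ hmB₀ in
/-- Vague convergence of optimal couplings together with the vanishing of the far parts of the
cost implies convergence of the random measures. -/
theorem tendsto_optimalMeanCost_of_tendsto_far (hB₀bdd : Bornology.IsBounded B₀) (hp : 1 ≤ p)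
    (hM : UniqueMongeSolutions p m) {qs : ℕ → Kernel Ω (M × M)} {q : Kernel Ω (M × M)}
    {μs : ℕ → Kernel Ω M} {μ : Kernel Ω M} (hμs : ∀ n, IsRandomMeasure (μs n))
    (hqs : ∀ n, IsEquivariantCoupling G P (qs n) (Kernel.const Ω m) (μs n))
    (hq : IsOptimalCoupling G P m p q (Kernel.const Ω m) μ) (hfin : meanCost G P m p q ≠ ∞)
    (h : VagueTendsto (fun n => campbell P (qs n)) (campbell P q))
    (hfar : Tendsto (fun k : ℕ => limsup (fun n => expect P (qs n) fun z =>
      ENNReal.ofReal (φ z.1) * ENNReal.ofReal (farCost p k z)) atTop) atTop (𝓝 0)) :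
    Tendsto (fun n => optimalMeanCost G P m p (μs n) μ) atTop (𝓝 0) := by
  have hp0 : 0 < p := by linarith
  have hne : Nonempty M := by
    rcases B₀.eq_empty_or_nonempty with h | ⟨z, -⟩
    · simp [h] at hmB₀
    · exact ⟨z⟩
  have hqe := hq.isEquivariantCoupling
  have := hqe.isRandomMeasure.isSFiniteKernel
  obtain ⟨K, hK, hKe, hKr⟩ := exists_equivariant_isResampling (P := P) hB₀ q hqe.isEquivariant (by
    filter_upwards [hqe.isCoupling] with ω hω
    have h1 : q ω (B₀ ×ˢ univ) = m B₀ := by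
      rw [← Kernel.const_apply m ω, ← hω.1, Measure.map_apply measurable_fst hB₀.measurableSet]
      congr 1; ext z; simp
    rw [h1, hmB₀]
    exact ENNReal.one_lt_top)
  have hdiag := hq.expect_glue_ne_eq_zero hB₀ hmB₀ hB₀bdd hp hM hfin hKe hKr
    (w := fun t => ENNReal.ofReal (φ t.1.2)) (hφw.comp (by fun_prop) fun _ _ => rfl)
  have hfarq := tendsto_expect_farCost hφc hφw hB₀ hmB₀ hp0.le hqe.isEquivariant hfin
  rw [ENNReal.tendsto_nhds_zero]
  intro ε hε
  rcases eq_or_ne ε ∞ with rfl | hεtop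
  · simp
  have h2p : (2 : ℝ≥0∞) ^ p ≠ ∞ := ENNReal.rpow_ne_top_of_nonneg hp0.le (by simp)
  -- The near part costs at most 2η, namely (2δ)^p and the convergence error, and each of the two
  -- far parts at most 2^p η.
  set η : ℝ≥0∞ := ε / (2 * 2 ^ p + 2) with hη
  have hη0 : 0 < η := ENNReal.div_pos hε.ne' (by finiteness)
  obtain ⟨k, hk1, hk2⟩ :=
    ((hfar.eventually_lt_const hη0).and (hfarq.eventually_lt_const hη0)).exists
  obtain ⟨δ, hδη, hδ⟩ : ∃ δ : ℝ, ENNReal.ofReal (2 * δ) ^ p < η ∧ 0 < δ := by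
    have h1 : Tendsto (fun δ : ℝ => ENNReal.ofReal (2 * δ) ^ p) (𝓝[>] 0)
        (𝓝 (ENNReal.ofReal (2 * 0) ^ p)) := by
      refine Filter.Tendsto.ennrpow_const _ (Tendsto.mono_left ?_ nhdsWithin_le_nhds)
      exact (ENNReal.continuous_ofReal.comp (continuous_const.mul continuous_id)).tendsto 0
    rw [mul_zero, ENNReal.ofReal_zero, ENNReal.zero_rpow_of_pos hp0] at h1
    exact ((h1.eventually_lt_const hη0).and self_mem_nhdsWithin).exists
  set A := Metric.cthickening (k + 1 : ℝ) (tsupport φ) with hAdef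
  have hA : IsCompact A := hφs.isCompact.cthickening
  have hφA : ∀ x, φ x ≠ 0 → ∀ y, dist x y ≤ (k : ℝ) + 1 → y ∈ A := fun x hx y hxy =>
    Metric.mem_cthickening_of_dist_le _ _ _ _ (subset_tsupport φ hx) (by rwa [dist_comm])
  filter_upwards [eventually_lt_of_limsup_lt hk1, eventually_expect_glue_near_le hΩ hφc hφs hφ0 hφw
    hB₀ hmB₀ hp0.le hqs hqe h hdiag hA hδ hη0.ne'] with n hn1 hn2
  calc optimalMeanCost G P m p (μs n) μ ≤ _ := optimalMeanCost_le_near_add_far hφc hφw hB₀ hmB₀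
        hp0.le (hμs n) (hqs n) hqe hKe hKr k hA.measurableSet hφA
    _ ≤ (η + η) + (2 ^ p * η + 2 ^ p * η) := by
        gcongr
        exact hn2.trans (by gcongr)
    _ = (2 * 2 ^ p + 2) * η := by ring
    _ ≤ ε := ENNReal.mul_div_le

end WeakStrong

/-! ### Translation into the transport distance and the tail condition -/

section Equivalences

variable {M : Type*} [MetricSpace M] [ProperSpace M] [MeasurableSpace M] [BorelSpace M]
  {G : Type*} [Group G] [Countable G] [MulAction G M] [IsIsometricSMul G M]
  {Ω : Type*} [MetricSpace Ω] [CompactSpace Ω] [MeasurableSpace Ω] [OpensMeasurableSpace Ω]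
  [MulAction G Ω] [MeasurableConstSMul G Ω] {P : Measure Ω}
  [IsProbabilityMeasure P] [SMulInvariantMeasure G Ω P] {m : Measure M}
  [IsFiniteMeasureOnCompacts m] [SMulInvariantMeasure G M m] {p : ℝ}
  (hΩ : ∀ A : Set Ω, MeasurableSet A → ∃ B : Set Ω, MeasurableSet[borel Ω] B ∧ A =ᵐ[P] B)
  (hfinite : ∀ B K : Set M, Bornology.IsBounded B → Bornology.IsBounded K →
    {g : G | ∃ x ∈ B, g • x ∈ K}.Finite)
  {B₀ : Set M} (hB₀ : IsFundamentalRegion G B₀) (hmB₀ : m B₀ = 1)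
  (hB₀bdd : Bornology.IsBounded B₀)

theorem tendsto_rpow_iff {r : ℝ} (hr : 0 < r) {u : ℕ → ℝ≥0∞} {a : ℝ≥0∞} :
    Tendsto (fun n => u n ^ r) atTop (𝓝 (a ^ r)) ↔ Tendsto u atTop (𝓝 a) := by
  refine ⟨fun h => ?_, fun h => h.ennrpow_const r⟩
  have := h.ennrpow_const r⁻¹
  simpa only [ENNReal.rpow_rpow_inv hr.ne'] using this

omit [IsFiniteMeasureOnCompacts m] [MetricSpace Ω] [CompactSpace Ω] [OpensMeasurableSpace Ω] in
include hB₀ hmB₀ in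
theorem IsOptimalCoupling.Wp_eq {q : Kernel Ω (M × M)} {μ : Kernel Ω M}
    (hq : IsOptimalCoupling G P m p q (Kernel.const Ω m) μ) :
    Wp G P m p μ (Kernel.const Ω m) = meanCost G P m p q ^ (1 / p) := by
  rw [Wp_comm hB₀ hmB₀, Wp, hq.meanCost_eq]

omit [IsFiniteMeasureOnCompacts m] [SMulInvariantMeasure G M m] [MetricSpace Ω] [CompactSpace Ω]
  [OpensMeasurableSpace Ω] [ProperSpace M] [BorelSpace M] [Countable G] [IsIsometricSMul G M]
  [MeasurableConstSMul G Ω] [IsProbabilityMeasure P] [SMulInvariantMeasure G Ω P] in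
theorem IsOptimalCoupling.meanCost_ne_top (hp : 0 < p) {q : Kernel Ω (M × M)} {μ : Kernel Ω M}
    (hq : IsOptimalCoupling G P m p q (Kernel.const Ω m) μ)
    (hfin : Wp G P m p (Kernel.const Ω m) μ ≠ ∞) : meanCost G P m p q ≠ ∞ := by
  rw [hq.meanCost_eq, ← Wp_rpow hp]
  exact ENNReal.rpow_ne_top_of_nonneg hp.le hfin

include hfinite hB₀ hmB₀ hB₀bdd

/-- For vaguely convergent optimal couplings, convergence of the transportation distances to `m`
is equivalent to uniform smallness of the costs of transports over large distances. -/
theorem tendsto_Wp_iff_tendsto_expectedCostOn (hp : 1 ≤ p) {qs : ℕ → Kernel Ω (M × M)}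
    {q : Kernel Ω (M × M)} {μs : ℕ → Kernel Ω M} {μ : Kernel Ω M}
    (hqs : ∀ n, IsOptimalCoupling G P m p (qs n) (Kernel.const Ω m) (μs n))
    (hq : IsOptimalCoupling G P m p q (Kernel.const Ω m) μ)
    (hfin : Wp G P m p (Kernel.const Ω m) μ ≠ ∞)
    (h : VagueTendsto (fun n => campbell P (qs n)) (campbell P q)) :
    Tendsto (fun n => Wp G P m p (μs n) (Kernel.const Ω m)) atTop
        (𝓝 (Wp G P m p μ (Kernel.const Ω m))) ↔
      Tendsto (fun R : ℝ => limsup (fun n => expectedCostOn P p (qs n)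
        (Metric.thickening R B₀)ᶜ B₀) atTop) atTop (𝓝 0) := by
  have hp0 : 0 < p := by linarith
  obtain ⟨φ, hφc, hφs, hφ0, hφw⟩ := exists_continuous_weight hfinite hB₀ hB₀bdd
  rw [← tendsto_far_iff_tendsto_expectedCostOn hφw hB₀ hB₀bdd hp0.le fun n =>
      (hqs n).isEquivariantCoupling.isEquivariant,
    ← tendsto_meanCost_iff_far hφc hφs hφ0 hφw hB₀ hmB₀ hp0.le
      (fun n => (hqs n).isEquivariantCoupling) hq.isEquivariantCoupling
      (hq.meanCost_ne_top hp0 hfin) h]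
  simp only [(hqs _).Wp_eq hB₀ hmB₀, hq.Wp_eq hB₀ hmB₀]
  exact tendsto_rpow_iff (by positivity)

include hΩ

/-- Vague convergence of optimal couplings together with uniform smallness of the costs of
transports over large distances implies convergence of the random measures. -/
theorem tendsto_Wp_zero_of_vagueTendsto (hp : 1 ≤ p) (hM : UniqueMongeSolutions p m)
    {qs : ℕ → Kernel Ω (M × M)} {q : Kernel Ω (M × M)} {μs : ℕ → Kernel Ω M} {μ : Kernel Ω M}
    (hμs : ∀ n, IsRandomMeasure (μs n))
    (hqs : ∀ n, IsOptimalCoupling G P m p (qs n) (Kernel.const Ω m) (μs n))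
    (hq : IsOptimalCoupling G P m p q (Kernel.const Ω m) μ)
    (hfin : Wp G P m p (Kernel.const Ω m) μ ≠ ∞)
    (h : VagueTendsto (fun n => campbell P (qs n)) (campbell P q))
    (hfar : Tendsto (fun R : ℝ => limsup (fun n => expectedCostOn P p (qs n)
      (Metric.thickening R B₀)ᶜ B₀) atTop) atTop (𝓝 0)) :
    Tendsto (fun n => Wp G P m p (μs n) μ) atTop (𝓝 0) := by
  have hp0 : 0 < p := by linarith
  obtain ⟨φ, hφc, hφs, hφ0, hφw⟩ := exists_continuous_weight hfinite hB₀ hB₀bdd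
  have h1 := tendsto_optimalMeanCost_of_tendsto_far hΩ hφc hφs hφ0 hφw hB₀ hmB₀ hB₀bdd hp hM hμs
    (fun n => (hqs n).isEquivariantCoupling) hq (hq.meanCost_ne_top hp0 hfin) h
    ((tendsto_far_iff_tendsto_expectedCostOn hφw hB₀ hB₀bdd hp0.le fun n =>
      (hqs n).isEquivariantCoupling.isEquivariant).2 hfar)
  have h2 := h1.ennrpow_const (1 / p)
  rwa [ENNReal.zero_rpow_of_pos (by positivity)] at h2

end Equivalences

end

end RandomTransport

/-! ### The proposition -/

theorem mainTheorem8
    {E : Type*} [NormedAddCommGroup E] [NormedSpace ℝ E] [FiniteDimensional ℝ E]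
    {M : Type*} [MetricSpace M] [ChartedSpace E M] [IsManifold 𝓘(ℝ, E) ((⊤ : ℕ∞) : WithTop ℕ∞) M]
    [RiemannianBundle (fun x : M => TangentSpace 𝓘(ℝ, E) x)]
    [IsContMDiffRiemannianBundle 𝓘(ℝ, E) ((⊤ : ℕ∞) : WithTop ℕ∞) E
      (fun x : M => TangentSpace 𝓘(ℝ, E) x)]
    [IsRiemannianManifold 𝓘(ℝ, E) M]
    [SecondCountableTopology M] [CompleteSpace M] [ConnectedSpace M] [NoncompactSpace M]
    [MeasurableSpace M] [BorelSpace M]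
    -- the group of isometries: properly discontinuous, cocompact, free
    {G : Type*} [Group G] [MulAction G M] [IsIsometricSMul G M]
    (hdisc : ∀ (x : M) (K : Set M), IsCompact K → {g : G | g • x ∈ K}.Finite)
    (hcocompact : CompactSpace (MulAction.orbitRel.Quotient G M))
    (hfree : ∀ (g : G) (x : M), g • x = x → g = 1)
    -- the fundamental region and the Riemannian volume measure, scaled so that `m B₀ = 1`
    -- (the Riemannian volume is, up to a constant, the Hausdorff measure of dimension `dim M`)
    (B₀ : Set M) (hB₀ : RandomTransport.IsFundamentalRegion G B₀)
    (hB₀bdd : Bornology.IsBounded B₀)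
    (m : Measure M) (hm : ∃ c : ℝ≥0, m = c • μH[(Module.finrank ℝ E : ℝ)]) (hmB₀ : m B₀ = 1)
    -- the probability space: a compact metric space whose `σ`-field lies between the Borel
    -- `σ`-field and its `P`-completion, with a measurable flow preserving `P`
    {Ω : Type*} [MetricSpace Ω] [CompactSpace Ω] [MeasurableSpace Ω] [OpensMeasurableSpace Ω]
    (P : Measure Ω) [IsProbabilityMeasure P]
    (hΩ : ∀ A : Set Ω, MeasurableSet A → ∃ B : Set Ω, MeasurableSet[borel Ω] B ∧ A =ᵐ[P] B)
    [MulAction G Ω] [MeasurableConstSMul G Ω] [SMulInvariantMeasure G Ω P]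
    -- the cost function `d^p`
    (p : ℝ) (hp : 1 ≤ p) (hMonge : RandomTransport.UniqueMongeSolutions p m)
    -- the random measures
    (μs : ℕ → Kernel Ω M) (μ : Kernel Ω M)
    (hμs : ∀ n, RandomTransport.MemPp G P m p (μs n)) (hμ : RandomTransport.MemPp G P m p μ) :
    -- i) implies ii)
    (Tendsto (fun n => RandomTransport.Wp G P m p (μs n) μ) atTop (𝓝 0) →
      RandomTransport.VagueTendsto (fun n => RandomTransport.campbell P (μs n))
          (RandomTransport.campbell P μ) ∧
        Tendsto (fun n => RandomTransport.Wp G P m p (μs n) (Kernel.const Ω m)) atTop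
          (𝓝 (RandomTransport.Wp G P m p μ (Kernel.const Ω m)))) ∧
    ∀ (qs : ℕ → Kernel Ω (M × M)) (q : Kernel Ω (M × M)),
      (∀ n, RandomTransport.IsOptimalCoupling G P m p (qs n) (Kernel.const Ω m) (μs n)) →
      RandomTransport.IsOptimalCoupling G P m p q (Kernel.const Ω m) μ →
      -- iii) is equivalent to iv)
      ((RandomTransport.VagueTendsto (fun n => RandomTransport.campbell P (qs n))
            (RandomTransport.campbell P q) ∧
          Tendsto (fun n => RandomTransport.Wp G P m p (μs n) (Kernel.const Ω m)) atTop
            (𝓝 (RandomTransport.Wp G P m p μ (Kernel.const Ω m)))) ↔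
        (RandomTransport.VagueTendsto (fun n => RandomTransport.campbell P (qs n))
            (RandomTransport.campbell P q) ∧
          Tendsto (fun R : ℝ => limsup (fun n => RandomTransport.expectedCostOn P p (qs n)
            (Metric.thickening R B₀)ᶜ B₀) atTop) atTop (𝓝 0))) ∧
      -- iii) implies i)
      ((RandomTransport.VagueTendsto (fun n => RandomTransport.campbell P (qs n))
            (RandomTransport.campbell P q) ∧
          Tendsto (fun n => RandomTransport.Wp G P m p (μs n) (Kernel.const Ω m)) atTop
            (𝓝 (RandomTransport.Wp G P m p μ (Kernel.const Ω m)))) →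
        Tendsto (fun n => RandomTransport.Wp G P m p (μs n) μ) atTop (𝓝 0)) ∧
      -- iv) implies i)
      ((RandomTransport.VagueTendsto (fun n => RandomTransport.campbell P (qs n))
            (RandomTransport.campbell P q) ∧
          Tendsto (fun R : ℝ => limsup (fun n => RandomTransport.expectedCostOn P p (qs n)
            (Metric.thickening R B₀)ᶜ B₀) atTop) atTop (𝓝 0)) →
        Tendsto (fun n => RandomTransport.Wp G P m p (μs n) μ) atTop (𝓝 0)) := by
  have : LocallyCompactSpace M := Manifold.locallyCompact_of_finiteDimensional 𝓘(ℝ, E)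
  have : ProperSpace M := RandomTransport.properSpace_of_cocompact
    (fun _ _ _ _ ha hb h => RandomTransport.exists_dist_le_dist_lt (E := E) ha hb h) hcocompact
  have : Countable G := RandomTransport.countable_of_properlyDiscontinuous hdisc
  -- Hausdorff measures are invariant under isometries.
  have : SMulInvariantMeasure G M m := by
    obtain ⟨c, rfl⟩ := hm
    infer_instance
  have : IsFiniteMeasureOnCompacts m := ⟨fun K hK =>
    RandomTransport.measure_lt_top_of_isBounded hdisc hB₀ hB₀bdd hmB₀ hK.isBounded⟩
  have hfinite : ∀ B K : Set M, Bornology.IsBounded B → Bornology.IsBounded K →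
      {g : G | ∃ x ∈ B, g • x ∈ K}.Finite := fun _ _ =>
    RandomTransport.finite_smul_inter hdisc
  refine ⟨fun h => ⟨?_, ?_⟩, fun qs q hqs hq => ?_⟩
  · exact RandomTransport.vagueTendsto_of_tendsto_Wp hB₀ hmB₀ (fun K => hfinite B₀ K hB₀bdd)
      (by linarith) (fun n => (hμs n).isRandomMeasure) hμ.isRandomMeasure
      (fun n => (hμs n).hasUnitIntensity) hμ.hasUnitIntensity h
  · refine RandomTransport.tendsto_Wp_of_tendsto_Wp_zero hB₀ hmB₀ hB₀bdd hp
      (fun n => (hμs n).isRandomMeasure) hμ.isRandomMeasure ?_ h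
    rw [RandomTransport.Wp_comm hB₀ hmB₀]
    exact hμ.finite.ne
  · have hiff := RandomTransport.tendsto_Wp_iff_tendsto_expectedCostOn hfinite hB₀ hmB₀ hB₀bdd hp
      hqs hq hμ.finite.ne
    have himp := RandomTransport.tendsto_Wp_zero_of_vagueTendsto hΩ hfinite hB₀ hmB₀ hB₀bdd hp
      hMonge (fun n => (hμs n).isRandomMeasure) hqs hq hμ.finite.ne
    -- The implication from iii) to i) passes through iv).
    exact ⟨and_congr_right hiff, fun h => himp h.1 ((hiff h.1).1 h.2), fun h => himp h.1 h.2⟩
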